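/- **Setting.** Fix $q\in\mathbb C$ with $|q|>1$ and write $q^{l}=e^{l\log q}$ for $l\in\mathbb R$ (principal determination of $\log q$). Write $D(0,r)$ for the open disc and $\dot D_{r}=D(0,r)\setminus\{0\}$. For subsets of $\mathbb C^*$ put $Uq^{-\mathbb N}=\{\epsilon q^{-n}:\epsilon\in U,n\in\mathbb N\}$, $\mathcal Tq^{\mathbb N}=\{tq^{n}: t\in\mathcal T, n\in\mathbb N\}$, $Vq^{\mathbb R_+}=\{\tau q^l:\tau\in V,l\ge 0\}$, $Vq^{\mathbb R}=\{\tau q^l:\tau\in V,l\in\mathbb R\}$. Let $M,A_1,C>0$, $S\ge 1$ an integer, $0<r_0\le 1$; for $0\le k\le S-1$ let $m_{0,k},m_{1,k}$ be positive integers and $b_k(\epsilon,z)=\sum_{s\in I_k}b_{ks}(\epsilon)z^s$ with $I_k\subset\mathbb N$ finite and $b_{ks}$ holomorphic and bounded on $D(0,r_0)$. *Good covering.* Let $\mathcal I$ be a finite family of pairs $I=(I_1,I_2)$ of open intervals of length $<1/4$, and $U_I=\{e^{2\pi i u}q^v:u\in I_1,v\in I_2\}$. Assume that $\bigcup_{I}U_Iq^{-\mathbb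 N}=\nu\setminus\{0\}$ for a neighbourhood $\nu$ of $0$, that any four different sets $U_Iq^{-\mathbb N}$ have empty intersection, and that $U_Iq^{-\mathbb N}\subseteq D(0,r_0)$ for all $I$. *Associated family.* Let $\delta>0$, $\rho_0>1$, and let $V_I$ ($I\in\mathcal I$) and $\mathcal T$ be open bounded subsets of $\mathbb C^*$ such that, for all $I$: $V_I\cap D(0,\rho_0)\ne\emptyset$; $|\tau+1|>\delta$ for $\tau\in V_Iq^{\mathbb R}$; $|1+\lambda/(\epsilon tq^r)|>\delta$ for all $t\in\mathcal T$, $\epsilon\in U_I$, $\lambda\in V_I\cap D(0,\rho_0)$, $r\in\mathbb R$; and $|t|\le1$ on $\mathcal T$. Choose $\lambda_I\in V_I\cap D(0,\rho_0)$. *$q$-Laplace transform.* Let $\Theta(x)=\sum_{n\in\mathbb Z}q^{-n(n-1)/2}x^n$, $\pi_q=\log (q)\prod_{n\ge0}(1-q^{-n-1})^{-1}$ and $$\mathcal L_{q;1}^{\lambda}F(z)=\frac1{\pi_q}\int_0^{\infty\lambda}\frac{F(\xi)}{\Theta(\xi/z)}\frac{d\xi}{\xi}$$ along the path $s\in(-\infty,\infty)\mapsto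 q^s\lambda$. *Initial data.* For $0\le j\le S-1$ let $W_j$ be bounded and holomorphic on $\dot D_{r_0}\times\dot D_{\rho_0}$ and, for each $I$, let $W_{I,j}$ be an analytic extension of $W_j|_{U_Iq^{-\mathbb N}\times\dot D_{\rho_0}}$ to $U_Iq^{-\mathbb N}\times(V_Iq^{\mathbb R_+}\cup\dot D_{\rho_0})$, such that for some $\Delta>0$ and $0<\tilde M<M$ (which may depend on $I,j$) both $|W_j(\epsilon,\tau)|$ and $|W_{I,j}(\epsilon,\tau)|$ are at most $\Delta e^{\tilde M\log^2|\tau/\epsilon|}$ on their domains. Put $\phi_{I,j}(\epsilon,t)=\mathcal L_{q;1}^{\lambda_I}(\tau\mapsto W_{I,j}(\epsilon,\tau))(\epsilon t)$. *Assumptions.* (A) $m_{0,k}\le C(S-k+s)$ and $m_{1,k}\ge 2(S-k+s)A_1$ for $0\le k\le S-1$, $s\in I_k$. (B) $M\le\frac1{2\log|q|}$. (C) $0<\xi,\bar\xi<1$ and there are $a_1,a_2,b_1,b_2,d_1,d_2>0$ with $\log|q|<\frac{b_1}{b_2}$; $\log|q|+\frac{\xi b_1}{2b_2}+\frac{d_1}{d_2}\left(M-\frac{\xi}{2\log|q|}\right)>0$;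 $M-\frac{\xi}{2\log|q|}+\frac{d_2}{d_1}\log|q|<0$; and $$A_1\left(1-\frac{d_2\log|q|}{d_1(\frac{\xi}{2\log|q|}-M)}\right)>\frac{C^2}{4\bar\xi\log|q|\,(\frac{\xi}{2\log|q|}-M)}+\frac{Ca_2}{a_1}.$$ **Theorem.** Under these assumptions, for every $I\in\mathcal I$ there is a formal solution $\sum_{\beta\ge0}W_{\beta}^I(\epsilon,\tau)z^\beta/\beta!$, with coefficients holomorphic on $U_Iq^{-\mathbb N}\times\big((V_Iq^{\mathbb R_+}\cup\dot D_{\rho_0})\setminus\{-1\}\big)$, of $$\partial_z^SW(\epsilon,\tau,z)=\sum_{k=0}^{S-1}\frac{b_k(\epsilon,z)\,\tau^{m_{0,k}}}{(\tau+1)\epsilon^{m_{0,k}}}(\partial_z^kW)(\epsilon,\tau,zq^{-m_{1,k}}),\qquad(\partial_z^jW)(\epsilon,\tau,0)=W_{I,j}(\epsilon,\tau),\quad 0\le j\le S-1,$$ such that $$X_I(\epsilon,t,z)=\sum_{\beta\ge0}\mathcal L_{q;1}^{\lambda_I}(W_\beta^I(\epsilon,\cdot))(\epsilon t)\frac{z^\beta}{\beta!}$$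 (with absolutely convergent integrals and convergent series) is holomorphic on $U_Iq^{-\mathbb N}\times\mathcal Tq^{\mathbb N}\times\mathbb C$, is bounded on $U_Iq^{-\mathbb N}\times\mathcal T\times D(0,\rho)$ for every $\rho>0$, and solves there (for $\epsilon\in U_Iq^{-\mathbb N}$, $t\in\mathcal Tq^{\mathbb N}$, $z\in\mathbb C$) the Cauchy problem $$\epsilon t\,\partial_z^SX_I(\epsilon,qt,z)+\partial_z^SX_I(\epsilon,t,z)=\sum_{k=0}^{S-1}b_k(\epsilon,z)(t\sigma_q)^{m_{0,k}}(\partial_z^kX_I)(\epsilon,t,zq^{-m_{1,k}}),\qquad (\partial_z^jX_I)(\epsilon,t,0)=\phi_{I,j}(\epsilon,t),\quad 0\le j\le S-1,$$ where $(\sigma_qX)(\epsilon,t,z)=X(\epsilon,qt,z)$. Moreover, for every $\rho>0$ and all $I,I'\in\mathcal I$ with $U_Iq^{-\mathbb N}\cap U_{I'}q^{-\mathbb N}\neq\emptyset$ there is $C_1>0$ such that $$|X_I(\epsilon,t,z)-X_{I'}(\epsilon,t,z)|\le C_1e^{-\frac1A\log^2|\epsilon|},\qquad(\epsilon,t,z)\in(U_Iq^{-\mathbb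 N}\cap U_{I'}q^{-\mathbb N})\times\mathcal T\times D(0,\rho),$$ with $\frac1A=(1-\bar\xi)\left(\frac{\xi}{2\log|q|}-M\right)$. -/

import Mathlib

noncomputable section

namespace QGevrey

/-- The point `q ^ l` of the continuous `q`-spiral, `l` real (principal determination of `log q`). -/
def qpow (q : ℂ) (l : ℝ) : ℂ := Complex.exp ((l : ℂ) * Complex.log q)

/-- The discrete spiral `U q^{-ℕ}`. -/
def spiralDown (q : ℂ) (U : Set ℂ) : Set ℂ :=
  {x | ∃ ε ∈ U, ∃ n : ℕ, x = ε * (q ^ n)⁻¹}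

/-- The discrete spiral `T q^{ℕ}`. -/
def spiralUp (q : ℂ) (T : Set ℂ) : Set ℂ :=
  {x | ∃ t ∈ T, ∃ n : ℕ, x = t * q ^ n}

/-- The continuous spiral `V q^{ℝ₊}`. -/
def contSpiralUp (q : ℂ) (V : Set ℂ) : Set ℂ :=
  {x | ∃ τ ∈ V, ∃ l : ℝ, 0 ≤ l ∧ x = τ * qpow q l}

/-- The continuous spiral `V q^{ℝ}`. -/
def contSpiral (q : ℂ) (V : Set ℂ) : Set ℂ :=
  {x | ∃ τ ∈ V, ∃ l : ℝ, x = τ * qpow q l}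

/-- The punctured open disc of radius `r` about the origin. -/
def puncturedDisc (r : ℝ) : Set ℂ := Metric.ball 0 r \ {0}

/-- A pair `I = (I₁, I₂)` of open intervals `I₁ = (u₀, u₁)`, `I₂ = (v₀, v₁)` of length smaller
than `1/4`. -/
structure IntervalPair where
  u₀ : ℝ
  u₁ : ℝ
  v₀ : ℝ
  v₁ : ℝ
  hu : u₀ < u₁
  hv : v₀ < v₁
  hu' : u₁ - u₀ < 1 / 4
  hv' : v₁ - v₀ < 1 / 4

/-- The open set `U_I = {e^{2π i u} q^v : u ∈ I₁, v ∈ I₂}`. -/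
def IntervalPair.U (q : ℂ) (I : IntervalPair) : Set ℂ :=
  {x | ∃ u ∈ Set.Ioo I.u₀ I.u₁, ∃ v ∈ Set.Ioo I.v₀ I.v₁,
    x = Complex.exp (2 * Real.pi * Complex.I * (u : ℂ)) * qpow q v}

/-- `(U_I q^{-ℕ})` is a good covering: the union is a punctured neighbourhood of the origin and
any four different members have empty intersection. -/
structure IsGoodCovering {ι : Type*} (q : ℂ) (J : ι → IntervalPair) : Prop where
  covers : ∃ ν ∈ nhds (0 : ℂ), (⋃ i, spiralDown q ((J i).U q)) = ν \ {0}
  four_disjoint : ∀ i₁ i₂ i₃ i₄ : ι, i₁ ≠ i₂ → i₁ ≠ i₃ → i₁ ≠ i₄ → i₂ ≠ i₃ → i₂ ≠ i₄ → i₃ ≠ i₄ →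
    spiralDown q ((J i₁).U q) ∩ spiralDown q ((J i₂).U q) ∩ spiralDown q ((J i₃).U q) ∩
      spiralDown q ((J i₄).U q) = ∅

/-- The family of open bounded sets `{(V_I), T}` of `ℂ \ {0}` is associated to the good
covering, with parameters `δ > 0` and `ρ₀ > 1`. -/
structure IsAssociatedFamily {ι : Type*} (q : ℂ) (J : ι → IntervalPair) (δ ρ₀ : ℝ)
    (V : ι → Set ℂ) (T : Set ℂ) : Prop where
  isOpen_V : ∀ i, IsOpen (V i)
  bounded_V : ∀ i, Bornology.IsBounded (V i)
  zero_notMem_V : ∀ i, (0 : ℂ) ∉ V i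
  isOpen_T : IsOpen T
  bounded_T : Bornology.IsBounded T
  zero_notMem_T : (0 : ℂ) ∉ T
  delta_pos : 0 < δ
  one_lt_rho : 1 < ρ₀
  inter_nonempty : ∀ i, (V i ∩ Metric.ball 0 ρ₀).Nonempty
  far_from_neg_one : ∀ i, ∀ τ ∈ contSpiral q (V i), δ < ‖τ + 1‖
  far_from_zeros : ∀ i, ∀ t ∈ T, ∀ ε ∈ (J i).U q, ∀ l ∈ V i ∩ Metric.ball 0 ρ₀, ∀ r : ℝ,
    δ < ‖1 + l / (ε * t * qpow q r)‖
  norm_le_one : ∀ t ∈ T, ‖t‖ ≤ 1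

/-- The set `{W, W_{UV}, ρ₀}` is admissible: `W` is bounded and holomorphic on the product of
punctured discs, `W_{UV}` is an analytic extension of it to
`U q^{-ℕ} × (V q^{ℝ₊} ∪ puncturedDisc ρ₀)`, and both satisfy the `q`-exponential bound. -/
def IsAdmissible (q : ℂ) (M r₀ ρ₀ : ℝ) (U V : Set ℂ) (W WUV : ℂ → ℂ → ℂ) : Prop :=
  ∃ Δ Mt : ℝ, 0 < Δ ∧ 0 < Mt ∧ Mt < M ∧
    DifferentiableOn ℂ (fun p : ℂ × ℂ => W p.1 p.2) (puncturedDisc r₀ ×ˢ puncturedDisc ρ₀) ∧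
    (∃ B : ℝ, ∀ ε ∈ puncturedDisc r₀, ∀ τ ∈ puncturedDisc ρ₀, ‖W ε τ‖ ≤ B) ∧
    (∀ ε ∈ puncturedDisc r₀, ∀ τ ∈ puncturedDisc ρ₀,
      ‖W ε τ‖ ≤ Δ * Real.exp (Mt * Real.log ‖τ / ε‖ ^ 2)) ∧
    DifferentiableOn ℂ (fun p : ℂ × ℂ => WUV p.1 p.2)
      (spiralDown q U ×ˢ (contSpiralUp q V ∪ puncturedDisc ρ₀)) ∧
    (∀ ε ∈ spiralDown q U, ∀ τ ∈ puncturedDisc ρ₀, WUV ε τ = W ε τ) ∧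
    (∀ ε ∈ spiralDown q U, ∀ τ ∈ contSpiralUp q V ∪ puncturedDisc ρ₀,
      ‖WUV ε τ‖ ≤ Δ * Real.exp (Mt * Real.log ‖τ / ε‖ ^ 2))

/-- The Jacobi theta function `∑_{n ∈ ℤ} q^{-n(n-1)/2} x^n`. -/
def theta (q x : ℂ) : ℂ := ∑' n : ℤ, q ^ (-(n * (n - 1) / 2)) * x ^ n

/-- The constant `π_q = log q ∏_{n ≥ 0} (1 - q^{-n-1})⁻¹`. -/
def piq (q : ℂ) : ℂ := Complex.log q * ∏' n : ℕ, (1 - (q ^ (n + 1))⁻¹)⁻¹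

/-- The integrand of the `q`-Laplace transform at `z`, i.e. the form
`F(ξ) / Θ(ξ / z) dξ / ξ` pulled back along `s ↦ ξ = q^s l`, for which `dξ = (log q) ξ ds`. -/
def qLaplaceIntegrand (q l : ℂ) (F : ℂ → ℂ) (z : ℂ) (s : ℝ) : ℂ :=
  F (qpow q s * l) / (theta q (qpow q s * l / z) * (qpow q s * l)) *
    (Complex.log q * (qpow q s * l))

/-- The `q`-Laplace transform of `F` following the direction `[l]`. -/
def qLaplace (q l : ℂ) (F : ℂ → ℂ) (z : ℂ) : ℂ :=
  (piq q)⁻¹ * ∫ s : ℝ, qLaplaceIntegrand q l F z s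

/-- The operator `t σ_q : f ↦ (t ↦ t f(q t))`. -/
def tSigma (q : ℂ) (f : ℂ → ℂ) : ℂ → ℂ := fun t => t * f (q * t)

/-- The coefficients `b_k(ε, z) = ∑_{s ∈ I_k} b_{ks}(ε) z^s`. -/
def bPoly (Is : ℕ → Finset ℕ) (b : ℕ → ℕ → ℂ → ℂ) (k : ℕ) (ε z : ℂ) : ℂ :=
  ∑ s ∈ Is k, b k s ε * z ^ s

/-- The same polynomial as a formal power series in `z`. -/
def bSeries (Is : ℕ → Finset ℕ) (b : ℕ → ℕ → ℂ → ℂ) (k : ℕ) (ε : ℂ) : PowerSeries ℂ :=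
  ∑ s ∈ Is k, PowerSeries.C (b k s ε) * PowerSeries.X ^ s

/-- The growth conditions `m_{0,k} ≤ C (S - k + s)` and `m_{1,k} ≥ 2 (S - k + s) A₁`
for all `0 ≤ k < S`, `s ∈ I_k`. -/
def AssumptionA (S : ℕ) (Is : ℕ → Finset ℕ) (m₀ m₁ : ℕ → ℕ) (A₁ C : ℝ) : Prop :=
  ∀ k < S, ∀ s ∈ Is k,
    (m₀ k : ℝ) ≤ C * ((S : ℝ) - k + s) ∧ 2 * ((S : ℝ) - k + s) * A₁ ≤ (m₁ k : ℝ)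

/-- The smallness conditions on `log |q|` relating `M`, `A₁`, `C` and `ξ, ξ' ∈ (0, 1)`
(`ξ'` stands for `ξ` with a bar). -/
def AssumptionC (q : ℂ) (M A₁ C ξ ξ' : ℝ) : Prop :=
  0 < ξ ∧ ξ < 1 ∧ 0 < ξ' ∧ ξ' < 1 ∧
  ∃ a₁ a₂ b₁ b₂ d₁ d₂ : ℝ, 0 < a₁ ∧ 0 < a₂ ∧ 0 < b₁ ∧ 0 < b₂ ∧ 0 < d₁ ∧ 0 < d₂ ∧
    Real.log ‖q‖ < b₁ / b₂ ∧
    0 < Real.log ‖q‖ + ξ * b₁ / (2 * b₂) + d₁ / d₂ * (M - ξ / (2 * Real.log ‖q‖)) ∧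
    M - ξ / (2 * Real.log ‖q‖) + d₂ / d₁ * Real.log ‖q‖ < 0 ∧
    C ^ 2 / (4 * ξ' * Real.log ‖q‖ * (ξ / (2 * Real.log ‖q‖) - M)) + C * a₂ / a₁ <
      A₁ * (1 - d₂ * Real.log ‖q‖ / (d₁ * (ξ / (2 * Real.log ‖q‖) - M)))

/-- The formal series `∑_β W_β(ε, τ) z^β / β!`. -/
def formalSeries (W : ℕ → ℂ → ℂ → ℂ) (ε τ : ℂ) : PowerSeries ℂ :=
  PowerSeries.mk fun β => W β ε τ / (β.factorial : ℂ)

/-- `∑_β W_β(ε, τ) z^β / β!` is, for every `(ε, τ) ∈ E × D`, a formal solution in `z` of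
`∂_z^S W = ∑_{k<S} b_k(ε, z) / ((τ + 1) ε^{m_{0,k}}) τ^{m_{0,k}} (∂_z^k W)(ε, τ, z q^{-m_{1,k}})`
with `∂_z^j W (ε, τ, 0) = w_j(ε, τ)` for `0 ≤ j < S`. -/
def IsFormalSolution (q : ℂ) (S : ℕ) (Is : ℕ → Finset ℕ) (b : ℕ → ℕ → ℂ → ℂ) (m₀ m₁ : ℕ → ℕ)
    (w : ℕ → ℂ → ℂ → ℂ) (E D : Set ℂ) (W : ℕ → ℂ → ℂ → ℂ) : Prop :=
  ∀ ε ∈ E, ∀ τ ∈ D,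
    (PowerSeries.derivative ℂ)^[S] (formalSeries W ε τ) =
      ∑ k ∈ Finset.range S, PowerSeries.C (τ ^ m₀ k / ((τ + 1) * ε ^ m₀ k)) * bSeries Is b k ε *
        PowerSeries.rescale ((q ^ m₁ k)⁻¹)
          ((PowerSeries.derivative ℂ)^[k] (formalSeries W ε τ)) ∧
    ∀ j < S, PowerSeries.constantCoeff ((PowerSeries.derivative ℂ)^[j] (formalSeries W ε τ)) =
      w j ε τ

/-- `X` solves the singularly perturbed `q`-difference-differential equation
`ε t ∂_z^S X(ε, q t, z) + ∂_z^S X(ε, t, z)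
  = ∑_{k<S} b_k(ε, z) (t σ_q)^{m_{0,k}} (∂_z^k X)(ε, t, z q^{-m_{1,k}})`
at every `(ε, t, z) ∈ E × D × ℂ`. -/
def SolvesEquation (q : ℂ) (S : ℕ) (Is : ℕ → Finset ℕ) (b : ℕ → ℕ → ℂ → ℂ) (m₀ m₁ : ℕ → ℕ)
    (E D : Set ℂ) (X : ℂ → ℂ → ℂ → ℂ) : Prop :=
  ∀ ε ∈ E, ∀ t ∈ D, ∀ z : ℂ,
    ε * t * iteratedDeriv S (X ε (q * t)) z + iteratedDeriv S (X ε t) z =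
      ∑ k ∈ Finset.range S, bPoly Is b k ε z *
        (tSigma q)^[m₀ k] (fun t' => iteratedDeriv k (X ε t') (z * (q ^ m₁ k)⁻¹)) t

end QGevrey

end

namespace QGevrey

open Set Filter Topology MeasureTheory

/-! ### The continuous spiral `q ^ l` and its norm. -/

section qpow

variable {q : ℂ}

/-! Since Θ(qx) = q x Θ(x), the q-Laplace transform, evaluated at εt, turns multiplication by τ/ε
into t σ_q (`qLaplaceIntegrand_mul`, `tSigma_iterate_qLaplace`). The operator εtσ_q + 1 on the left
of the equation thus corresponds to multiplication by τ + 1, and the Cauchy problem becomes an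
explicit recursion in the τ-plane (`auxCoeff`), which transforms back to the equation
(`solvesEquation`).

Everything else compares Gaussian rates in logarithms. Put L = log|q| and let y be the positive part
of log|τ/ε|. The data grow at most like exp(M y²) (`IsAdmissible.exists_norm_le`). Assumption (A)
turns the recursion into |W_n| ≤ n! D K^n exp(M y² + C n y - A₁ L n²) (`exists_norm_auxCoeff_le`).
Completing the square in n trades the cross term for a larger rate M', allowed as soon as C² < 4 A₁
L (M' - M), and leaves a factor exp(-c n²) that makes the series entire in z
(`exists_auxCoeff_majorant`).

On the other side, the kernel 1/Θ decays at every rate P < 1/(2L), uniformly at positive angular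
distance from the spiral of its poles (`exists_theta_lower_bound`). This rests on the zeros of Θ
being exactly on -q^ℤ (`theta_eq_zero_imp`). With P = ξ/(2L) > M' the integrals converge, uniformly
for |t| ≤ 1, and depend holomorphically on the parameters. Assumption (C) supplies an M' that also
satisfies 1/A < P - M' (`AssumptionC.exists_rate`).

For the flatness, both directions are normalised to modulus 1 and the two integrals are cut at |τ| =
1/2. The outer parts only see log|τ/ε| ≥ -log|ε| - log 2, so they are of size exp(-(P - M')(-log|ε|
- log 2)²) (`exists_norm_tail_le`). On the inner parts the integrands coincide, because both sets of
initial data extend the same function. The paths are deformed into each other on the side that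
avoids the poles of 1/Θ, and only the arc |τ| = 1/2 contributes, with the same size
(`exists_norm_head_sub_le`). The strict inequality 1/A < P - M' absorbs the shift by log 2
(`flat_exponent_le`). -/

lemma qpow_add (q : ℂ) (a b : ℝ) : qpow q (a + b) = qpow q a * qpow q b := by
  simp [qpow, add_mul, Complex.exp_add]

lemma qpow_ne_zero (q : ℂ) (a : ℝ) : qpow q a ≠ 0 := Complex.exp_ne_zero _

lemma qpow_neg (q : ℂ) (a : ℝ) : qpow q (-a) = (qpow q a)⁻¹ := by
  simp [qpow, Complex.exp_neg]

lemma qpow_intCast (hq : q ≠ 0) (n : ℤ) : qpow q n = q ^ n := by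
  have : qpow q n = Complex.exp (n * Complex.log q) := by simp [qpow]
  rw [this, Complex.exp_int_mul, Complex.exp_log hq]

lemma qpow_natCast (hq : q ≠ 0) (n : ℕ) : qpow q n = q ^ n := by
  simpa using qpow_intCast hq (n : ℤ)

lemma norm_qpow (q : ℂ) (a : ℝ) : ‖qpow q a‖ = Real.exp (a * Real.log ‖q‖) := by
  simp [qpow, Complex.norm_exp, Complex.log_re]

lemma log_norm_qpow_mul (q : ℂ) (a : ℝ) {x : ℂ} (hx : x ≠ 0) :
    Real.log ‖qpow q a * x‖ = a * Real.log ‖q‖ + Real.log ‖x‖ := by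
  rw [norm_mul, Real.log_mul (by simp [qpow_ne_zero]) (by simpa using hx), norm_qpow,
    Real.log_exp]

lemma continuous_qpow (q : ℂ) : Continuous (qpow q) := by
  unfold qpow; fun_prop

lemma ne_zero_of_one_lt_norm (hq : 1 < ‖q‖) : q ≠ 0 := by
  rintro rfl; simp at hq; linarith

end qpow

/-! ### The theta function: holomorphy, functional equation, and the two product factors. -/

section theta

variable {q : ℂ}

/-- Convergence and holomorphy of Θ are imported from Jacobi's two-variable theta function through
the substitution x = exp w. The integer division by 2 is exact because n(n-1) is even. -/
lemma theta_term_eq (hq : q ≠ 0) (w : ℂ) (n : ℤ) :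
    q ^ (-(n * (n - 1) / 2)) * Complex.exp w ^ n =
      jacobiTheta₂_term n ((w + Complex.log q / 2) / (2 * Real.pi * Complex.I))
        (Complex.I * Complex.log q / (2 * Real.pi)) := by
  obtain ⟨k, hk⟩ : ∃ k : ℤ, n * (n - 1) = 2 * k := by
    have := Int.even_mul_pred_self n
    obtain ⟨k, hk⟩ := this
    exact ⟨k, by rw [hk]; ring⟩
  have hk' : (n : ℂ) * (n - 1) = 2 * k := by exact_mod_cast hk
  have h2 : n * (n - 1) / 2 = k := by omega
  rw [h2, jacobiTheta₂_term, ← Complex.exp_int_mul]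
  have hqk : q ^ (-k) = Complex.exp ((-k : ℤ) * Complex.log q) := by
    rw [Complex.exp_int_mul, Complex.exp_log hq]
  rw [hqk, ← Complex.exp_add]
  congr 1
  have hpi : (Real.pi : ℂ) ≠ 0 := by exact_mod_cast Real.pi_ne_zero
  push_cast
  field_simp
  rw [Complex.I_sq]
  linear_combination Complex.log q * hk'

lemma im_theta_modulus_pos (hq : 1 < ‖q‖) :
    0 < (Complex.I * Complex.log q / (2 * Real.pi)).im := by
  have h : Complex.I * Complex.log q / (2 * Real.pi) =
      ((1 / (2 * Real.pi) : ℝ) : ℂ) * (Complex.I * Complex.log q) := by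
    push_cast; ring
  rw [h, Complex.im_ofReal_mul]
  have := Real.log_pos hq
  have h3 := Real.pi_pos
  simp [Complex.log_re]
  positivity

lemma theta_exp (hq : 1 < ‖q‖) (w : ℂ) :
    theta q (Complex.exp w) =
      jacobiTheta₂ ((w + Complex.log q / 2) / (2 * Real.pi * Complex.I))
        (Complex.I * Complex.log q / (2 * Real.pi)) := by
  unfold theta jacobiTheta₂
  exact tsum_congr fun n => theta_term_eq (ne_zero_of_one_lt_norm hq) w n

lemma summable_theta (hq : 1 < ‖q‖) {x : ℂ} (hx : x ≠ 0) :
    Summable fun n : ℤ => q ^ (-(n * (n - 1) / 2)) * x ^ n := by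
  rw [← Complex.exp_log hx]
  simp_rw [theta_term_eq (ne_zero_of_one_lt_norm hq)]
  exact (hasSum_jacobiTheta₂_term _ (im_theta_modulus_pos hq)).summable

/-- Θ ∘ exp is entire, so it suffices to compose it with a local logarithm. The branch y ↦ log(y/x)
+ log x keeps the argument of log near 1, away from the cut. -/
lemma differentiableAt_theta (hq : 1 < ‖q‖) {x : ℂ} (hx : x ≠ 0) :
    DifferentiableAt ℂ (theta q) x := by
  have h1 : Differentiable ℂ fun w => theta q (Complex.exp w) := by
    intro w
    simp_rw [theta_exp hq]
    have := differentiableAt_jacobiTheta₂_fst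
      ((w + Complex.log q / 2) / (2 * Real.pi * Complex.I)) (im_theta_modulus_pos hq)
    exact DifferentiableAt.comp (g := fun z => jacobiTheta₂ z _) w this (by fun_prop)
  have h2 : DifferentiableAt ℂ (fun y => Complex.log (y / x) + Complex.log x) x := by
    refine DifferentiableAt.add ?_ (by fun_prop)
    refine DifferentiableAt.clog (by fun_prop) ?_
    simp [hx]
  have h3 := DifferentiableAt.comp (g := fun w => theta q (Complex.exp w)) x (h1 _) h2
  refine h3.congr_of_eventuallyEq ?_
  filter_upwards [isOpen_ne.mem_nhds hx] with y hy
  simp [Complex.exp_add, Complex.exp_log hx, Complex.exp_log (div_ne_zero hy hx), hx]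

lemma theta_mul_q (hq : q ≠ 0) {x : ℂ} (hx : x ≠ 0) :
    theta q (q * x) = q * x * theta q x := by
  unfold theta
  rw [← tsum_mul_left, ← (Equiv.addRight (1 : ℤ)).tsum_eq
    (fun n : ℤ => q ^ (-(n * (n - 1) / 2)) * (q * x) ^ n)]
  refine tsum_congr fun n => ?_
  simp only [Equiv.coe_addRight]
  obtain ⟨k, hk⟩ : ∃ k : ℤ, n * (n - 1) = 2 * k := by
    obtain ⟨k, hk⟩ := Int.even_mul_pred_self n
    exact ⟨k, by rw [hk]; ring⟩
  have h1 : n * (n - 1) / 2 = k := by omega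
  have h2 : (n + 1) * (n + 1 - 1) / 2 = k + n := by
    have : (n + 1) * (n + 1 - 1) = 2 * (k + n) := by linear_combination hk
    omega
  rw [h1, h2, mul_zpow, zpow_add_one₀ hx, zpow_add_one₀ hq, neg_add, zpow_add₀ hq, zpow_neg q n]
  field_simp

/-- The reflection n ↦ 1 - n preserves n(n-1) and reverses the parity of n, so the sum equals its
own negative. -/
lemma theta_neg_one (q : ℂ) : theta q (-1) = 0 := by
  have h : theta q (-1) = -theta q (-1) := by
    conv_lhs => unfold theta
    rw [← (Equiv.subLeft (1 : ℤ)).tsum_eq]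
    unfold theta
    rw [← tsum_neg]
    refine tsum_congr fun n => ?_
    simp only [Equiv.subLeft_apply]
    have h1 : (1 - n) * (1 - n - 1) = n * (n - 1) := by ring
    rw [h1, zpow_sub₀ (by norm_num)]
    rcases Int.even_or_odd n with h | h
    · simp [h.neg_one_zpow]
    · simp [h.neg_one_zpow]
  have h2 : (2 : ℂ) * theta q (-1) = 0 := by linear_combination h
  simpa using h2

/-- Integrating over the unit circle isolates the coefficient of x^0, which is 1; vanishing on the
circle would make it 0. -/
lemma theta_ne_zero_exists (hq : 1 < ‖q‖) : ∃ x : ℂ, ‖x‖ = 1 ∧ theta q x ≠ 0 := by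
  by_contra! h
  have hsum : HasSum (fun n : ℤ => ∫ s in (0 : ℝ)..2 * Real.pi,
      q ^ (-(n * (n - 1) / 2)) * Complex.exp (s * Complex.I) ^ n)
      (∫ s in (0 : ℝ)..2 * Real.pi, ∑' n : ℤ, 
        q ^ (-(n * (n - 1) / 2)) * Complex.exp (s * Complex.I) ^ n) := by
    have hcont : ∀ n : ℤ, Continuous fun s : ℝ =>
        q ^ (-(n * (n - 1) / 2)) * Complex.exp (s * Complex.I) ^ n := by
      intro n
      simp_rw [← Complex.exp_int_mul]
      fun_prop
    refine intervalIntegral.hasSum_intervalIntegral_of_summable_norm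
      (f := fun n : ℤ => ⟨fun s : ℝ =>
        q ^ (-(n * (n - 1) / 2)) * Complex.exp (s * Complex.I) ^ n, hcont n⟩) ?_
    refine Summable.of_nonneg_of_le (fun _ => norm_nonneg _) (fun n => ?_)
      ((summable_theta hq (one_ne_zero)).norm)
    rw [ContinuousMap.norm_le _ (norm_nonneg _)]
    intro s
    simp [ContinuousMap.restrict_apply, Complex.norm_exp_ofReal_mul_I]
  have h0 : (∫ s in (0 : ℝ)..2 * Real.pi, ∑' n : ℤ, 
        q ^ (-(n * (n - 1) / 2)) * Complex.exp (s * Complex.I) ^ n) = 0 := by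
    have : ∀ s : ℝ, ∑' n : ℤ, 
        q ^ (-(n * (n - 1) / 2)) * Complex.exp (s * Complex.I) ^ n = 0 := fun s =>
      h _ (Complex.norm_exp_ofReal_mul_I s)
    simp only [this, intervalIntegral.integral_zero]
  rw [h0] at hsum
  have hterm : ∀ n : ℤ, n ≠ 0 → ∫ s in (0 : ℝ)..2 * Real.pi,
      q ^ (-(n * (n - 1) / 2)) * Complex.exp (s * Complex.I) ^ n = 0 := by
    intro n hn
    have hn' : (n * Complex.I : ℂ) ≠ 0 := by simp [hn]
    rw [intervalIntegral.integral_const_mul]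
    have := integral_exp_mul_complex (a := 0) (b := 2 * Real.pi) hn'
    have e : ∀ s : ℝ, Complex.exp (s * Complex.I) ^ n = Complex.exp (n * Complex.I * s) := by
      intro s; rw [← Complex.exp_int_mul]; ring_nf
    simp_rw [e]
    rw [this]
    have e2 : (n * Complex.I * ((2 * Real.pi : ℝ) : ℂ) : ℂ) = n * (2 * Real.pi * Complex.I) := by
      push_cast; ring
    rw [e2, Complex.exp_int_mul_two_pi_mul_I]
    simp
  have := hsum.unique (hasSum_single 0 hterm)
  simp at this

/-- The part `∏ (1 + x q^{-n-1})` of the product expansion of the theta function. -/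
noncomputable def thetaFactor (q x : ℂ) : ℂ := ∏' n : ℕ, (1 + x * (q ^ (n + 1))⁻¹)

lemma summable_thetaFactor (hq : 1 < ‖q‖) (x : ℂ) :
    Summable fun n : ℕ => ‖x * (q ^ (n + 1))⁻¹‖ := by
  have h : Summable fun n : ℕ => (‖q‖⁻¹) ^ n :=
    summable_geometric_of_lt_one (by positivity) (inv_lt_one_of_one_lt₀ hq)
  have := ((summable_nat_add_iff 1).mpr h).mul_left ‖x‖
  simpa using this

lemma differentiable_thetaFactor (hq : 1 < ‖q‖) : Differentiable ℂ (thetaFactor q) := by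
  have key : MultipliableLocallyUniformlyOn (fun (n : ℕ) (x : ℂ) => 1 + x * (q ^ (n + 1))⁻¹)
      univ := by
    use fun x ↦ ∏' n : ℕ, (1 + x * (q ^ (n + 1))⁻¹)
    apply hasProdLocallyUniformlyOn_of_forall_compact isOpen_univ
    intro K _ hcK
    obtain ⟨R, hR⟩ := hcK.isBounded.exists_norm_le
    refine Summable.hasProdUniformlyOn_nat_one_add (u := fun n : ℕ => ‖(R : ℂ) * (q ^ (n + 1))⁻¹‖)
      hcK (summable_thetaFactor hq R) (.of_forall fun n x hx ↦ ?_) (fun _ ↦ by fun_prop)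
    rw [norm_mul, norm_mul]
    gcongr
    simpa using (hR x hx).trans (le_abs_self R)
  have h := key.hasProdLocallyUniformlyOn.differentiableOn
    (.of_forall fun _ ↦ by simpa [Finset.prod_fn] using
      DifferentiableOn.finsetProd (fun _ _ ↦ by fun_prop)) isOpen_univ
  exact differentiableOn_univ.mp h

lemma thetaFactor_ne_zero (hq : 1 < ‖q‖) {x : ℂ} (hx : ‖x‖ < ‖q‖) : thetaFactor q x ≠ 0 := by
  refine tprod_one_add_ne_zero_of_summable (fun n h => ?_) (summable_thetaFactor hq x)
  have h1 : ‖x * (q ^ (n + 1))⁻¹‖ < 1 := by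
    have hq0 : 0 < ‖q‖ := by linarith
    rw [norm_mul, norm_inv, norm_pow, ← div_eq_mul_inv, div_lt_one (by positivity)]
    exact hx.trans_le (le_self_pow₀ hq.le (by simp))
  have h2 : x * (q ^ (n + 1))⁻¹ = -1 := by linear_combination h
  rw [h2] at h1
  simp at h1

lemma thetaFactor_mul_q (hq : 1 < ‖q‖) (x : ℂ) :
    thetaFactor q (q * x) = (1 + x) * thetaFactor q x := by
  unfold thetaFactor
  have hq0 := ne_zero_of_one_lt_norm hq
  have h : ∀ n : ℕ, 1 + q * x * (q ^ (n + 1 + 1))⁻¹ = 1 + x * (q ^ (n + 1))⁻¹ := by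
    intro n
    rw [pow_succ q (n + 1)]
    field_simp
  rw [tprod_eq_zero_mul' (f := fun n : ℕ => 1 + q * x * (q ^ (n + 1))⁻¹)]
  · simp_rw [h]
    congr 1
    field_simp
    ring
  · simp_rw [h]
    exact multipliable_one_add_of_summable (summable_thetaFactor hq x)

end theta

/-! ### Zeros of the theta function and its lower bound off a spiral. -/

section thetaZeros

variable {q : ℂ}

lemma theta_zpow_mul (hq : q ≠ 0) {x : ℂ} (hx : x ≠ 0) (n : ℤ) :
    theta q (q ^ n * x) = q ^ (n * (n + 1) / 2) * x ^ n * theta q x := by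
  have key : ∀ n : ℤ, theta q (q ^ (n + 1) * x) = q ^ (n + 1) * x * theta q (q ^ n * x) := by
    intro n
    rw [zpow_add_one₀ hq, mul_comm (q ^ n) q, mul_assoc,
      theta_mul_q hq (mul_ne_zero (zpow_ne_zero _ hq) hx)]
  have half : ∀ n : ℤ, (n + 1) * (n + 1 + 1) / 2 = n * (n + 1) / 2 + (n + 1) := by
    intro n
    have : (n + 1) * (n + 1 + 1) = n * (n + 1) + (n + 1) * 2 := by ring
    rw [this, Int.add_mul_ediv_right _ _ (by norm_num)]
  induction n using Int.induction_on with
  | zero => simp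
  | succ n ih =>
    rw [key, ih, half, zpow_add₀ hq _ ((n : ℤ) + 1), zpow_add_one₀ hx]
    generalize q ^ ((n : ℤ) + 1) = A
    generalize q ^ ((n : ℤ) * (n + 1) / 2) = B
    generalize x ^ (n : ℤ) = D
    ring
  | pred n ih =>
    have h1 := key (-(n : ℤ) - 1)
    have h2 := half (-(n : ℤ) - 1)
    rw [sub_add_cancel] at h1 h2
    rw [h1] at ih
    rw [h2, zpow_add₀ hq] at ih
    have hx' : x ^ (-(n : ℤ)) = x ^ (-(n : ℤ) - 1) * x := by
      rw [← zpow_add_one₀ hx, sub_add_cancel]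
    rw [hx'] at ih
    have hqn : q ^ (-(n : ℤ)) ≠ 0 := zpow_ne_zero _ hq
    have : q ^ (-(n : ℤ)) * x ≠ 0 := mul_ne_zero hqn hx
    apply mul_left_cancel₀ this
    rw [ih, sub_add_cancel]
    generalize q ^ (-(n : ℤ)) = A
    generalize x ^ (-(n : ℤ) - 1) = D
    ring

/-- The quotient of the theta function by its product expansion, on an annulus about the
unit circle. -/
noncomputable def thetaQuotient (q x : ℂ) : ℂ :=
  dslope (theta q) (-1) x / (thetaFactor q x * thetaFactor q x⁻¹)

/-- `dslope` removes the zero at -1, and the annulus is where neither product factor vanishes, so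
the quotient has no singularity there, not even at -1. -/
lemma thetaQuotient_mul (hq : 1 < ‖q‖) {x : ℂ} (hx : ‖q‖⁻¹ < ‖x‖) (hx' : ‖x‖ < ‖q‖) :
    thetaQuotient q x * (1 + x) * (thetaFactor q x * thetaFactor q x⁻¹) = theta q x := by
  have h1 := thetaFactor_ne_zero hq hx'
  have hq0 : 0 < ‖q‖ := by linarith
  have h2 : thetaFactor q x⁻¹ ≠ 0 := by
    refine thetaFactor_ne_zero hq ?_
    rw [norm_inv]
    exact inv_lt_of_inv_lt₀ hq0 hx
  have h3 := sub_smul_dslope (theta q) (-1) x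
  rw [theta_neg_one, sub_zero, smul_eq_mul] at h3
  have h4 : thetaQuotient q x * (thetaFactor q x * thetaFactor q x⁻¹) =
      dslope (theta q) (-1) x := div_mul_cancel₀ _ (mul_ne_zero h1 h2)
  linear_combination h3 + (1 + x) * h4

/-- Numerator and product pick up the same factor q x under x ↦ q x. The condition on x places both
x and q x in the annulus. -/
lemma thetaQuotient_mul_q (hq : 1 < ‖q‖) {x : ℂ} (hx : ‖q‖⁻¹ < ‖x‖) (hx' : ‖x‖ < 1) :
    thetaQuotient q (q * x) = thetaQuotient q x := by
  have hq0 : 0 < ‖q‖ := by linarith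
  have hq00 : q ≠ 0 := norm_pos_iff.mp hq0
  have hxn : 0 < ‖x‖ := lt_trans (by positivity) hx
  have hx0 : x ≠ 0 := norm_pos_iff.mp hxn
  have hqx : 1 < ‖q * x‖ := by
    rw [norm_mul]; rwa [inv_lt_iff_one_lt_mul₀' hq0] at hx
  have hqx' : ‖q * x‖ < ‖q‖ := by
    rw [norm_mul]; exact mul_lt_of_lt_one_right hq0 hx'
  have e1 := thetaQuotient_mul hq hx (hx'.trans hq)
  have e2 := thetaQuotient_mul hq ((inv_lt_one_of_one_lt₀ hq).trans hqx) hqx'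
  rw [theta_mul_q hq00 hx0, ← e1, thetaFactor_mul_q hq] at e2
  have e3 : thetaFactor q x⁻¹ = (1 + (q * x)⁻¹) * thetaFactor q (q * x)⁻¹ := by
    rw [← thetaFactor_mul_q hq]
    congr 1
    field_simp
  rw [e3] at e2
  have n1 : thetaFactor q x ≠ 0 := thetaFactor_ne_zero hq (hx'.trans hq)
  have n2 : thetaFactor q (q * x)⁻¹ ≠ 0 := by
    refine thetaFactor_ne_zero hq ?_
    rw [norm_inv]
    exact (inv_lt_one_of_one_lt₀ hqx).trans hq
  have n3 : 1 + x ≠ 0 := by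
    intro h
    have : x = -1 := by linear_combination h
    rw [this] at hx'; simp at hx'
  have n4 : 1 + q * x ≠ 0 := by
    intro h
    have : q * x = -1 := by linear_combination h
    rw [this] at hqx; simp at hqx
  have e4 : q * x * (1 + (q * x)⁻¹) = 1 + q * x := by field_simp; ring
  have : ((1 + q * x) * ((1 + x) * thetaFactor q x * thetaFactor q (q * x)⁻¹)) ≠ 0 :=
    mul_ne_zero n4 (mul_ne_zero (mul_ne_zero n3 n1) n2)
  apply mul_right_cancel₀ this
  linear_combination e2 + thetaQuotient q x * (1 + x) * thetaFactor q x *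
    thetaFactor q (q * x)⁻¹ * e4

lemma differentiableOn_thetaQuotient (hq : 1 < ‖q‖) :
    DifferentiableOn ℂ (thetaQuotient q) {x | ‖q‖⁻¹ < ‖x‖ ∧ ‖x‖ < ‖q‖} := by
  have hq0 : 0 < ‖q‖ := by linarith
  intro x hx
  have hx0 : x ≠ 0 := norm_pos_iff.mp (lt_trans (by positivity) hx.1)
  have h1 : DifferentiableOn ℂ (dslope (theta q) (-1)) {0}ᶜ :=
    (Complex.differentiableOn_dslope (isOpen_compl_singleton.mem_nhds (by simp))).mpr
      fun y hy => (differentiableAt_theta hq hy).differentiableWithinAt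
  have h1' := h1.differentiableAt (isOpen_compl_singleton.mem_nhds hx0)
  refine (DifferentiableAt.div h1' ?_ ?_).differentiableWithinAt
  · refine (differentiable_thetaFactor hq x).mul ?_
    exact DifferentiableAt.comp (g := thetaFactor q) x (differentiable_thetaFactor hq _)
      (differentiableAt_inv hx0)
  · refine mul_ne_zero (thetaFactor_ne_zero hq hx.2) (thetaFactor_ne_zero hq ?_)
    rw [norm_inv]
    exact inv_lt_of_inv_lt₀ hq0 hx.1

lemma isPreconnected_annulus {a b : ℝ} (ha : 0 < a) :
    IsPreconnected {x : ℂ | a < ‖x‖ ∧ ‖x‖ < b} := by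
  have h : {x : ℂ | a < ‖x‖ ∧ ‖x‖ < b} =
      (fun p : ℝ × ℝ => (p.1 : ℂ) * Complex.exp (p.2 * Complex.I)) '' (Ioo a b ×ˢ univ) := by
    ext x
    constructor
    · intro hx
      exact ⟨(‖x‖, x.arg), ⟨⟨hx.1, hx.2⟩, mem_univ _⟩, Complex.norm_mul_exp_arg_mul_I x⟩
    · rintro ⟨⟨r, s⟩, ⟨⟨h1, h2⟩, -⟩, rfl⟩
      simp only [mem_ofPred_eq, norm_mul, Complex.norm_exp_ofReal_mul_I, mul_one,
        Complex.norm_real, Real.norm_eq_abs, abs_of_pos (ha.trans h1)]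
      exact ⟨h1, h2⟩
  rw [h]
  refine (isPreconnected_Ioo.prod isPreconnected_univ).image _ (Continuous.continuousOn ?_)
  exact (Complex.continuous_ofReal.comp continuous_fst).mul (Complex.continuous_exp.comp
    ((Complex.continuous_ofReal.comp continuous_snd).mul continuous_const))

/-- By q-invariance the maximum of the modulus over a compact fundamental annulus is a maximum over
the whole open annulus, so the maximum principle makes the quotient constant. This yields the
product formula up to a nonzero constant, which is all that locating the zeros requires. -/
lemma exists_thetaQuotient_eq (hq : 1 < ‖q‖) :
    ∃ c : ℂ, c ≠ 0 ∧ ∀ x : ℂ, ‖q‖⁻¹ < ‖x‖ → ‖x‖ < ‖q‖ → thetaQuotient q x = c := by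
  have hq0 : 0 < ‖q‖ := by linarith
  set A : Set ℂ := {x | ‖q‖⁻¹ < ‖x‖ ∧ ‖x‖ < ‖q‖} with hA
  have hAo : IsOpen A := (isOpen_lt continuous_const continuous_norm).inter
    (isOpen_lt continuous_norm continuous_const)
  have hd := differentiableOn_thetaQuotient hq
  -- The closed annulus between 1/r and r has ratio r² = |q|: it meets every q-orbit and lies
  -- strictly inside the open one.
  set r := Real.sqrt ‖q‖ with hr
  have hr1 : 1 < r := by rw [hr]; exact Real.lt_sqrt_of_sq_lt (by simpa using hq)
  have hr0 : 0 < r := by linarith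
  have hrr : r * r = ‖q‖ := Real.mul_self_sqrt hq0.le
  have hrq : r < ‖q‖ := by nlinarith
  have hri : ‖q‖⁻¹ < r⁻¹ := by gcongr
  have hri1 : r⁻¹ < 1 := inv_lt_one_of_one_lt₀ hr1
  set K : Set ℂ := {x | r⁻¹ ≤ ‖x‖ ∧ ‖x‖ ≤ r} with hK
  have hKc : IsCompact K := by
    refine Metric.isCompact_of_isClosed_isBounded ?_ ?_
    · exact (isClosed_le continuous_const continuous_norm).inter
        (isClosed_le continuous_norm continuous_const)
    · exact (Metric.isBounded_closedBall (x := (0 : ℂ)) (r := r)).subset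
        fun x hx => by simpa using hx.2
  have hKA : K ⊆ A := fun x hx => ⟨hri.trans_le hx.1, hx.2.trans_lt hrq⟩
  obtain ⟨c, hcK, hc⟩ := hKc.exists_isMaxOn ⟨1, by simp [hK, hri1.le, hr1.le]⟩
    (hd.continuousOn.mono hKA).norm
  have hmax : IsMaxOn (norm ∘ thetaQuotient q) A c := by
    intro x hx
    show ‖thetaQuotient q x‖ ≤ ‖thetaQuotient q c‖
    rcases lt_or_ge ‖x‖ r⁻¹ with h | h
    · rw [← thetaQuotient_mul_q hq hx.1 (h.trans hri1)]
      refine hc ⟨?_, ?_⟩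
      · rw [norm_mul]
        have := hx.1
        rw [inv_lt_iff_one_lt_mul₀' hq0] at this
        linarith
      · rw [norm_mul, ← hrr]
        calc r * r * ‖x‖ ≤ r * r * r⁻¹ := by gcongr
          _ = r := by field_simp
    · rcases lt_or_ge r ‖x‖ with h' | h'
      · have hxq : x = q * (q⁻¹ * x) := by
          have := ne_zero_of_one_lt_norm hq
          field_simp
        have e : ‖q⁻¹ * x‖ = ‖x‖ / ‖q‖ := by
          rw [norm_mul, norm_inv]; ring
        have e1 : ‖q‖⁻¹ < ‖q⁻¹ * x‖ := by
          rw [e, inv_eq_one_div]; gcongr; linarith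
        have e2 : ‖q⁻¹ * x‖ < 1 := by
          rw [e, div_lt_one hq0]; exact hx.2
        rw [hxq, thetaQuotient_mul_q hq e1 e2]
        refine hc ⟨?_, ?_⟩
        · rw [e, ← hrr, le_div_iff₀ (by positivity)]
          calc r⁻¹ * (r * r) = r := by field_simp
            _ ≤ ‖x‖ := h'.le
        · linarith
      · exact hc ⟨h, h'⟩
  have heq := Complex.eqOn_of_isPreconnected_of_isMaxOn_norm
    (isPreconnected_annulus (by positivity)) hAo hd (hKA hcK) hmax
  refine ⟨thetaQuotient q c, ?_, fun x h1 h2 => heq ⟨h1, h2⟩⟩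
  intro h0
  obtain ⟨x, hx1, hx⟩ := theta_ne_zero_exists hq
  have a1 : ‖q‖⁻¹ < ‖x‖ := by rw [hx1]; exact inv_lt_one_of_one_lt₀ hq
  have a2 : ‖x‖ < ‖q‖ := by rwa [hx1]
  have := heq ⟨a1, a2⟩
  apply hx
  rw [← thetaQuotient_mul hq a1 a2, this, Function.const, h0]
  simp

/-- The zeros of the theta function are the points `-q ^ n`. -/
lemma theta_eq_zero_imp (hq : 1 < ‖q‖) {x : ℂ} (hx : x ≠ 0) (h : theta q x = 0) :
    ∃ n : ℤ, x = -q ^ n := by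
  have hq0 : 0 < ‖q‖ := by linarith
  have hq00 := ne_zero_of_one_lt_norm hq
  -- A power of q moves x to y with 1 ≤ |y| < |q|, where the product formula leaves 1 + y as the
  -- only factor that can vanish.
  obtain ⟨n, hn1, hn2⟩ := exists_mem_Ico_zpow (norm_pos_iff.mpr hx) hq
  have hxy : x = q ^ n * (q ^ (-n) * x) := by
    rw [← mul_assoc, ← zpow_add₀ hq00]; simp
  set y := q ^ (-n) * x with hy
  have hy0 : y ≠ 0 := mul_ne_zero (zpow_ne_zero _ hq00) hx
  have hny : ‖y‖ = ‖x‖ / ‖q‖ ^ n := by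
    rw [hy, norm_mul, norm_zpow, zpow_neg, div_eq_inv_mul]
  have hp : 0 < ‖q‖ ^ n := zpow_pos hq0 n
  have hy1 : 1 ≤ ‖y‖ := by rw [hny, one_le_div hp]; exact hn1
  have hy2 : ‖y‖ < ‖q‖ := by
    rw [hny, div_lt_iff₀ hp]; rwa [zpow_add_one₀ hq0.ne', mul_comm] at hn2
  obtain ⟨c, hc0, hc⟩ := exists_thetaQuotient_eq hq
  have hy3 : ‖q‖⁻¹ < ‖y‖ := (inv_lt_one_of_one_lt₀ hq).trans_le hy1
  have hty : theta q y = 0 := by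
    rw [hxy, theta_zpow_mul hq00 hy0] at h
    have h1 : q ^ (n * (n + 1) / 2) * y ^ n ≠ 0 :=
      mul_ne_zero (zpow_ne_zero _ hq00) (zpow_ne_zero _ hy0)
    exact (mul_eq_zero.mp h).resolve_left h1
  rw [← thetaQuotient_mul hq hy3 hy2, hc y hy3 hy2] at hty
  have n1 := thetaFactor_ne_zero hq hy2
  have n2 : thetaFactor q y⁻¹ ≠ 0 := by
    refine thetaFactor_ne_zero hq ?_
    rw [norm_inv]
    exact inv_lt_of_inv_lt₀ hq0 hy3
  have : 1 + y = 0 := by simpa [hc0, n1, n2] using hty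
  have hy' : y = -1 := by linear_combination this
  exact ⟨n, by rw [hxy, hy']; ring⟩

/-- Lower bound for the theta function away from the spiral `-q^ℝ`. -/
lemma exists_theta_lower_bound_polar (hq : 1 < ‖q‖) {P δ : ℝ} (hP : P < 1 / (2 * Real.log ‖q‖))
    (hδ : 0 < δ) :
    ∃ c > 0, ∀ s : ℝ, ∀ u : ℂ, ‖u‖ = 1 → δ ≤ ‖1 - u‖ →
      c * Real.exp (P * (s * Real.log ‖q‖) ^ 2) ≤ ‖theta q (-(qpow q s * u))‖ := by
  have hq00 := ne_zero_of_one_lt_norm hq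
  set L := Real.log ‖q‖ with hL
  have hLpos : 0 < L := Real.log_pos hq
  set K : Set (ℝ × ℂ) := Icc 0 1 ×ˢ {u | ‖u‖ = 1 ∧ δ ≤ ‖1 - u‖} with hK
  have hKc : IsCompact K := by
    refine isCompact_Icc.prod (Metric.isCompact_of_isClosed_isBounded ?_ ?_)
    · exact (isClosed_eq continuous_norm continuous_const).inter
        (isClosed_le continuous_const (continuous_const.sub continuous_id).norm)
    · exact (Metric.isBounded_closedBall (x := (0 : ℂ)) (r := 1)).subset
        fun x hx => by simp [hx.1]
  -- Over one period of s, compactness gives a positive minimum: a zero -q^n would force s = n by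
  -- comparing moduli, hence u = 1, which the distance δ excludes.
  have hmin : ∃ c > 0, ∀ p ∈ K, c ≤ ‖theta q (-(qpow q p.1 * p.2))‖ := by
    rcases K.eq_empty_or_nonempty with hE | hne
    · exact ⟨1, one_pos, by simp [hE]⟩
    have hne0 : ∀ p ∈ K, -(qpow q p.1 * p.2) ≠ 0 := by
      rintro ⟨s, u⟩ ⟨-, hu, -⟩
      have : u ≠ 0 := by rintro rfl; simp at hu
      exact neg_ne_zero.mpr (mul_ne_zero (qpow_ne_zero q s) this)
    have hcont : ContinuousOn (fun p : ℝ × ℂ => ‖theta q (-(qpow q p.1 * p.2))‖) K := by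
      refine ContinuousOn.norm fun p hp => ?_
      have h1 : ContinuousAt (theta q) (-(qpow q p.1 * p.2)) :=
        (differentiableAt_theta hq (hne0 p hp)).continuousAt
      have h2 : Continuous fun p : ℝ × ℂ => -(qpow q p.1 * p.2) :=
        (((continuous_qpow q).comp continuous_fst).mul continuous_snd).neg
      exact (ContinuousAt.comp (f := fun p : ℝ × ℂ => -(qpow q p.1 * p.2)) (x := p) h1
        h2.continuousAt).continuousWithinAt
    obtain ⟨p, hp, hpm⟩ := hKc.exists_isMinOn hne hcont
    refine ⟨_, norm_pos_iff.mpr fun h0 => ?_, fun p' hp' => hpm hp'⟩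
    obtain ⟨n, hn⟩ := theta_eq_zero_imp hq (hne0 p hp) h0
    obtain ⟨hp1, hu, hpδ⟩ := hp
    have h1 : qpow q p.1 * p.2 = q ^ n := neg_injective hn
    have h2 : p.1 = n := by
      have := congrArg (fun z => Real.log ‖z‖) h1
      rw [← qpow_intCast hq00, norm_mul, norm_qpow, norm_qpow, hu, mul_one, Real.log_exp,
        Real.log_exp] at this
      exact mul_right_cancel₀ hLpos.ne' this
    rw [h2, qpow_intCast hq00] at h1
    have h3 : p.2 = 1 := by
      simpa [zpow_ne_zero n hq00] using h1
    rw [h3] at hpδ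
    rw [sub_self, norm_zero] at hpδ
    linarith
  obtain ⟨c, hc, hcK⟩ := hmin
  -- The iterated functional equation gives exactly the rate 1/(2L), up to a term linear in s. The
  -- margin a pays for it through a(sL + 1/(4a))² ≥ 0, which is the origin of the constant 1/(16a).
  set a := 1 / (2 * L) - P with ha
  have ha0 : 0 < a := by rw [ha]; linarith
  refine ⟨c * Real.exp (-(L + 1 / (16 * a))), by positivity, fun s u hu hδu => ?_⟩
  set n := ⌊s⌋ with hn
  set v := s - n with hv
  have hv0 : 0 ≤ v := by rw [hv]; linarith [Int.floor_le s]
  have hv1 : v < 1 := by rw [hv]; linarith [Int.lt_floor_add_one s]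
  have hs : s = n + v := by rw [hv]; ring
  have hu0 : u ≠ 0 := by rintro rfl; simp at hu
  have hy0 : -(qpow q v * u) ≠ 0 := by simp [qpow_ne_zero, hu0]
  have e1 : -(qpow q s * u) = q ^ n * -(qpow q v * u) := by
    conv_lhs => rw [hs]
    rw [qpow_add, qpow_intCast hq00]
    ring
  rw [e1, theta_zpow_mul hq00 hy0, norm_mul, norm_mul, norm_zpow, norm_zpow, norm_neg, norm_mul,
    hu, mul_one, norm_qpow]
  have hb := hcK (v, u) ⟨⟨hv0, hv1.le⟩, hu, hδu⟩
  have hq' : ‖q‖ = Real.exp L := (Real.exp_log (by linarith)).symm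
  have hhalf : ((n * (n + 1) / 2 : ℤ) : ℝ) = n * (n + 1) / 2 := by
    obtain ⟨k, hk⟩ := Int.even_mul_succ_self n
    have h2 : n * (n + 1) / 2 = k := by omega
    rw [h2]
    have : (n : ℝ) * (n + 1) = k + k := by exact_mod_cast hk
    rw [this]; ring
  have hz : ∀ (y : ℝ) (k : ℤ), Real.exp y ^ k = Real.exp (y * k) := by
    intro y k
    rw [← Real.rpow_intCast, ← Real.exp_mul]
  rw [← hL]
  conv_rhs => rw [hq']
  rw [hz, hz, ← Real.exp_add, hhalf, mul_assoc, ← Real.exp_add, mul_comm]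
  refine mul_le_mul (Real.exp_le_exp.mpr ?_) hb hc.le (Real.exp_pos _).le
  have hkey : P * (s * L) ^ 2 = (1 / (2 * L) - a) * (s * L) ^ 2 := by rw [ha]; ring
  rw [hkey]
  have h3 : 1 / (2 * L) * (s * L) ^ 2 = s ^ 2 * L / 2 := by field_simp
  have h4 : 0 ≤ a * (s * L + 1 / (4 * a)) ^ 2 := by positivity
  have h5 : a * (s * L + 1 / (4 * a)) ^ 2 = a * (s * L) ^ 2 + s * L / 2 + 1 / (16 * a) := by
    field_simp; ring
  rw [h5] at h4
  have h6 : (1 / (2 * L) - a) * (s * L) ^ 2 = s ^ 2 * L / 2 - a * (s * L) ^ 2 := by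
    rw [sub_mul, h3]
  rw [h6]
  have h7 : v ^ 2 * L ≤ L := mul_le_of_le_one_left hLpos.le (pow_le_one₀ hv0 hv1.le)
  have h8 : v * L ≤ L := mul_le_of_le_one_left hLpos.le hv1.le
  have h9 : s ^ 2 * L / 2 = n ^ 2 * L / 2 + n * (v * L) + v ^ 2 * L / 2 := by rw [hs]; ring
  have h10 : s * L = n * L + v * L := by rw [hs]; ring
  linarith

lemma exists_polar (hq : 1 < ‖q‖) {x : ℂ} (hx : x ≠ 0) :
    ∃ u : ℂ, ‖u‖ = 1 ∧ x = qpow q (Real.log ‖x‖ / Real.log ‖q‖) * u := by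
  have hL : 0 < Real.log ‖q‖ := Real.log_pos hq
  have h : Real.log ‖x‖ / Real.log ‖q‖ * Real.log ‖q‖ = Real.log ‖x‖ := by field_simp
  refine ⟨x / qpow q (Real.log ‖x‖ / Real.log ‖q‖), ?_, ?_⟩
  · rw [norm_div, norm_qpow, h, Real.exp_log (norm_pos_iff.mpr hx)]
    exact div_self (norm_ne_zero_iff.mpr hx)
  · rw [mul_div_cancel₀ _ (qpow_ne_zero _ _)]

/-- Taking r with |x q^r| = 1 turns the distance condition on the spiral into one on the angular
part of x. -/
lemma exists_theta_lower_bound (hq : 1 < ‖q‖) {P δ : ℝ} (hP : P < 1 / (2 * Real.log ‖q‖))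
    (hδ : 0 < δ) :
    ∃ c > 0, ∀ x : ℂ, x ≠ 0 → (∀ r : ℝ, δ < ‖1 + x * qpow q r‖) →
      c * Real.exp (P * Real.log ‖x‖ ^ 2) ≤ ‖theta q x‖ := by
  obtain ⟨c, hc, h⟩ := exists_theta_lower_bound_polar hq hP hδ
  refine ⟨c, hc, fun x hx hr => ?_⟩
  have hL : 0 < Real.log ‖q‖ := Real.log_pos hq
  obtain ⟨u, hu, hxu⟩ := exists_polar hq hx
  set s := Real.log ‖x‖ / Real.log ‖q‖ with hs
  have h1 : s * Real.log ‖q‖ = Real.log ‖x‖ := by rw [hs]; field_simp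
  have h2 := h s (-u) (by simpa using hu) (by
    have := hr (-s)
    rw [hxu, qpow_neg] at this
    have e : 1 + qpow q s * u * (qpow q s)⁻¹ = 1 - -u := by
      have := qpow_ne_zero q s
      field_simp
      ring
    rw [e] at this
    exact this.le)
  rw [h1] at h2
  rwa [mul_neg, neg_neg, ← hxu] at h2

end thetaZeros

/-! ### The recursion in the τ-plane and the growth of its solution. -/

section auxiliaryProblem

/-- The coefficients of the formal solution of the auxiliary Cauchy problem, at a fixed
point `(ε, τ)`. -/
noncomputable def auxCoeff (q : ℂ) (S : ℕ) (Is : ℕ → Finset ℕ) (b : ℕ → ℕ → ℂ → ℂ)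
    (m₀ m₁ : ℕ → ℕ) (w : ℕ → ℂ → ℂ → ℂ) (ε τ : ℂ) : ℕ → ℂ
  | n =>
    if n < S then w n ε τ else
      (n - S).factorial * ∑ k ∈ Finset.range S, ∑ s ∈ Is k,
        -- The dependent test supplies the inequalities for the termination proof; s ≤ n - S also
        -- cuts off the indices where the power series product has no term.
        if _h : k < S ∧ s ≤ n - S ∧ S ≤ n then
          τ ^ m₀ k / ((τ + 1) * ε ^ m₀ k) * (b k s ε * (((q ^ m₁ k)⁻¹) ^ (n - S - s) *
            (auxCoeff q S Is b m₀ m₁ w ε τ (n - S - s + k) / (n - S - s).factorial)))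
        else 0
  termination_by n => n
  decreasing_by omega

section

variable {q : ℂ} {S : ℕ} {Is : ℕ → Finset ℕ} {b : ℕ → ℕ → ℂ → ℂ} {m₀ m₁ : ℕ → ℕ}
  {w w' : ℕ → ℂ → ℂ → ℂ} {ε τ : ℂ}

lemma auxCoeff_of_lt {n : ℕ} (h : n < S) : auxCoeff q S Is b m₀ m₁ w ε τ n = w n ε τ := by
  rw [auxCoeff, if_pos h]

lemma auxCoeff_add (h : ℕ) :
    auxCoeff q S Is b m₀ m₁ w ε τ (h + S) =
      h.factorial * ∑ k ∈ Finset.range S, ∑ s ∈ Is k,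
        if s ≤ h then
          τ ^ m₀ k / ((τ + 1) * ε ^ m₀ k) * (b k s ε * (((q ^ m₁ k)⁻¹) ^ (h - s) *
            (auxCoeff q S Is b m₀ m₁ w ε τ (h - s + k) / (h - s).factorial)))
        else 0 := by
  rw [auxCoeff, if_neg (by omega)]
  simp only [Nat.add_sub_cancel]
  congr 1
  refine Finset.sum_congr rfl fun k hk => Finset.sum_congr rfl fun s _ => ?_
  have hk := Finset.mem_range.mp hk
  by_cases hs : s ≤ h
  · rw [dif_pos ⟨hk, hs, by omega⟩, if_pos hs]
  · rw [dif_neg (by tauto), if_neg hs]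

/-- The recursion is pointwise in (ε, τ). Hence two sectors have the same coefficients wherever
their initial data coincide, in particular near τ = 0. -/
lemma auxCoeff_congr (h : ∀ j < S, w j ε τ = w' j ε τ) (n : ℕ) :
    auxCoeff q S Is b m₀ m₁ w ε τ n = auxCoeff q S Is b m₀ m₁ w' ε τ n := by
  induction n using Nat.strong_induction_on with
  | _ n ih =>
    rcases lt_or_ge n S with hn | hn
    · rw [auxCoeff_of_lt hn, auxCoeff_of_lt hn, h n hn]
    · obtain ⟨m, rfl⟩ := Nat.exists_eq_add_of_le' hn
      rw [auxCoeff_add, auxCoeff_add]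
      congr 1
      refine Finset.sum_congr rfl fun k hk => Finset.sum_congr rfl fun s _ => ?_
      have hk := Finset.mem_range.mp hk
      split_ifs with hs
      · rw [ih (m - s + k) (by omega)]
      · rfl

lemma differentiableOn_auxCoeff {E D : Set ℂ} (hE : ∀ ε ∈ E, ε ≠ 0) (hD : ∀ τ ∈ D, τ ≠ -1)
    (hb : ∀ k < S, ∀ s ∈ Is k, DifferentiableOn ℂ (b k s) E)
    (hw : ∀ j < S, DifferentiableOn ℂ (fun p : ℂ × ℂ => w j p.1 p.2) (E ×ˢ D)) (n : ℕ) :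
    DifferentiableOn ℂ (fun p : ℂ × ℂ => auxCoeff q S Is b m₀ m₁ w p.1 p.2 n) (E ×ˢ D) := by
  induction n using Nat.strong_induction_on with
  | _ n ih =>
    rcases lt_or_ge n S with hn | hn
    · simp_rw [auxCoeff_of_lt hn]
      exact hw n hn
    · obtain ⟨m, rfl⟩ := Nat.exists_eq_add_of_le' hn
      simp_rw [auxCoeff_add]
      refine (differentiableOn_const _).mul (DifferentiableOn.fun_sum fun k hk =>
        DifferentiableOn.fun_sum fun s hs => ?_)
      have hk := Finset.mem_range.mp hk
      by_cases hsm : s ≤ m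
      · simp only [hsm, if_true]
        refine DifferentiableOn.mul ?_ (DifferentiableOn.mul ?_ ?_)
        · simp only [div_eq_mul_inv]
          refine (differentiableOn_snd.pow _).mul (DifferentiableOn.inv
            ((differentiableOn_snd.add (differentiableOn_const _)).mul
              (differentiableOn_fst.pow _)) ?_)
          rintro ⟨x, y⟩ ⟨hx, hy⟩
          refine mul_ne_zero (fun h => hD y hy ?_) (pow_ne_zero _ (hE x hx))
          linear_combination h
        · exact (hb k hk s hs).comp differentiableOn_fst fun p hp => hp.1
        · refine (differentiableOn_const _).mul ?_
          simp only [div_eq_mul_inv]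
          exact (ih (m - s + k) (by omega)).mul (differentiableOn_const _)
      · simp only [hsm, if_false]
        exact differentiableOn_const _

lemma derivative_iterate_formalSeries (W : ℕ → ℂ → ℂ → ℂ) (k : ℕ) :
    (PowerSeries.derivative ℂ)^[k] (formalSeries W ε τ) =
      formalSeries (fun n => W (n + k)) ε τ := by
  induction k with
  | zero => rfl
  | succ k ih =>
    rw [Function.iterate_succ_apply', ih]
    ext n
    rw [PowerSeries.coeff_derivative]
    simp only [formalSeries, PowerSeries.coeff_mk]
    rw [Nat.factorial_succ, show n + 1 + k = n + (k + 1) by ring]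
    push_cast
    have h1 : (n.factorial : ℂ) ≠ 0 := by exact_mod_cast n.factorial_ne_zero
    have h2 : (n : ℂ) + 1 ≠ 0 := by exact_mod_cast n.succ_ne_zero
    field_simp

lemma isFormalSolution_auxCoeff (E D : Set ℂ) :
    IsFormalSolution q S Is b m₀ m₁ w E D
      fun n ε τ => auxCoeff q S Is b m₀ m₁ w ε τ n := by
  intro ε _ τ _
  constructor
  · ext h
    rw [derivative_iterate_formalSeries, map_sum]
    simp only [formalSeries, PowerSeries.coeff_mk]
    rw [auxCoeff_add, mul_div_assoc, mul_comm, div_mul_cancel₀ _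
      (by exact_mod_cast h.factorial_ne_zero)]
    refine Finset.sum_congr rfl fun k _ => ?_
    have e := derivative_iterate_formalSeries (ε := ε) (τ := τ)
      (fun n ε τ => auxCoeff q S Is b m₀ m₁ w ε τ n) k
    simp only [formalSeries] at e
    rw [e, mul_assoc, PowerSeries.coeff_C_mul, bSeries, Finset.sum_mul, map_sum, Finset.mul_sum]
    refine Finset.sum_congr rfl fun s _ => ?_
    rw [mul_assoc, PowerSeries.coeff_C_mul, PowerSeries.coeff_X_pow_mul']
    split_ifs with hs
    · rw [PowerSeries.coeff_rescale, PowerSeries.coeff_mk]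
    · simp
  · intro j hj
    rw [derivative_iterate_formalSeries, ← PowerSeries.coeff_zero_eq_constantCoeff_apply]
    simp [formalSeries, auxCoeff_of_lt hj]

/-- Here d = S - k + s is the jump from index γ to index β. Assumption (A) is exactly what makes the
exponent C β x⁺ - A₁ L β² reproduce itself: the power of τ/ε costs at most C d x⁺, and the dilation
gains 2 d A₁ L (γ - k), the cross term of (γ + d)². The remainder does not depend on γ. -/
lemma auxCoeff_exponent_le {L A₁ C d m μ x γ k β : ℝ} (hL : 0 ≤ L)
    (hd : m ≤ C * d) (hμ : 2 * d * A₁ ≤ μ) (hm : 0 ≤ m) (hγk : k ≤ γ) (hβ : β = γ + d) :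
    m * x - L * (μ * (γ - k)) + (C * γ * max x 0 - A₁ * L * γ ^ 2) ≤
      A₁ * L * (d ^ 2 + 2 * d * k) + (C * β * max x 0 - A₁ * L * β ^ 2) := by
  have h1 : m * x ≤ C * d * max x 0 :=
    (mul_le_mul_of_nonneg_left (le_max_left x 0) hm).trans
      (mul_le_mul_of_nonneg_right hd (le_max_right _ _))
  have h2 : L * (2 * d * A₁ * (γ - k)) ≤ L * (μ * (γ - k)) :=
    mul_le_mul_of_nonneg_left (mul_le_mul_of_nonneg_right hμ (by linarith)) hL
  subst hβ
  nlinarith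

lemma factorial_div_le {h s k S : ℕ} (hs : s ≤ h) (hk : k < S) :
    (h.factorial : ℝ) * ((h - s + k).factorial / (h - s).factorial) ≤ (h + S).factorial := by
  have h1 : ((h - s).factorial : ℝ) * ((h - s + 1).ascFactorial k : ℕ) =
      (h - s + k).factorial := by
    exact_mod_cast Nat.factorial_mul_ascFactorial (h - s) k
  have h2 : (h.factorial : ℝ) * ((h + 1).ascFactorial S : ℕ) = (h + S).factorial := by
    exact_mod_cast Nat.factorial_mul_ascFactorial h S
  have h3 : (h - s + 1).ascFactorial k ≤ (h + 1).ascFactorial S := by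
    calc (h - s + 1).ascFactorial k ≤ (h + 1).ascFactorial k :=
          Nat.ascFactorial_le k (by omega)
      _ ≤ (h + 1).ascFactorial S := by
          rw [← Nat.add_sub_of_le hk.le, ← Nat.ascFactorial_mul_ascFactorial]
          rw [add_right_comm]
          exact Nat.le_mul_of_pos_right _ (Nat.ascFactorial_pos _ _)
  rw [← h1, ← h2, mul_div_cancel_left₀ _ (by positivity)]
  gcongr

lemma auxCoeff_step_le {F f g B δ D e1 e2 e3 u v a Kg Kn H X Y : ℝ} (hF : 0 ≤ F) (hf : 0 ≤ f)
    (hg : 0 ≤ g) (hB : 0 ≤ B) (hδ : 0 < δ) (hD : 0 ≤ D) (he2 : 0 ≤ e2) (ha0 : 0 ≤ a)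
    (hv : 0 ≤ v) (he1 : 0 ≤ e1) (he3 : 0 ≤ e3) (hKg : 0 ≤ Kg) (hue : u ≤ e1 / δ) (hvB : v ≤ B)
    (ha : a ≤ g * (D * Kg * e3)) (hK : Kg ≤ Kn) (hH : F * (g / f) ≤ H) (hXY : X ≤ Y)
    (hX : e1 * e2 * e3 = X) :
    F * (u * (v * (e2 * (a / f)))) ≤ H * (B / δ * (D * Kn) * Y) := by
  have hKn : 0 ≤ Kn := hKg.trans hK
  calc F * (u * (v * (e2 * (a / f))))
      ≤ F * (e1 / δ * (B * (e2 * (g * (D * Kg * e3) / f)))) := by gcongr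
    _ ≤ F * (e1 / δ * (B * (e2 * (g * (D * Kn * e3) / f)))) := by gcongr
    _ = F * (g / f) * (B / δ * (D * Kn) * X) := by rw [← hX]; ring
    _ ≤ H * (B / δ * (D * Kn) * Y) := by
        have hX0 : 0 ≤ X := by rw [← hX]; positivity
        have hH0 : 0 ≤ H := le_trans (by positivity) hH
        gcongr

/-- K is independent of the data and of the point, so D₀ may later be taken to depend on (ε, τ) and
carry the growth of the initial data. The factor exp(A₁ L S²) covers the initial indices n < S. -/
lemma exists_norm_auxCoeff_le (hq : 1 < ‖q‖) {A₁ C B δ : ℝ}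
    (hA : AssumptionA S Is m₀ m₁ A₁ C) (hB : 0 ≤ B) (hδ : 0 < δ) (hA₁ : 0 ≤ A₁) (hC : 0 ≤ C) :
    ∃ K ≥ (1 : ℝ), ∀ (w : ℕ → ℂ → ℂ → ℂ) (ε τ : ℂ) (D₀ : ℝ), 0 ≤ D₀ → ε ≠ 0 → τ ≠ 0 →
      (∀ k < S, ∀ s ∈ Is k, ‖b k s ε‖ ≤ B) → δ ≤ ‖τ + 1‖ → (∀ j < S, ‖w j ε τ‖ ≤ D₀) →
      ∀ n : ℕ, ‖auxCoeff q S Is b m₀ m₁ w ε τ n‖ ≤ n.factorial *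
        (D₀ * Real.exp (A₁ * Real.log ‖q‖ * S ^ 2) * K ^ n *
          Real.exp (C * n * max (Real.log ‖τ / ε‖) 0 - A₁ * Real.log ‖q‖ * n ^ 2)) := by
  set L := Real.log ‖q‖ with hL
  have hLpos : 0 < L := Real.log_pos hq
  set Q : ℕ → ℕ → ℝ := fun k s => B / δ *
    Real.exp (A₁ * L * (((S : ℝ) - k + s) ^ 2 + 2 * ((S : ℝ) - k + s) * k)) with hQ
  have hQ0 : ∀ k s, 0 ≤ Q k s := fun k s => by positivity
  -- K dominates the total constant of one step, so a step spends one power of K; the summand 1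
  -- makes powers of K monotone in the index.
  set K : ℝ := 1 + ∑ k ∈ Finset.range S, ∑ s ∈ Is k, Q k s with hK
  have hsum0 : 0 ≤ ∑ k ∈ Finset.range S, ∑ s ∈ Is k, Q k s :=
    Finset.sum_nonneg fun k _ => Finset.sum_nonneg fun s _ => hQ0 k s
  have hK1 : 1 ≤ K := by rw [hK]; linarith
  clear_value Q K L
  refine ⟨K, hK1, fun w ε τ D₀ hD₀ hε hτ hb hδτ hw n => ?_⟩
  set x := Real.log ‖τ / ε‖ with hx
  have hxexp : Real.exp x = ‖τ‖ / ‖ε‖ := by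
    rw [hx, Real.exp_log (norm_pos_iff.mpr (div_ne_zero hτ hε)), norm_div]
  set D := D₀ * Real.exp (A₁ * L * S ^ 2) with hD
  have hD0 : 0 ≤ D := by positivity
  clear_value D x
  induction n using Nat.strong_induction_on with
  | _ n ih =>
    rcases lt_or_ge n S with hn | hn
    · rw [auxCoeff_of_lt hn]
      have h1 : (1 : ℝ) ≤ n.factorial := by exact_mod_cast n.factorial_pos
      have h2 : 1 ≤ K ^ n := one_le_pow₀ hK1
      have h3 : 1 ≤ Real.exp (A₁ * L * S ^ 2) *
          Real.exp (C * n * max x 0 - A₁ * L * n ^ 2) := by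
        rw [← Real.exp_add, Real.one_le_exp_iff]
        have h4 : (n : ℝ) ^ 2 ≤ S ^ 2 := by gcongr
        have h5 : A₁ * L * n ^ 2 ≤ A₁ * L * S ^ 2 := by gcongr
        have h6 : 0 ≤ C * n * max x 0 := by positivity
        linarith
      calc ‖w n ε τ‖ ≤ 1 * (D₀ * (1 * 1)) := by simpa using hw n hn
        _ ≤ n.factorial * (D₀ * (K ^ n * (Real.exp (A₁ * L * S ^ 2) *
          Real.exp (C * n * max x 0 - A₁ * L * n ^ 2)))) := by gcongr
        _ = _ := by rw [hD]; ring
    · obtain ⟨h, rfl⟩ := Nat.exists_eq_add_of_le' hn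
      rw [auxCoeff_add, norm_mul, Complex.norm_natCast]
      set G : ℝ := Real.exp (C * (h + S : ℕ) * max x 0 - A₁ * L * ((h + S : ℕ) : ℝ) ^ 2) with hG
      have hG0 : 0 < G := Real.exp_pos _
      clear_value G
      have hterm : ∀ k ∈ Finset.range S, ∀ s ∈ Is k, h.factorial * ‖(if s ≤ h then
          τ ^ m₀ k / ((τ + 1) * ε ^ m₀ k) * (b k s ε * (((q ^ m₁ k)⁻¹) ^ (h - s) *
            (auxCoeff q S Is b m₀ m₁ w ε τ (h - s + k) / (h - s).factorial)))
          else 0)‖ ≤ (h + S).factorial * (Q k s * (D * K ^ (h + S - 1) * G)) := by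
        intro k hk s hs
        have hk := Finset.mem_range.mp hk
        split_ifs with hsh
        swap
        · rw [norm_zero, mul_zero]
          have := hQ0 k s
          positivity
        have i1 := ih (h - s + k) (by omega)
        obtain ⟨a1, a2⟩ := hA k hk s hs
        have n1 : ‖τ ^ m₀ k / ((τ + 1) * ε ^ m₀ k)‖ ≤ Real.exp (m₀ k * x) / δ := by
          rw [norm_div, norm_mul, norm_pow, norm_pow, Real.exp_nat_mul, hxexp, div_pow,
            div_div, mul_comm ‖τ + 1‖]
          have := norm_pos_iff.mpr hε
          gcongr
        have n2 : ‖((q ^ m₁ k)⁻¹) ^ (h - s)‖ = Real.exp (-(L * (m₁ k * ((h - s : ℕ) : ℝ)))) := by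
          rw [norm_pow, norm_inv, norm_pow, Real.exp_neg, inv_pow, ← pow_mul]
          congr 1
          rw [← Nat.cast_mul, mul_comm L, Real.exp_nat_mul, hL,
            Real.exp_log (by linarith)]
        have n3 : K ^ (h - s + k) ≤ K ^ (h + S - 1) := pow_le_pow_right₀ hK1 (by omega)
        have n4 := factorial_div_le hsh hk
        have n5 := auxCoeff_exponent_le (x := x) (k := k) (γ := (h - s + k : ℕ))
          (β := (h + S : ℕ)) hLpos.le a1 a2 (by positivity) (by push_cast; linarith [Nat.cast_nonneg (α := ℝ) (h - s)])
          (by push_cast [Nat.cast_sub hsh]; ring)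
        have n6 : ((h - s + k : ℕ) : ℝ) - k = ((h - s : ℕ) : ℝ) := by push_cast; ring
        rw [n6] at n5
        rw [norm_mul, norm_mul, norm_mul, norm_div (auxCoeff _ _ _ _ _ _ _ _ _ _), Complex.norm_natCast, n2]
        have n7 := auxCoeff_step_le (Nat.cast_nonneg h.factorial)
          (Nat.cast_nonneg (h - s).factorial) (Nat.cast_nonneg (h - s + k).factorial) hB hδ hD0
          (Real.exp_pos (-(L * (m₁ k * ((h - s : ℕ) : ℝ))))).le (norm_nonneg _)
          (norm_nonneg _) (Real.exp_pos _).le (Real.exp_pos _).le (by positivity)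
          n1 (hb k hk s hs) i1 n3 n4 (Real.exp_le_exp.mpr n5)
          (by rw [← Real.exp_add, ← Real.exp_add]; congr 1)
        refine n7.trans_eq ?_
        rw [Real.exp_add, hQ, hG]
        ring
      calc (h.factorial : ℝ) * ‖∑ k ∈ Finset.range S, ∑ s ∈ Is k, if s ≤ h then
          τ ^ m₀ k / ((τ + 1) * ε ^ m₀ k) * (b k s ε * (((q ^ m₁ k)⁻¹) ^ (h - s) *
            (auxCoeff q S Is b m₀ m₁ w ε τ (h - s + k) / (h - s).factorial)))
          else 0‖ ≤ ∑ k ∈ Finset.range S, ∑ s ∈ Is k, (h + S).factorial *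
            (Q k s * (D * K ^ (h + S - 1) * G)) := by
            refine (mul_le_mul_of_nonneg_left ((norm_sum_le _ _).trans
              (Finset.sum_le_sum fun k _ => norm_sum_le _ _)) (Nat.cast_nonneg _)).trans ?_
            simp_rw [Finset.mul_sum]
            exact Finset.sum_le_sum fun k hk => Finset.sum_le_sum fun s hs => hterm k hk s hs
        _ = (h + S).factorial * ((∑ k ∈ Finset.range S, ∑ s ∈ Is k, Q k s) *
            (D * K ^ (h + S - 1) * G)) := by
            simp_rw [Finset.sum_mul, Finset.mul_sum]
        _ ≤ (h + S).factorial * (K * (D * K ^ (h + S - 1) * G)) := by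
            gcongr
            rw [hK]; linarith
        _ = (h + S).factorial * (D * K ^ (h + S) * G) := by
            -- The subtraction in h + S - 1 truncates only when S = 0; then the sum over k is empty
            -- and K = 1.
            rcases Nat.eq_zero_or_pos (h + S) with h0 | h0
            · have : S = 0 := by omega
              subst this
              simp [hK, h0]
            · have : K ^ (h + S) = K * K ^ (h + S - 1) := by
                rw [← pow_succ']; congr 1; omega
              rw [this]; ring

end

end auxiliaryProblem

/-! ### Trading growth in n for growth in log|τ/ε|. -/

section majorant

lemma summable_pow_mul_exp_neg_sq {c : ℝ} (hc : 0 < c) (R : ℝ) :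
    Summable fun n : ℕ => R ^ n * Real.exp (-(c * (n : ℝ) ^ 2)) := by
  have h1 : Tendsto (fun n : ℕ => |R| * Real.exp (-(c * (n : ℝ)))) atTop (𝓝 (|R| * 0)) := by
    refine Tendsto.const_mul _ (Real.tendsto_exp_neg_atTop_nhds_zero.comp ?_)
    exact tendsto_natCast_atTop_atTop.const_mul_atTop hc
  rw [mul_zero] at h1
  have h2 := h1.eventually_lt_const (show (0 : ℝ) < 1 / 2 by norm_num)
  refine Summable.of_norm_bounded_eventually_nat (g := fun n => (1 / 2 : ℝ) ^ n)
    (summable_geometric_of_lt_one (by norm_num) (by norm_num)) ?_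
  filter_upwards [h2] with n hn
  have e : Real.exp (-(c * (n : ℝ) ^ 2)) = Real.exp (-(c * n)) ^ n := by
    rw [← Real.exp_nat_mul]; congr 1; ring
  rw [e, norm_mul, norm_pow, Real.norm_eq_abs, Real.norm_of_nonneg (by positivity), ← mul_pow]
  exact pow_le_pow_left₀ (by positivity) hn.le n

variable {q : ℂ}

/-- For |τ| ≤ |ε| < 1 the point lies in the punctured disc, where the data are bounded, so growth is
only felt when |τ/ε| > 1. This one-sided bound is what later gives estimates uniform as t → 0. -/
lemma IsAdmissible.exists_norm_le {M r₀ ρ₀ : ℝ} {U V : Set ℂ} {W WUV : ℂ → ℂ → ℂ}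
    (h : IsAdmissible q M r₀ ρ₀ U V W WUV) (hU : spiralDown q U ⊆ Metric.ball 0 r₀)
    (hU0 : (0 : ℂ) ∉ spiralDown q U) (hr₀ : r₀ ≤ 1) (hρ₀ : 1 < ρ₀) :
    ∃ D₀ : ℝ, 0 ≤ D₀ ∧ ∀ ε ∈ spiralDown q U, ∀ τ ∈ contSpiralUp q V ∪ puncturedDisc ρ₀,
      τ ≠ 0 → ‖WUV ε τ‖ ≤ D₀ * Real.exp (M * max (Real.log ‖τ / ε‖) 0 ^ 2) := by
  obtain ⟨Δ, Mt, hΔ, hMt, hMtM, -, ⟨B, hB⟩, -, -, heq, hbd⟩ := h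
  refine ⟨Δ + |B|, by positivity, fun ε hε τ hτ hτ0 => ?_⟩
  have hε0 : ε ≠ 0 := fun h => hU0 (h ▸ hε)
  have hεr := hU hε
  rw [mem_ball_zero_iff] at hεr
  have hεp := norm_pos_iff.mpr hε0
  rcases le_or_gt (Real.log ‖τ / ε‖) 0 with hx | hx
  · rw [max_eq_right hx]
    have h1 : ‖τ / ε‖ ≤ 1 := by
      by_contra! h1
      exact absurd (Real.log_pos h1) (by linarith)
    rw [norm_div, div_le_one hεp] at h1
    have h2 : τ ∈ puncturedDisc ρ₀ := ⟨by rw [mem_ball_zero_iff]; linarith, hτ0⟩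
    rw [heq ε hε τ h2]
    have h3 := hB ε ⟨hU hε, hε0⟩ τ h2
    simp only [ne_eq, OfNat.ofNat_ne_zero, not_false_eq_true, zero_pow, mul_zero, Real.exp_zero,
      mul_one]
    exact h3.trans ((le_abs_self B).trans (by linarith))
  · rw [max_eq_left hx.le]
    refine (hbd ε hε τ hτ).trans ?_
    gcongr
    · linarith [abs_nonneg B]

lemma exists_auxCoeff_majorant (hq : 1 < ‖q‖) {S : ℕ} {Is : ℕ → Finset ℕ} {b : ℕ → ℕ → ℂ → ℂ}
    {m₀ m₁ : ℕ → ℕ} {w : ℕ → ℂ → ℂ → ℂ} {A₁ C M M' B δ D₀ : ℝ} {E D : Set ℂ}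
    (hA : AssumptionA S Is m₀ m₁ A₁ C) (hA₁ : 0 < A₁) (hC : 0 ≤ C)
    (hM' : C ^ 2 < 4 * A₁ * Real.log ‖q‖ * (M' - M)) (hB : 0 ≤ B) (hδ : 0 < δ) (hD₀ : 0 ≤ D₀)
    (hE0 : (0 : ℂ) ∉ E) (hb : ∀ ε ∈ E, ∀ k < S, ∀ s ∈ Is k, ‖b k s ε‖ ≤ B)
    (hw : ∀ j < S, ∀ ε ∈ E, ∀ τ ∈ D, τ ≠ 0 →
      ‖w j ε τ‖ ≤ D₀ * Real.exp (M * max (Real.log ‖τ / ε‖) 0 ^ 2)) :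
    ∃ κ : ℕ → ℝ, (∀ n, 0 ≤ κ n) ∧ (∀ ρ : ℝ, Summable fun n => κ n * ρ ^ n) ∧
      ∀ ε ∈ E, ∀ τ ∈ D, τ ≠ 0 → δ ≤ ‖τ + 1‖ → ∀ n : ℕ,
        ‖auxCoeff q S Is b m₀ m₁ w ε τ n‖ ≤
          n.factorial * (κ n * Real.exp (M' * max (Real.log ‖τ / ε‖) 0 ^ 2)) := by
  obtain ⟨K, hK1, hK⟩ := exists_norm_auxCoeff_le (b := b) hq hA hB hδ hA₁.le hC
  set L := Real.log ‖q‖ with hL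
  have hLpos : 0 < L := Real.log_pos hq
  set a := M' - M with ha
  have hapos : 0 < a := by
    by_contra! h
    have : 4 * A₁ * L * a ≤ 0 := mul_nonpos_of_nonneg_of_nonpos (by positivity) h
    nlinarith
  -- The part A₂ of the Gaussian in n dominates the cross term C n y with the help of a y², which
  -- needs C² ≤ 4 A₂ L a; the part A₁ - A₂ > 0 remains for summability.
  set A₂ := (A₁ + C ^ 2 / (4 * L * a)) / 2 with hA₂
  have h1 : C ^ 2 / (4 * L * a) < A₁ := by
    rw [div_lt_iff₀ (by positivity)]; linarith
  have h2 : A₂ < A₁ := by rw [hA₂]; linarith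
  have h3 : C ^ 2 / (4 * L * a) < A₂ := by rw [hA₂]; linarith
  have h4 : C ^ 2 ≤ 4 * A₂ * L * a := by
    rw [div_lt_iff₀ (by positivity)] at h3; linarith
  have hA₂pos : 0 < A₂ := lt_of_le_of_lt (by positivity) h3
  refine ⟨fun n => D₀ * Real.exp (A₁ * L * S ^ 2) * K ^ n *
    Real.exp (-((A₁ - A₂) * L * (n : ℝ) ^ 2)), fun n => by positivity, fun ρ => ?_, ?_⟩
  · have hc : 0 < (A₁ - A₂) * L := mul_pos (by linarith) hLpos
    refine ((summable_pow_mul_exp_neg_sq hc (K * ρ)).mul_left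
      (D₀ * Real.exp (A₁ * L * S ^ 2))).congr fun n => ?_
    rw [mul_pow]
    ring
  · intro ε hε τ hτ hτ0 hδτ n
    have hε0 : ε ≠ 0 := fun h => hE0 (h ▸ hε)
    set y := max (Real.log ‖τ / ε‖) 0 with hy
    refine (hK w ε τ (D₀ * Real.exp (M * y ^ 2)) (by positivity) hε0 hτ0 (hb ε hε) hδτ
      (fun j hj => hw j hj ε hε τ hτ hτ0) n).trans ?_
    gcongr ?_ * ?_
    have h5 : 0 ≤ A₂ * L * (n : ℝ) ^ 2 - C * n * y + a * y ^ 2 := by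
      have h6 : 0 ≤ (2 * A₂ * L * n - C * y) ^ 2 + (4 * A₂ * L * a - C ^ 2) * y ^ 2 := by
        have : 0 ≤ 4 * A₂ * L * a - C ^ 2 := by linarith
        positivity
      have h7 : (2 * A₂ * L * n - C * y) ^ 2 + (4 * A₂ * L * a - C ^ 2) * y ^ 2 =
          4 * A₂ * L * (A₂ * L * (n : ℝ) ^ 2 - C * n * y + a * y ^ 2) := by ring
      rw [h7] at h6
      exact nonneg_of_mul_nonneg_right h6 (by positivity)
    have h8 : Real.exp (M * y ^ 2) * Real.exp (C * n * y - A₁ * L * (n : ℝ) ^ 2) ≤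
        Real.exp (-((A₁ - A₂) * L * (n : ℝ) ^ 2)) * Real.exp (M' * y ^ 2) := by
      rw [← Real.exp_add, ← Real.exp_add, Real.exp_le_exp]
      have : M' = M + a := by rw [ha]; ring
      rw [this]
      linarith
    calc D₀ * Real.exp (M * y ^ 2) * Real.exp (A₁ * L * S ^ 2) * K ^ n *
          Real.exp (C * n * y - A₁ * L * (n : ℝ) ^ 2)
        = D₀ * Real.exp (A₁ * L * S ^ 2) * K ^ n * (Real.exp (M * y ^ 2) *
          Real.exp (C * n * y - A₁ * L * (n : ℝ) ^ 2)) := by ring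
      _ ≤ D₀ * Real.exp (A₁ * L * S ^ 2) * K ^ n *
          (Real.exp (-((A₁ - A₂) * L * (n : ℝ) ^ 2)) * Real.exp (M' * y ^ 2)) := by gcongr
      _ = _ := by ring

end majorant

/-! ### Holomorphy of dominated series and integrals in several variables. -/

section holomorphy

variable {E : Type*} [NormedAddCommGroup E] [NormedSpace ℂ E]

lemma norm_fderiv_le_of_ball {f : E → ℂ} {p₀ p : E} {r B : ℝ}
    (hf : DifferentiableOn ℂ f (Metric.ball p₀ r)) (hB : ∀ x ∈ Metric.ball p₀ r, ‖f x‖ ≤ B)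
    (hp : p ∈ Metric.ball p₀ (r / 2)) : ‖fderiv ℂ f p‖ ≤ 2 * B / (r / 2) := by
  have hr : 0 < r / 2 := (dist_nonneg).trans_lt (Metric.mem_ball.mp hp)
  have hsub : Metric.ball p (r / 2) ⊆ Metric.ball p₀ r := by
    refine Metric.ball_subset_ball' ?_
    have := Metric.mem_ball.mp hp
    linarith
  refine Complex.norm_fderiv_le_div_of_mapsTo_ball (hf.mono hsub) (fun x hx => ?_) hr
  rw [mem_closedBall_iff_norm]
  have h1 := hB x (hsub hx)
  have h2 := hB p (hsub (Metric.mem_ball_self hr))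
  linarith [norm_sub_le (f x) (f p)]

lemma differentiableAt_tsum_of_bound {f : ℕ → E → ℂ} {U : Set E} (hU : IsOpen U) {p₀ : E}
    (hp₀ : p₀ ∈ U) (hf : ∀ n, DifferentiableOn ℂ (f n) U) {u : ℕ → ℝ} (hu : Summable u)
    (hb : ∀ n, ∀ x ∈ U, ‖f n x‖ ≤ u n) : DifferentiableAt ℂ (fun x => ∑' n, f n x) p₀ := by
  obtain ⟨r, hr, hrU⟩ := Metric.isOpen_iff.mp hU p₀ hp₀
  have hr2 : 0 < r / 2 := by linarith
  have hsub : Metric.ball p₀ (r / 2) ⊆ Metric.ball p₀ r :=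
    Metric.ball_subset_ball (by linarith)
  let : NormedSpace ℝ E := NormedSpace.restrictScalars ℝ ℂ E
  have hpre : IsPreconnected (Metric.ball p₀ (r / 2)) := (convex_ball p₀ (r / 2)).isPreconnected
  refine (hasFDerivAt_tsum_of_isPreconnected (u := fun n => 2 * u n / (r / 2))
    (f' := fun n x => fderiv ℂ (f n) x) ((hu.mul_left 2).div_const _)
    Metric.isOpen_ball hpre (fun n x hx => ?_) (fun n x hx => ?_)
    (Metric.mem_ball_self hr2) ?_ (Metric.mem_ball_self hr2)).differentiableAt
  · exact ((hf n).differentiableAt (hU.mem_nhds (hrU (hsub hx)))).hasFDerivAt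
  · exact norm_fderiv_le_of_ball ((hf n).mono hrU) (fun y hy => hb n y (hrU hy)) hx
  · exact Summable.of_norm_bounded hu fun n => hb n p₀ hp₀

/-- A Cauchy estimate on a ball of half the radius turns domination of the integrand into domination
of its derivative. Measurability in s of that derivative comes from writing its two directional
values as limits of difference quotients. -/
lemma differentiableAt_integral_of_bound {F : ℂ × ℂ → ℝ → ℂ} {U : Set (ℂ × ℂ)} (hU : IsOpen U)
    {p₀ : ℂ × ℂ} (hp₀ : p₀ ∈ U) (hF : ∀ s, DifferentiableOn ℂ (fun p => F p s) U)
    (hm : ∀ p ∈ U, AEStronglyMeasurable (F p)) {g : ℝ → ℝ} (hg : Integrable g)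
    (hb : ∀ p ∈ U, ∀ s, ‖F p s‖ ≤ g s) :
    DifferentiableAt ℂ (fun p => ∫ s, F p s) p₀ := by
  obtain ⟨r, hr, hrU⟩ := Metric.isOpen_iff.mp hU p₀ hp₀
  have hr2 : 0 < r / 2 := by linarith
  have hsub : Metric.ball p₀ (r / 2) ⊆ Metric.ball p₀ r :=
    Metric.ball_subset_ball (by linarith)
  have hd : ∀ s, DifferentiableAt ℂ (fun p => F p s) p₀ := fun s =>
    (hF s).differentiableAt (hU.mem_nhds hp₀)
  have hdir : ∀ v : ℂ × ℂ,
      AEStronglyMeasurable (fun s => fderiv ℂ (fun p => F p s) p₀ v) := by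
    intro v
    -- The quotients are indexed from n₀ on so that every point used lies in U, where measurability
    -- is assumed.
    obtain ⟨n₀, hn₀⟩ : ∃ n₀ : ℕ, ∀ n : ℕ, n₀ ≤ n → p₀ + ((n : ℂ) + 1)⁻¹ • v ∈ U := by
      have h1 : Tendsto (fun n : ℕ => p₀ + ((n : ℂ) + 1)⁻¹ • v) atTop (𝓝 (p₀ + (0 : ℂ) • v)) := by
        refine tendsto_const_nhds.add (Tendsto.smul_const ?_ v)
        have := tendsto_one_div_add_atTop_nhds_zero_nat (𝕜 := ℂ)
        simpa using this
      rw [zero_smul, add_zero] at h1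
      exact eventually_atTop.mp (h1.eventually (hU.mem_nhds hp₀))
    refine aestronglyMeasurable_of_tendsto_ae atTop
      (f := fun n s => ((n + n₀ : ℕ) + 1 : ℂ) •
        (F (p₀ + (((n + n₀ : ℕ) : ℂ) + 1)⁻¹ • v) s - F p₀ s)) (fun n => ?_) ?_
    · exact ((hm _ (hn₀ (n + n₀) (by omega))).sub (hm _ hp₀)).const_smul
        (((n + n₀ : ℕ) : ℂ) + 1)
    · refine Eventually.of_forall fun s => ?_
      have h2 : ∀ m : ℕ, ((m : ℂ) + 1) ≠ 0 := fun m => by exact_mod_cast m.succ_ne_zero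
      have h1 := ((hd s).hasFDerivAt.lim v (α := ℕ) (c := fun n => (((n + n₀ : ℕ) : ℂ) + 1))
        (l := atTop) (𝕜 := ℂ) ?_)
      · exact h1
      · have h3 : Tendsto (fun n : ℕ => ‖(n : ℂ) + 1‖) atTop atTop := by
          have h4 : ∀ n : ℕ, ‖(n : ℂ) + 1‖ = n + 1 := by
            intro n
            have : ((n : ℂ) + 1) = ((n + 1 : ℕ) : ℂ) := by push_cast; ring
            rw [this, Complex.norm_natCast]; push_cast; ring
          simp_rw [h4]
          exact tendsto_atTop_add_const_right _ _ tendsto_natCast_atTop_atTop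
        exact h3.comp (tendsto_add_atTop_nat n₀)
  have hmeas : AEStronglyMeasurable (fun s => fderiv ℂ (fun p => F p s) p₀) := by
    have e : (fun s => fderiv ℂ (fun p => F p s) p₀) = fun s =>
        (fderiv ℂ (fun p => F p s) p₀ (1, 0)) • ContinuousLinearMap.fst ℂ ℂ ℂ +
        (fderiv ℂ (fun p => F p s) p₀ (0, 1)) • ContinuousLinearMap.snd ℂ ℂ ℂ := by
      funext s
      ext <;> simp
    rw [e]
    exact ((hdir (1, 0)).smul_const _).add ((hdir (0, 1)).smul_const _)
  refine (hasFDerivAt_integral_of_dominated_of_fderiv_le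
    (F' := fun p s => fderiv ℂ (fun p => F p s) p)
    (bound := fun s => 2 * g s / (r / 2)) (Metric.ball_mem_nhds p₀ hr2) ?_ ?_ hmeas ?_ ?_
    ?_).differentiableAt
  · filter_upwards [hU.mem_nhds hp₀] with p hp using hm p hp
  · exact hg.mono' (hm p₀ hp₀) (Eventually.of_forall (hb p₀ hp₀))
  · exact Eventually.of_forall fun s p hp =>
      norm_fderiv_le_of_ball ((hF s).mono hrU) (fun y hy => hb y (hrU hy) s) hp
  · exact (hg.const_mul 2).div_const _
  · exact Eventually.of_forall fun s p hp =>
      ((hF s).differentiableAt (hU.mem_nhds (hrU (hsub hp)))).hasFDerivAt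

end holomorphy

/-! ### Entire exponential generating series and their derivatives. -/

section entire

/-- The sequence `a` satisfies `∑ ‖a n‖ ρ ^ n / n! < ∞` for all `ρ`. -/
def IsEntireSeq (a : ℕ → ℂ) : Prop :=
  ∀ ρ : ℝ, Summable fun n => ‖a n‖ / n.factorial * ρ ^ n

variable {a : ℕ → ℂ}

lemma IsEntireSeq.hasSum (ha : IsEntireSeq a) (z : ℂ) :
    HasSum (fun n => a n * (z ^ n / (n.factorial : ℂ))) (∑' n, a n * (z ^ n / (n.factorial : ℂ))) := by
  refine Summable.hasSum (Summable.of_norm ((ha ‖z‖).congr fun n => ?_))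
  rw [norm_mul, norm_div, norm_pow, Complex.norm_natCast]
  ring

/-- The factor n + 1 lost by the factorial is at most 2^(n+1), which a doubled radius absorbs. -/
lemma IsEntireSeq.shift (ha : IsEntireSeq a) : IsEntireSeq fun n => a (n + 1) := by
  intro ρ
  have h := (summable_nat_add_iff 1).mpr (ha (2 * (|ρ| + 1)))
  refine Summable.of_norm_bounded h fun n => ?_
  rw [norm_mul, norm_pow, Real.norm_eq_abs ρ, Real.norm_of_nonneg (by positivity),
    Nat.factorial_succ]
  have h1 : ((n : ℝ) + 1) ≤ 2 ^ (n + 1) := by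
    exact_mod_cast (Nat.lt_two_pow_self (n := n + 1)).le
  have h2 : |ρ| ^ n ≤ (|ρ| + 1) ^ (n + 1) := by
    calc |ρ| ^ n ≤ (|ρ| + 1) ^ n := by gcongr; linarith
      _ ≤ (|ρ| + 1) ^ (n + 1) := pow_le_pow_right₀ (by linarith [abs_nonneg ρ]) (by omega)
  have h3 : (0 : ℝ) < n.factorial := by positivity
  calc ‖a (n + 1)‖ / n.factorial * |ρ| ^ n
      ≤ ‖a (n + 1)‖ / n.factorial * (|ρ| + 1) ^ (n + 1) := by gcongr
    _ = ‖a (n + 1)‖ / (((n + 1 : ℕ) : ℝ) * n.factorial) * ((n + 1) * (|ρ| + 1) ^ (n + 1)) := by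
        push_cast; field_simp
    _ ≤ ‖a (n + 1)‖ / (((n + 1 : ℕ) : ℝ) * n.factorial) * (2 ^ (n + 1) * (|ρ| + 1) ^ (n + 1)) := by
        gcongr
    _ = _ := by push_cast; rw [mul_pow]

lemma IsEntireSeq.shift_add (ha : IsEntireSeq a) (k : ℕ) : IsEntireSeq fun n => a (n + k) := by
  induction k with
  | zero => exact ha
  | succ k ih =>
    have := ih.shift
    simpa [add_assoc, add_comm 1 k] using this

lemma IsEntireSeq.hasDerivAt (ha : IsEntireSeq a) (z : ℂ) :
    HasDerivAt (fun z => ∑' n, a n * (z ^ n / (n.factorial : ℂ)))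
      (∑' n, a (n + 1) * (z ^ n / (n.factorial : ℂ))) z := by
  have hR : 0 < ‖z‖ + 1 := by positivity
  set R := ‖z‖ + 1
  have hterm : ∀ (n : ℕ) (y : ℂ), a (n + 1) * (((n + 1 : ℕ) : ℂ) * y ^ n / ((n + 1).factorial : ℂ)) =
      a (n + 1) * (y ^ n / (n.factorial : ℂ)) := by
    intro n y
    rw [Nat.factorial_succ]
    have h1 : (n.factorial : ℂ) ≠ 0 := by exact_mod_cast n.factorial_ne_zero
    have h2 : ((n : ℂ) + 1) ≠ 0 := by exact_mod_cast n.succ_ne_zero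
    push_cast
    field_simp
  have hu : Summable fun n : ℕ =>
      ‖a n‖ * ((n : ℝ) * R ^ (n - 1) / (n.factorial : ℝ)) := by
    rw [← summable_nat_add_iff 1]
    refine (ha.shift R).congr fun n => ?_
    rw [Nat.factorial_succ]
    simp only [Nat.add_sub_cancel]
    push_cast
    field_simp
  have h := hasDerivAt_tsum_of_isPreconnected (𝕜 := ℂ)
    (g := fun n z => a n * (z ^ n / (n.factorial : ℂ)))
    (g' := fun n z => a n * ((n : ℂ) * z ^ (n - 1) / (n.factorial : ℂ))) hu
    (Metric.isOpen_ball (x := (0 : ℂ)) (ε := R)) (convex_ball _ _).isPreconnected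
    (fun n y _ => (((hasDerivAt_pow n y).div_const _).const_mul _)) (fun n y hy => ?_)
    (Metric.mem_ball_self hR) (ha.hasSum 0).summable
    (y := z) (by rw [mem_ball_zero_iff]; simp [R])
  · have e : ∑' n, a n * ((n : ℂ) * z ^ (n - 1) / (n.factorial : ℂ)) =
        ∑' n, a (n + 1) * (z ^ n / (n.factorial : ℂ)) := by
      have hs : HasSum (fun n => a (n + 1) * (((n + 1 : ℕ) : ℂ) * z ^ (n + 1 - 1) / ((n + 1).factorial : ℂ)))
          (∑' n, a (n + 1) * (z ^ n / (n.factorial : ℂ))) := by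
        simp only [Nat.add_sub_cancel]
        simp_rw [hterm]
        exact ha.shift.hasSum z
      have := (hasSum_nat_add_iff (f := fun n : ℕ =>
        a n * ((n : ℂ) * z ^ (n - 1) / (n.factorial : ℂ))) 1).mp hs
      simpa using this.tsum_eq
    rw [← e]
    exact h
  · rw [norm_mul, norm_div, norm_mul, norm_pow, Complex.norm_natCast, Complex.norm_natCast]
    have := mem_ball_zero_iff.mp hy
    gcongr

lemma IsEntireSeq.iteratedDeriv (ha : IsEntireSeq a) (k : ℕ) :
    iteratedDeriv k (fun z => ∑' n, a n * (z ^ n / (n.factorial : ℂ))) =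
      fun z => ∑' n, a (n + k) * (z ^ n / (n.factorial : ℂ)) := by
  induction k with
  | zero => simp
  | succ k ih =>
    rw [iteratedDeriv_succ, ih]
    funext z
    rw [((ha.shift_add k).hasDerivAt z).deriv]
    simp [add_assoc, add_comm 1 k]

lemma tsum_entire_zero (a : ℕ → ℂ) : ∑' n, a n * ((0 : ℂ) ^ n / (n.factorial : ℂ)) = a 0 := by
  rw [tsum_eq_single 0 fun n hn => by simp [hn]]
  simp

lemma hasSum_pow_mul_shift {d : ℕ → ℂ} {z v : ℂ} (s : ℕ)
    (h : HasSum (fun n => d n * (z ^ n / (n.factorial : ℂ))) v) :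
    HasSum (fun n => if s ≤ n then d (n - s) * (z ^ n / ((n - s).factorial : ℂ)) else 0)
      (z ^ s * v) := by
  have hinj : Function.Injective fun n : ℕ => n + s := add_left_injective s
  rw [← hinj.hasSum_iff]
  · refine (h.mul_left (z ^ s)).congr_fun ?_ 
    intro n
    simp [pow_add]
    ring
  · intro n hn
    rw [if_neg]
    intro hsn
    exact hn ⟨n - s, Nat.sub_add_cancel hsn⟩

end entire

/-! ### The q-Laplace transform of a family of coefficients. -/

section laplaceFamily

variable {q l : ℂ}

lemma qLaplaceIntegrand_eq (hl : l ≠ 0) (F : ℂ → ℂ) (z : ℂ) (s : ℝ) :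
    qLaplaceIntegrand q l F z s =
      Complex.log q * (F (qpow q s * l) / theta q (qpow q s * l / z)) := by
  have h : qpow q s * l ≠ 0 := mul_ne_zero (qpow_ne_zero q s) hl
  unfold qLaplaceIntegrand
  generalize qpow q s * l = y at h
  rw [div_mul_eq_mul_div, ← mul_assoc, mul_div_mul_right _ _ h]
  ring

/-- The exchange of multiplication by τ with z σ_q is the functional equation of Θ at ξ/(qz). It
holds before integration, so integrability transfers as well. -/
lemma qLaplaceIntegrand_mul (hq : q ≠ 0) (hl : l ≠ 0) (F : ℂ → ℂ) {z : ℂ} (hz : z ≠ 0) (s : ℝ) :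
    qLaplaceIntegrand q l (fun τ => τ * F τ) z s = z * qLaplaceIntegrand q l F (q * z) s := by
  have h : qpow q s * l ≠ 0 := mul_ne_zero (qpow_ne_zero q s) hl
  rw [qLaplaceIntegrand_eq hl, qLaplaceIntegrand_eq hl]
  have e : qpow q s * l / z = q * (qpow q s * l / (q * z)) := by field_simp
  have h0 : qpow q s * l / (q * z) ≠ 0 := div_ne_zero h (mul_ne_zero hq hz)
  have e2 : q * (qpow q s * l / (q * z)) = qpow q s * l / z := e.symm
  rw [e, theta_mul_q hq h0, e2]
  generalize theta q (qpow q s * l / (q * z)) = t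
  generalize qpow q s * l = y at h
  rcases eq_or_ne t 0 with ht | ht
  · simp [ht]
  · field_simp

lemma qLaplace_mul (hq : q ≠ 0) (hl : l ≠ 0) (F : ℂ → ℂ) {z : ℂ} (hz : z ≠ 0) :
    qLaplace q l (fun τ => τ * F τ) z = z * qLaplace q l F (q * z) := by
  unfold qLaplace
  simp_rw [qLaplaceIntegrand_mul hq hl F hz, integral_const_mul]
  ring

lemma qLaplaceIntegrand_pow_mul (hq : q ≠ 0) (hl : l ≠ 0) (F : ℂ → ℂ) (m : ℕ) :
    ∀ z : ℂ, z ≠ 0 → ∃ c : ℂ, ∀ s, qLaplaceIntegrand q l (fun τ => τ ^ m * F τ) z s =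
      c * qLaplaceIntegrand q l F (q ^ m * z) s := by
  induction m with
  | zero => intro z _; exact ⟨1, by simp⟩
  | succ m ih =>
    intro z hz
    obtain ⟨c, hc⟩ := ih (q * z) (mul_ne_zero hq hz)
    refine ⟨z * c, fun s => ?_⟩
    have e : (fun τ : ℂ => τ ^ (m + 1) * F τ) = fun τ => τ * (τ ^ m * F τ) := by
      funext τ; ring
    rw [e, qLaplaceIntegrand_mul hq hl _ hz, hc, pow_succ]
    ring_nf

lemma tSigma_iterate_qLaplace (hq : q ≠ 0) (hl : l ≠ 0) (F : ℂ → ℂ) {ε : ℂ} (hε : ε ≠ 0) (m : ℕ) :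
    ∀ t : ℂ, t ≠ 0 → (tSigma q)^[m] (fun t' => qLaplace q l F (ε * t')) t =
      (ε ^ m)⁻¹ * qLaplace q l (fun τ => τ ^ m * F τ) (ε * t) := by
  induction m with
  | zero => intro t _; simp
  | succ m ih =>
    intro t ht
    rw [Function.iterate_succ_apply', tSigma, ih (q * t) (mul_ne_zero hq ht)]
    have e : (fun τ : ℂ => τ ^ (m + 1) * F τ) = fun τ => τ * (τ ^ m * F τ) := by
      funext τ; ring
    rw [e, qLaplace_mul hq hl _ (mul_ne_zero hε ht), pow_succ,
      show q * (ε * t) = ε * (q * t) by ring]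
    field_simp

/-- The scalar p does not depend on f, so the operator passes through infinite sums without any
interchange argument. -/
lemma exists_tSigma_iterate (q : ℂ) (m : ℕ) (t : ℂ) :
    ∃ p : ℂ, ∀ f : ℂ → ℂ, (tSigma q)^[m] f t = p * f (q ^ m * t) := by
  induction m generalizing t with
  | zero => exact ⟨1, by simp⟩
  | succ m ih =>
    obtain ⟨p, hp⟩ := ih (q * t)
    refine ⟨t * p, fun f => ?_⟩
    rw [Function.iterate_succ_apply', tSigma, hp, pow_succ]
    ring_nf

/-- A sequence of functions whose `q`-Laplace transforms along the spiral through `l` define an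
entire series, locally uniformly on `E × T`. The variables of `W n` are `ε` and `τ`. -/
structure IsLaplaceFamily (q l : ℂ) (E T : Set ℂ) (W : ℕ → ℂ → ℂ → ℂ) (κ : ℕ → ℝ)
    (M P c : ℝ) : Prop where
  one_lt : 1 < ‖q‖
  ne_zero : l ≠ 0
  isOpen_E : IsOpen E
  zero_notMem_E : (0 : ℂ) ∉ E
  isOpen_T : IsOpen T
  zero_notMem_T : (0 : ℂ) ∉ T
  mul_mem : ∀ t ∈ T, q * t ∈ T
  M_nonneg : 0 ≤ M
  M_lt : M < P
  c_pos : 0 < c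
  kappa_nonneg : ∀ n, 0 ≤ κ n
  summable_kappa : ∀ ρ : ℝ, Summable fun n => κ n * ρ ^ n
  norm_le : ∀ ε ∈ E, ∀ s : ℝ, ∀ n : ℕ, ‖W n ε (qpow q s * l)‖ ≤
    n.factorial * (κ n * Real.exp (M * max (Real.log ‖qpow q s * l / ε‖) 0 ^ 2))
  theta_ge : ∀ ε ∈ E, ∀ t ∈ T, ∀ s : ℝ,
    c * Real.exp (P * Real.log ‖qpow q s * l / (ε * t)‖ ^ 2) ≤ ‖theta q (qpow q s * l / (ε * t))‖
  differentiableOn : ∀ n, ∀ s : ℝ, DifferentiableOn ℂ (fun ε => W n ε (qpow q s * l)) E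
  continuous : ∀ n, ∀ ε ∈ E, Continuous fun s : ℝ => W n ε (qpow q s * l)

/-- Half of the margin P - M absorbs the cross term 2 P x y; the other half is the decay in s, after
replacing x by sL at the cost of e². -/
lemma gaussian_exponent_le {M P L Y s e y : ℝ} (hM : 0 ≤ M) (hMP : M < P)
    (he : |e| ≤ Y) (hy : |y| ≤ Y) :
    M * max (s * L + e) 0 ^ 2 - P * (s * L + e - y) ^ 2 ≤
      -((P - M) / 4 * L ^ 2 * s ^ 2) +
        ((P - M) / 2 * Y ^ 2 + 2 * P ^ 2 / (P - M) * Y ^ 2) := by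
  have hd : 0 < P - M := by linarith
  set x := s * L + e with hx
  have h1 : max x 0 ^ 2 ≤ x ^ 2 := by
    rcases le_total x 0 with h | h
    · rw [max_eq_right h]; simpa using sq_nonneg x
    · rw [max_eq_left h]
  have hy2 : y ^ 2 ≤ Y ^ 2 := sq_le_sq' (by linarith [neg_abs_le y]) (by linarith [le_abs_self y])
  have he2 : e ^ 2 ≤ Y ^ 2 := sq_le_sq' (by linarith [neg_abs_le e]) (by linarith [le_abs_self e])
  have h2 : 2 * P * x * y ≤ (P - M) / 2 * x ^ 2 + 2 * P ^ 2 / (P - M) * y ^ 2 := by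
    have : 0 ≤ (P - M) / 2 * (x - 2 * P / (P - M) * y) ^ 2 := by positivity
    have e : (P - M) / 2 * (x - 2 * P / (P - M) * y) ^ 2 =
        (P - M) / 2 * x ^ 2 + 2 * P ^ 2 / (P - M) * y ^ 2 - 2 * P * x * y := by
      field_simp; ring
    linarith
  have h3 : s ^ 2 * L ^ 2 ≤ 2 * x ^ 2 + 2 * e ^ 2 := by
    have : s * L = x - e := by rw [hx]; ring
    have h : s ^ 2 * L ^ 2 = (x - e) ^ 2 := by rw [← this]; ring
    rw [h]; nlinarith [sq_nonneg (x + e)]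
  have h4 : 2 * P ^ 2 / (P - M) * y ^ 2 ≤ 2 * P ^ 2 / (P - M) * Y ^ 2 := by gcongr
  have h5 : M * max x 0 ^ 2 ≤ M * x ^ 2 := by gcongr
  have hP : 0 ≤ P * y ^ 2 := mul_nonneg (by linarith) (sq_nonneg y)
  have h6 : (P - M) / 4 * (s ^ 2 * L ^ 2) ≤ (P - M) / 4 * (2 * x ^ 2 + 2 * Y ^ 2) := by
    gcongr; linarith
  linarith

namespace IsLaplaceFamily

variable {E T : Set ℂ} {W : ℕ → ℂ → ℂ → ℂ} {κ : ℕ → ℝ} {M P c : ℝ} {ε t : ℂ}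

lemma norm_integrand_le (h : IsLaplaceFamily q l E T W κ M P c) (hε : ε ∈ E) (ht : t ∈ T)
    (n : ℕ) (s : ℝ) :
    ‖qLaplaceIntegrand q l (W n ε) (ε * t) s‖ ≤ n.factorial * κ n * (‖Complex.log q‖ / c *
      Real.exp (M * max (s * Real.log ‖q‖ + (Real.log ‖l‖ - Real.log ‖ε‖)) 0 ^ 2 -
        P * (s * Real.log ‖q‖ + (Real.log ‖l‖ - Real.log ‖ε‖) - Real.log ‖t‖) ^ 2)) := by
  have hε0 : ε ≠ 0 := fun h0 => h.zero_notMem_E (h0 ▸ hε)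
  have ht0 : t ≠ 0 := fun h0 => h.zero_notMem_T (h0 ▸ ht)
  have hc := h.c_pos
  have hκ := h.kappa_nonneg n
  rw [qLaplaceIntegrand_eq h.ne_zero, norm_mul, norm_div]
  have h1 := h.norm_le ε hε s n
  have h2 := h.theta_ge ε hε t ht s
  have e1 : Real.log ‖qpow q s * l / ε‖ =
      s * Real.log ‖q‖ + (Real.log ‖l‖ - Real.log ‖ε‖) := by
    rw [mul_div_assoc, log_norm_qpow_mul q s (div_ne_zero h.ne_zero hε0), norm_div,
      Real.log_div (norm_ne_zero_iff.mpr h.ne_zero) (norm_ne_zero_iff.mpr hε0)]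
  have e2 : Real.log ‖qpow q s * l / (ε * t)‖ =
      s * Real.log ‖q‖ + (Real.log ‖l‖ - Real.log ‖ε‖) - Real.log ‖t‖ := by
    rw [mul_div_assoc, log_norm_qpow_mul q s (div_ne_zero h.ne_zero (mul_ne_zero hε0 ht0)),
      norm_div, norm_mul, Real.log_div (norm_ne_zero_iff.mpr h.ne_zero)
      (mul_ne_zero (norm_ne_zero_iff.mpr hε0) (norm_ne_zero_iff.mpr ht0)),
      Real.log_mul (norm_ne_zero_iff.mpr hε0) (norm_ne_zero_iff.mpr ht0)]
    ring
  rw [e1] at h1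
  rw [e2] at h2
  rw [Real.exp_sub]
  generalize s * Real.log ‖q‖ + (Real.log ‖l‖ - Real.log ‖ε‖) = x at h1 h2
  calc ‖Complex.log q‖ * (‖W n ε (qpow q s * l)‖ / ‖theta q (qpow q s * l / (ε * t))‖)
      ≤ ‖Complex.log q‖ * (n.factorial * (κ n * Real.exp (M * max x 0 ^ 2)) /
        (c * Real.exp (P * (x - Real.log ‖t‖) ^ 2))) := by gcongr
    _ = _ := by field_simp

lemma continuous_integrand (h : IsLaplaceFamily q l E T W κ M P c) (hε : ε ∈ E) (ht : t ∈ T)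
    (n : ℕ) : Continuous (qLaplaceIntegrand q l (W n ε) (ε * t)) := by
  have hε0 : ε ≠ 0 := fun h0 => h.zero_notMem_E (h0 ▸ hε)
  have ht0 : t ≠ 0 := fun h0 => h.zero_notMem_T (h0 ▸ ht)
  have e : qLaplaceIntegrand q l (W n ε) (ε * t) = fun s => Complex.log q *
      (W n ε (qpow q s * l) / theta q (qpow q s * l / (ε * t))) :=
    funext fun s => qLaplaceIntegrand_eq h.ne_zero _ _ _
  rw [e]
  have h1 : Continuous fun s => theta q (qpow q s * l / (ε * t)) := by
    refine continuous_iff_continuousAt.mpr fun s => ?_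
    have h2 : ContinuousAt (theta q) (qpow q s * l / (ε * t)) :=
      (differentiableAt_theta h.one_lt (div_ne_zero
        (mul_ne_zero (qpow_ne_zero q s) h.ne_zero) (mul_ne_zero hε0 ht0))).continuousAt
    have h3 : Continuous fun s => qpow q s * l / (ε * t) :=
      ((continuous_qpow q).mul continuous_const).div_const _
    exact ContinuousAt.comp (f := fun s => qpow q s * l / (ε * t)) h2 h3.continuousAt
  refine continuous_const.mul ((h.continuous n ε hε).div h1 fun s h0 => ?_)
  have := h.theta_ge ε hε t ht s
  rw [h0, norm_zero] at this
  have hc := h.c_pos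
  exact absurd this (not_le.mpr (by positivity))

/-- A Gaussian majorant of all the integrands at the points `(ε, t)` with bounded logarithms. -/
lemma exists_gaussian_majorant (h : IsLaplaceFamily q l E T W κ M P c) (Y : ℝ) :
    ∃ g : ℝ → ℝ, Integrable g ∧ (∀ s, 0 ≤ g s) ∧ ∀ ε ∈ E, ∀ t ∈ T, |Real.log ‖ε‖| ≤ Y →
      |Real.log ‖t‖| ≤ Y → ∀ n s,
      ‖qLaplaceIntegrand q l (W n ε) (ε * t) s‖ ≤ n.factorial * κ n * g s := by
  have hL : 0 < Real.log ‖q‖ := Real.log_pos h.one_lt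
  have hd : 0 < P - M := by linarith [h.M_lt]
  set Y' := |Real.log ‖l‖| + |Y| with hY'
  set A := (P - M) / 4 * Real.log ‖q‖ ^ 2 with hA
  have hApos : 0 < A := by positivity
  set B := (P - M) / 2 * Y' ^ 2 + 2 * P ^ 2 / (P - M) * Y' ^ 2 with hB
  have hc := h.c_pos
  refine ⟨fun s => ‖Complex.log q‖ / c * (Real.exp (-A * s ^ 2) * Real.exp B), ?_,
    fun s => by positivity, fun ε hε t ht h1 h2 n s => ?_⟩
  · exact ((integrable_exp_neg_mul_sq hApos).mul_const _).const_mul _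
  · refine (h.norm_integrand_le hε ht n s).trans ?_
    have hκ := h.kappa_nonneg n
    simp only [← Real.exp_add]
    gcongr
    have := gaussian_exponent_le (L := Real.log ‖q‖) (s := s)
      (e := Real.log ‖l‖ - Real.log ‖ε‖) (y := Real.log ‖t‖) (Y := Y') h.M_nonneg h.M_lt
      ((abs_sub _ _).trans (by rw [hY']; linarith [le_abs_self Y]))
      (by rw [hY']; linarith [le_abs_self Y, abs_nonneg (Real.log ‖l‖)])
    rwa [← hA, ← hB, ← neg_mul] at this

lemma integrable (h : IsLaplaceFamily q l E T W κ M P c) (hε : ε ∈ E) (ht : t ∈ T)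
    (n : ℕ) : Integrable (qLaplaceIntegrand q l (W n ε) (ε * t)) := by
  obtain ⟨g, hg, -, hb⟩ := h.exists_gaussian_majorant (max |Real.log ‖ε‖| |Real.log ‖t‖|)
  exact (hg.const_mul (n.factorial * κ n)).mono'
    (h.continuous_integrand hε ht n).aestronglyMeasurable (Eventually.of_forall
      (hb ε hε t ht (le_max_left _ _) (le_max_right _ _) n))

lemma exists_norm_qLaplace_le (h : IsLaplaceFamily q l E T W κ M P c) (Y : ℝ) :
    ∃ Γ : ℝ, 0 ≤ Γ ∧ ∀ ε ∈ E, ∀ t ∈ T, |Real.log ‖ε‖| ≤ Y → |Real.log ‖t‖| ≤ Y → ∀ n,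
      ‖qLaplace q l (W n ε) (ε * t)‖ ≤ n.factorial * κ n * Γ := by
  obtain ⟨g, hg, hg0, hb⟩ := h.exists_gaussian_majorant Y
  refine ⟨‖(piq q)⁻¹‖ * ∫ s, g s, mul_nonneg (norm_nonneg _) (integral_nonneg hg0),
    fun ε hε t ht h1 h2 n => ?_⟩
  unfold qLaplace
  rw [norm_mul]
  have := norm_integral_le_of_norm_le (hg.const_mul (n.factorial * κ n))
    (Eventually.of_forall (hb ε hε t ht h1 h2 n))
  rw [integral_const_mul] at this
  calc ‖(piq q)⁻¹‖ * ‖∫ s, qLaplaceIntegrand q l (W n ε) (ε * t) s‖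
      ≤ ‖(piq q)⁻¹‖ * (n.factorial * κ n * ∫ s, g s) := by gcongr
    _ = _ := by ring

lemma summable_of_norm_le {a : ℕ → ℂ} {Γ : ℝ} (h : IsLaplaceFamily q l E T W κ M P c)
    (ha : ∀ n, ‖a n‖ ≤ n.factorial * κ n * Γ) : IsEntireSeq a := by
  intro ρ
  refine Summable.of_norm_bounded ((h.summable_kappa |ρ|).mul_right Γ) fun n => ?_
  have h3 : (0 : ℝ) < n.factorial := by positivity
  rw [norm_mul, norm_pow, Real.norm_eq_abs ρ, Real.norm_of_nonneg (by positivity)]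
  calc ‖a n‖ / n.factorial * |ρ| ^ n ≤ n.factorial * κ n * Γ / n.factorial * |ρ| ^ n := by
        gcongr; exact ha n
    _ = _ := by field_simp

lemma isEntireSeq (h : IsLaplaceFamily q l E T W κ M P c) (hε : ε ∈ E) (ht : t ∈ T) :
    IsEntireSeq fun n => qLaplace q l (W n ε) (ε * t) := by
  obtain ⟨Γ, -, hb⟩ := h.exists_norm_qLaplace_le (max |Real.log ‖ε‖| |Real.log ‖t‖|)
  exact h.summable_of_norm_le (hb ε hε t ht (le_max_left _ _) (le_max_right _ _))

lemma exists_nhds_log_bound {x : ℂ} {D : Set ℂ} (hD : IsOpen D) (hx : x ∈ D) (h0 : (0 : ℂ) ∉ D) :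
    ∃ U ⊆ D, IsOpen U ∧ x ∈ U ∧ ∃ Y, ∀ y ∈ U, |Real.log ‖y‖| ≤ Y := by
  have hx0 : x ≠ 0 := fun h => h0 (h ▸ hx)
  have hc : ContinuousAt (fun y : ℂ => |Real.log ‖y‖|) x :=
    (ContinuousAt.log continuous_norm.continuousAt (norm_ne_zero_iff.mpr hx0)).abs
  have h1 := (hc.eventually_lt_const (lt_add_one (|Real.log ‖x‖|))).and (hD.mem_nhds hx)
  obtain ⟨U, hU, hUo, hxU⟩ := mem_nhds_iff.mp h1
  exact ⟨U, fun y hy => (hU hy).2, hUo, hxU, _, fun y hy => (hU hy).1.le⟩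

lemma differentiableOn_qLaplace (h : IsLaplaceFamily q l E T W κ M P c) (n : ℕ) :
    DifferentiableOn ℂ (fun p : ℂ × ℂ => qLaplace q l (W n p.1) (p.1 * p.2)) (E ×ˢ T) := by
  rintro ⟨ε, t⟩ ⟨hε, ht⟩
  obtain ⟨U₁, hU₁, hU₁o, hεU, Y₁, hY₁⟩ := exists_nhds_log_bound h.isOpen_E hε h.zero_notMem_E
  obtain ⟨U₂, hU₂, hU₂o, htU, Y₂, hY₂⟩ := exists_nhds_log_bound h.isOpen_T ht h.zero_notMem_T
  obtain ⟨g, hg, -, hb⟩ := h.exists_gaussian_majorant (max Y₁ Y₂)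
  refine (DifferentiableAt.const_mul (differentiableAt_integral_of_bound (hU₁o.prod hU₂o)
    ⟨hεU, htU⟩ (g := fun s => n.factorial * κ n * g s) (fun s => ?_) ?_ (hg.const_mul _) ?_)
    _).differentiableWithinAt
  · have e : (fun p : ℂ × ℂ => qLaplaceIntegrand q l (W n p.1) (p.1 * p.2) s) =
        fun p => Complex.log q * (W n p.1 (qpow q s * l) *
          (theta q (qpow q s * l / (p.1 * p.2)))⁻¹) :=
      funext fun p => by rw [qLaplaceIntegrand_eq h.ne_zero, div_eq_mul_inv]
    rw [e]
    refine (differentiableOn_const _).mul (DifferentiableOn.mul ?_ (DifferentiableOn.inv ?_ ?_))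
    · exact ((h.differentiableOn n s).mono hU₁).comp differentiableOn_fst fun p hp => hp.1
    · intro p hp
      have hp1 : p.1 ≠ 0 := fun h0 => h.zero_notMem_E (h0 ▸ hU₁ hp.1)
      have hp2 : p.2 ≠ 0 := fun h0 => h.zero_notMem_T (h0 ▸ hU₂ hp.2)
      have d1 : DifferentiableAt ℂ (theta q) (qpow q s * l / (p.1 * p.2)) :=
        differentiableAt_theta h.one_lt (div_ne_zero
          (mul_ne_zero (qpow_ne_zero q s) h.ne_zero) (mul_ne_zero hp1 hp2))
      have d2 : DifferentiableAt ℂ (fun p : ℂ × ℂ => qpow q s * l / (p.1 * p.2)) p := by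
        simp only [div_eq_mul_inv]
        exact ((differentiableAt_fst.mul differentiableAt_snd).inv
          (mul_ne_zero hp1 hp2)).const_mul _
      exact (DifferentiableAt.comp (g := theta q) p d1 d2).differentiableWithinAt
    · rintro p hp h0
      have := h.theta_ge p.1 (hU₁ hp.1) p.2 (hU₂ hp.2) s
      rw [h0, norm_zero] at this
      have hc := h.c_pos
      exact absurd this (not_le.mpr (by positivity))
  · exact fun p hp => (h.continuous_integrand (hU₁ hp.1) (hU₂ hp.2) n).aestronglyMeasurable
  · exact fun p hp s => hb p.1 (hU₁ hp.1) p.2 (hU₂ hp.2)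
      ((hY₁ _ hp.1).trans (le_max_left _ _)) ((hY₂ _ hp.2).trans (le_max_right _ _)) n s

lemma differentiableOn_tsum (h : IsLaplaceFamily q l E T W κ M P c) :
    DifferentiableOn ℂ (fun p : ℂ × ℂ × ℂ => ∑' n, qLaplace q l (W n p.1) (p.1 * p.2.1) *
      (p.2.2 ^ n / (n.factorial : ℂ))) (E ×ˢ T ×ˢ univ) := by
  rintro ⟨ε, t, z⟩ ⟨hε, ht, -⟩
  obtain ⟨U₁, hU₁, hU₁o, hεU, Y₁, hY₁⟩ := exists_nhds_log_bound h.isOpen_E hε h.zero_notMem_E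
  obtain ⟨U₂, hU₂, hU₂o, htU, Y₂, hY₂⟩ := exists_nhds_log_bound h.isOpen_T ht h.zero_notMem_T
  obtain ⟨Γ, hΓ, hb⟩ := h.exists_norm_qLaplace_le (max Y₁ Y₂)
  refine (differentiableAt_tsum_of_bound (U := U₁ ×ˢ U₂ ×ˢ Metric.ball 0 (‖z‖ + 1))
    (u := fun n => κ n * (‖z‖ + 1) ^ n * Γ) (hU₁o.prod (hU₂o.prod Metric.isOpen_ball))
    ⟨hεU, htU, by simp⟩ (fun n => ?_) ((h.summable_kappa _).mul_right _)
    fun n p hp => ?_).differentiableWithinAt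
  · refine DifferentiableOn.mul ?_ ?_
    · refine (h.differentiableOn_qLaplace n).comp
        (g := fun p : ℂ × ℂ => qLaplace q l (W n p.1) (p.1 * p.2))
        (f := fun p : ℂ × ℂ × ℂ => (p.1, p.2.1)) ?_ fun p hp => ⟨hU₁ hp.1, hU₂ hp.2.1⟩
      exact (differentiable_fst.prodMk (differentiable_fst.comp
        differentiable_snd)).differentiableOn
    · simp only [div_eq_mul_inv]
      exact (((differentiable_snd.comp differentiable_snd).pow n).mul_const _).differentiableOn
  · have h1 := hb p.1 (hU₁ hp.1) p.2.1 (hU₂ hp.2.1)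
      ((hY₁ _ hp.1).trans (le_max_left _ _)) ((hY₂ _ hp.2.1).trans (le_max_right _ _)) n
    have h2 : ‖p.2.2‖ ≤ ‖z‖ + 1 := (mem_ball_zero_iff.mp hp.2.2).le
    have hκ := h.kappa_nonneg n
    rw [norm_mul, norm_div, norm_pow, Complex.norm_natCast]
    calc _ ≤ n.factorial * κ n * Γ * ((‖z‖ + 1) ^ n / n.factorial) := by gcongr
      _ = _ := by field_simp

end IsLaplaceFamily

end laplaceFamily

/-! ### The sum of transforms solves the q-difference-differential equation. -/

section equation

namespace IsLaplaceFamily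

variable {q l : ℂ} {E T : Set ℂ} {κ : ℕ → ℝ} {M P c : ℝ} {ε t : ℂ} {S : ℕ} {Is : ℕ → Finset ℕ}
  {b : ℕ → ℕ → ℂ → ℂ} {m₀ m₁ : ℕ → ℕ} {w : ℕ → ℂ → ℂ → ℂ}

lemma pow_mul_mem {W : ℕ → ℂ → ℂ → ℂ} (h : IsLaplaceFamily q l E T W κ M P c) (ht : t ∈ T)
    (m : ℕ) : q ^ m * t ∈ T := by
  induction m with
  | zero => simpa using ht
  | succ m ih =>
    rw [pow_succ', mul_assoc]
    exact h.mul_mem _ ih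

lemma integrable_pow_mul {W : ℕ → ℂ → ℂ → ℂ} (h : IsLaplaceFamily q l E T W κ M P c)
    (hε : ε ∈ E) (ht : t ∈ T) (n m : ℕ) :
    Integrable (qLaplaceIntegrand q l (fun τ => τ ^ m * W n ε τ) (ε * t)) := by
  have hε0 : ε ≠ 0 := fun h0 => h.zero_notMem_E (h0 ▸ hε)
  have ht0 : t ≠ 0 := fun h0 => h.zero_notMem_T (h0 ▸ ht)
  obtain ⟨d, hd⟩ := qLaplaceIntegrand_pow_mul (ne_zero_of_one_lt_norm h.one_lt) h.ne_zero
    (W n ε) m (ε * t) (mul_ne_zero hε0 ht0)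
  rw [funext hd, show q ^ m * (ε * t) = ε * (q ^ m * t) by ring]
  exact (h.integrable hε (h.pow_mul_mem ht m) n).const_mul d

/-- The left side is the transform of (τ + 1) W_{j+S}, and the factor τ + 1 cancels the denominator
of the recursion, the spiral avoiding τ = -1. This is the equation read on the coefficient of z^j.
-/
lemma qLaplace_auxCoeff_recurrence
    (h : IsLaplaceFamily q l E T (fun n ε τ => auxCoeff q S Is b m₀ m₁ w ε τ n) κ M P c)
    (hpole : ∀ s : ℝ, qpow q s * l ≠ -1) (hε : ε ∈ E) (ht : t ∈ T) (j : ℕ) :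
    ε * t * qLaplace q l (fun τ => auxCoeff q S Is b m₀ m₁ w ε τ (j + S)) (ε * (q * t)) +
      qLaplace q l (fun τ => auxCoeff q S Is b m₀ m₁ w ε τ (j + S)) (ε * t) =
    ∑ k ∈ Finset.range S, ∑ s ∈ Is k, if s ≤ j then
      b k s ε * (j.factorial / (j - s).factorial) * (((q ^ m₁ k)⁻¹) ^ (j - s) *
        (tSigma q)^[m₀ k] (fun t' =>
          qLaplace q l (fun τ => auxCoeff q S Is b m₀ m₁ w ε τ (j - s + k)) (ε * t')) t) else 0 := by
  have hq0 := ne_zero_of_one_lt_norm h.one_lt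
  have hε0 : ε ≠ 0 := fun h0 => h.zero_notMem_E (h0 ▸ hε)
  have ht0 : t ≠ 0 := fun h0 => h.zero_notMem_T (h0 ▸ ht)
  have hz0 : ε * t ≠ 0 := mul_ne_zero hε0 ht0
  rw [show ε * (q * t) = q * (ε * t) by ring, ← qLaplace_mul hq0 h.ne_zero _ hz0]
  simp_rw [tSigma_iterate_qLaplace hq0 h.ne_zero _ hε0 _ t ht0]
  have i1 : Integrable (qLaplaceIntegrand q l
      (fun τ => τ * auxCoeff q S Is b m₀ m₁ w ε τ (j + S)) (ε * t)) := by
    simpa using h.integrable_pow_mul hε ht (j + S) 1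
  have i2 := h.integrable hε ht (j + S)
  simp only [qLaplace]
  rw [← mul_add, ← integral_add i1 i2]
  have hpt : ∀ s, qLaplaceIntegrand q l
        (fun τ => τ * auxCoeff q S Is b m₀ m₁ w ε τ (j + S)) (ε * t) s +
      qLaplaceIntegrand q l (fun τ => auxCoeff q S Is b m₀ m₁ w ε τ (j + S)) (ε * t) s =
      ∑ k ∈ Finset.range S, ∑ s' ∈ Is k, (if s' ≤ j then
        b k s' ε * (j.factorial / (j - s').factorial) * (((q ^ m₁ k)⁻¹) ^ (j - s') *
          (ε ^ m₀ k)⁻¹) else 0) * qLaplaceIntegrand q l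
            (fun τ => τ ^ m₀ k * auxCoeff q S Is b m₀ m₁ w ε τ (j - s' + k)) (ε * t) s := by
    intro s
    simp_rw [qLaplaceIntegrand_eq h.ne_zero]
    have hτ := hpole s
    generalize qpow q s * l = τ at hτ
    have hτ1 : τ + 1 ≠ 0 := fun h0 => hτ (by linear_combination h0)
    generalize theta q (τ / (ε * t)) = θ
    rw [show Complex.log q * (τ * auxCoeff q S Is b m₀ m₁ w ε τ (j + S) / θ) +
      Complex.log q * (auxCoeff q S Is b m₀ m₁ w ε τ (j + S) / θ) =
      Complex.log q / θ * ((τ + 1) * auxCoeff q S Is b m₀ m₁ w ε τ (j + S)) by ring,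
      auxCoeff_add, Finset.mul_sum, Finset.mul_sum, Finset.mul_sum]
    refine Finset.sum_congr rfl fun k _ => ?_
    rw [Finset.mul_sum, Finset.mul_sum, Finset.mul_sum]
    refine Finset.sum_congr rfl fun s' _ => ?_
    split_ifs with hs
    · have h1 : ((j - s').factorial : ℂ) ≠ 0 := by exact_mod_cast (j - s').factorial_ne_zero
      have h2 : ε ^ m₀ k ≠ 0 := pow_ne_zero _ hε0
      generalize ((q ^ m₁ k)⁻¹) ^ (j - s') = Q
      generalize ε ^ m₀ k = e at h2
      generalize ((j - s').factorial : ℂ) = f at h1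
      rcases eq_or_ne θ 0 with h0 | h0
      · simp [h0]
      · field_simp
    · simp
  simp_rw [hpt]
  have hint : ∀ k s', Integrable fun s => (if s' ≤ j then
        b k s' ε * (j.factorial / (j - s').factorial) * (((q ^ m₁ k)⁻¹) ^ (j - s') *
          (ε ^ m₀ k)⁻¹) else 0) * qLaplaceIntegrand q l
            (fun τ => τ ^ m₀ k * auxCoeff q S Is b m₀ m₁ w ε τ (j - s' + k)) (ε * t) s :=
    fun k s' => (h.integrable_pow_mul hε ht (j - s' + k) (m₀ k)).const_mul _
  rw [integral_finsetSum _ fun k _ => integrable_finsetSum _ fun s' _ => hint k s',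
    Finset.mul_sum]
  refine Finset.sum_congr rfl fun k _ => ?_
  rw [integral_finsetSum _ fun s' _ => hint k s', Finset.mul_sum]
  refine Finset.sum_congr rfl fun s' _ => ?_
  rw [integral_const_mul]
  split_ifs with hs
  · ring
  · simp

lemma solvesEquation
    (h : IsLaplaceFamily q l E T (fun n ε τ => auxCoeff q S Is b m₀ m₁ w ε τ n) κ M P c)
    (hpole : ∀ s : ℝ, qpow q s * l ≠ -1) :
    SolvesEquation q S Is b m₀ m₁ E T fun ε t z =>
      ∑' n, qLaplace q l (fun τ => auxCoeff q S Is b m₀ m₁ w ε τ n) (ε * t) *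
        (z ^ n / (n.factorial : ℂ)) := by
  intro ε hε t ht z
  have hent : ∀ t ∈ T, IsEntireSeq fun n =>
    qLaplace q l (fun τ => auxCoeff q S Is b m₀ m₁ w ε τ n) (ε * t) := fun t ht =>
    h.isEntireSeq hε ht
  have hrec := h.qLaplace_auxCoeff_recurrence hpole hε ht
  generalize hC : (fun (n : ℕ) (t : ℂ) =>
    qLaplace q l (fun τ => auxCoeff q S Is b m₀ m₁ w ε τ n) (ε * t)) = C
  have hC' : ∀ n t, qLaplace q l (fun τ => auxCoeff q S Is b m₀ m₁ w ε τ n) (ε * t) = C n t :=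
    fun n t => by rw [← hC]
  simp only [hC'] at hent hrec ⊢
  have e1 : ∀ t ∈ T, ∀ k z, iteratedDeriv k (fun z => ∑' n, C n t * (z ^ n / (n.factorial : ℂ))) z =
      ∑' n, C (n + k) t * (z ^ n / (n.factorial : ℂ)) := fun t ht k z => by
    rw [(hent t ht).iteratedDeriv k]
  rw [e1 t ht, e1 (q * t) (h.mul_mem t ht)]
  have hsum1 := (((hent _ (h.mul_mem t ht)).shift_add S).hasSum z).mul_left (ε * t)
  have hsum := hsum1.add (((hent t ht).shift_add S).hasSum z)
  refine hsum.unique ?_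
  have hk : ∀ k, HasSum (fun j => ∑ s ∈ Is k, if s ≤ j then b k s ε *
      ((((q ^ m₁ k)⁻¹) ^ (j - s) * (tSigma q)^[m₀ k] (C (j - s + k)) t) *
        (z ^ j / ((j - s).factorial : ℂ))) else 0)
      (bPoly Is b k ε z * (tSigma q)^[m₀ k] (fun t' => iteratedDeriv k
        (fun z => ∑' n, C n t' * (z ^ n / (n.factorial : ℂ))) (z * (q ^ m₁ k)⁻¹)) t) := by
    intro k
    obtain ⟨p, hp⟩ := exists_tSigma_iterate q (m₀ k) t
    have h1 : HasSum (fun n => (((q ^ m₁ k)⁻¹) ^ n * (tSigma q)^[m₀ k] (C (n + k)) t) *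
        (z ^ n / (n.factorial : ℂ))) ((tSigma q)^[m₀ k] (fun t' => iteratedDeriv k
        (fun z => ∑' n, C n t' * (z ^ n / (n.factorial : ℂ))) (z * (q ^ m₁ k)⁻¹)) t) := by
      rw [hp, e1 _ (h.pow_mul_mem ht _)]
      have h2 := (((hent _ (h.pow_mul_mem ht (m₀ k))).shift_add k).hasSum
        (z * (q ^ m₁ k)⁻¹)).mul_left p
      refine h2.congr_fun fun n => ?_
      rw [hp, mul_pow]
      ring
    rw [bPoly, Finset.sum_mul]
    refine hasSum_sum fun s _ => ?_
    have h3 := (hasSum_pow_mul_shift s h1).mul_left (b k s ε)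
    rw [← mul_assoc] at h3
    refine h3.congr_fun fun j => ?_
    split_ifs <;> simp
  have hfin := hasSum_sum (s := Finset.range S) fun k _ => hk k
  refine hfin.congr_fun fun j => ?_
  rw [← mul_assoc, ← add_mul, hrec j, Finset.sum_mul]
  refine Finset.sum_congr rfl fun k _ => ?_
  rw [Finset.sum_mul]
  refine Finset.sum_congr rfl fun s _ => ?_
  split_ifs with hs
  · have h1 : ((j - s).factorial : ℂ) ≠ 0 := by exact_mod_cast (j - s).factorial_ne_zero
    have h2 : (j.factorial : ℂ) ≠ 0 := by exact_mod_cast j.factorial_ne_zero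
    generalize ((q ^ m₁ k)⁻¹) ^ (j - s) = Q
    generalize (tSigma q)^[m₀ k] (C (j - s + k)) t = R
    field_simp
  · simp

end IsLaplaceFamily

end equation

/-! ### Deformation of one spiral path into another. -/

section contour

/-- In the coordinates ξ = u exp(s log q + iφ), holomorphy of G says that ∂_s and ∂_φ are
proportional to log q and i. -/
lemma hasFDerivAt_comp_spiral {q u : ℂ} {G : ℂ → ℂ} {p : ℝ × ℝ}
    (hG : DifferentiableAt ℂ G (qpow q p.1 * (u * Complex.exp (p.2 * Complex.I)))) :
    ∃ D : ℝ × ℝ →L[ℝ] ℂ,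
      HasFDerivAt (fun p : ℝ × ℝ => G (qpow q p.1 * (u * Complex.exp (p.2 * Complex.I)))) D p ∧
      D (0, 1) * Complex.log q = D (1, 0) * Complex.I := by
  set A : ℝ × ℝ →L[ℝ] ℂ := (ContinuousLinearMap.fst ℝ ℝ ℝ).smulRight (Complex.log q) +
    (ContinuousLinearMap.snd ℝ ℝ ℝ).smulRight Complex.I with hA
  have e : ∀ p : ℝ × ℝ, qpow q p.1 * (u * Complex.exp (p.2 * Complex.I)) =
      Complex.exp (A p) * u := by
    intro p
    simp only [hA, qpow, add_apply, ContinuousLinearMap.smulRight_apply,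
      ContinuousLinearMap.coe_fst', ContinuousLinearMap.coe_snd', Complex.real_smul,
      Complex.exp_add]
    ring
  simp_rw [e] at hG ⊢
  have h1 : HasFDerivAt (fun p => Complex.exp (A p) * u) _ p := (A.hasFDerivAt.cexp).mul_const u
  have h2 := (hG.hasFDerivAt.restrictScalars ℝ).comp p h1
  refine ⟨_, h2, ?_⟩
  have key : ∀ v : ℝ × ℝ, ((fderiv ℂ G (Complex.exp (A p) * u)).restrictScalars ℝ).comp
      (u • (Complex.exp (A p) • A)) v =
      A v * ((fderiv ℂ G (Complex.exp (A p) * u)) (u * Complex.exp (A p))) := by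
    intro v
    simp only [ContinuousLinearMap.comp_apply, ContinuousLinearMap.coe_restrictScalars',
      smul_apply, smul_eq_mul]
    rw [← smul_eq_mul (A v), ← map_smul, smul_eq_mul]
    congr 1
    ring
  have k1 := key (1, 0)
  have k2 := key (0, 1)
  have a1 : A (1, 0) = Complex.log q := by simp [hA]
  have a2 : A (0, 1) = Complex.I := by simp [hA]
  rw [a1] at k1
  rw [a2] at k2
  erw [k1, k2]
  ring

/-- Cauchy's theorem on the region between two spirals, truncated at s = a: the difference equals
the two arcs at a and σ, and the arc at a disappears as a → -∞. -/
lemma norm_integral_spiral_sub_le {q u : ℂ} {G : ℂ → ℂ} {σ φ₁ φ₂ : ℝ} {B : ℝ → ℝ}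
    (hG : ∀ s ≤ σ, ∀ φ ∈ uIcc φ₁ φ₂,
      DifferentiableAt ℂ G (qpow q s * (u * Complex.exp (φ * Complex.I))))
    (hB : ∀ s ≤ σ, ∀ φ ∈ uIcc φ₁ φ₂, ‖G (qpow q s * (u * Complex.exp (φ * Complex.I)))‖ ≤ B s)
    (hB0 : Tendsto B atBot (𝓝 0))
    (h1 : IntegrableOn (fun s : ℝ => G (qpow q s * (u * Complex.exp (φ₁ * Complex.I)))) (Iic σ))
    (h2 : IntegrableOn (fun s : ℝ => G (qpow q s * (u * Complex.exp (φ₂ * Complex.I)))) (Iic σ)) :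
    ‖Complex.log q * (∫ s in Iic σ, G (qpow q s * (u * Complex.exp (φ₁ * Complex.I)))) -
      Complex.log q * ∫ s in Iic σ, G (qpow q s * (u * Complex.exp (φ₂ * Complex.I)))‖ ≤
      B σ * |φ₂ - φ₁| := by
  set H : ℝ × ℝ → ℂ := fun p => G (qpow q p.1 * (u * Complex.exp (p.2 * Complex.I))) with hH
  have hfin : ∀ a ≤ σ, ‖Complex.log q * (∫ s in a..σ, H (s, φ₁)) -
      Complex.log q * ∫ s in a..σ, H (s, φ₂)‖ ≤ (B σ + B a) * |φ₂ - φ₁| := by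
    intro a ha
    have hmem : ∀ p ∈ uIcc a σ ×ˢ uIcc φ₁ φ₂, p.1 ≤ σ ∧ p.2 ∈ uIcc φ₁ φ₂ := by
      rintro p ⟨hp1, hp2⟩
      rw [uIcc_of_le ha] at hp1
      exact ⟨hp1.2, hp2⟩
    have hD : ∀ p ∈ uIcc a σ ×ˢ uIcc φ₁ φ₂, ∃ D : ℝ × ℝ →L[ℝ] ℂ, HasFDerivAt H D p ∧
        D (0, 1) * Complex.log q = D (1, 0) * Complex.I := fun p hp =>
      hasFDerivAt_comp_spiral (hG p.1 (hmem p hp).1 p.2 (hmem p hp).2)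
    choose! D hD1 hD2 using hD
    have hsub : Ioo (min a σ) (max a σ) ×ˢ Ioo (min φ₁ φ₂) (max φ₁ φ₂) ⊆
        uIcc a σ ×ˢ uIcc φ₁ φ₂ := prod_mono Ioo_subset_Icc_self Ioo_subset_Icc_self
    have hc : ContinuousOn H (uIcc a σ ×ˢ uIcc φ₁ φ₂) := fun p hp =>
      (hD1 p hp).continuousAt.continuousWithinAt
    have hz : ∀ p ∈ uIcc a σ ×ˢ uIcc φ₁ φ₂,
        (Complex.I • D p) (1, 0) + ((-Complex.log q) • D p) (0, 1) = 0 := by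
      intro p hp
      have := hD2 p hp
      simp only [smul_apply, smul_eq_mul]
      linear_combination -this
    -- The field (i H, -log q · H) has zero divergence by the Cauchy–Riemann relation above.
    have hdiv := integral2_divergence_prod_of_hasFDerivAt
      (fun p => Complex.I * H p) (fun p => -Complex.log q * H p)
      (fun p => Complex.I • D p) (fun p => (-Complex.log q) • D p) a φ₁ σ φ₂
      (continuousOn_const.mul hc) (continuousOn_const.mul hc)
      (fun p hp => (hD1 p (hsub hp)).const_mul _) (fun p hp => (hD1 p (hsub hp)).const_mul _)
      ((integrableOn_zero).congr_fun (fun p hp => (hz p hp).symm)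
        (measurableSet_uIcc.prod measurableSet_uIcc))
    have hzero : (∫ x in a..σ, ∫ y in φ₁..φ₂, (Complex.I • D (x, y)) (1, 0) +
        ((-Complex.log q) • D (x, y)) (0, 1)) = 0 := by
      rw [intervalIntegral.integral_congr (g := fun _ => (0 : ℂ)) (fun x hx => ?_)]
      · simp
      · simp only
        rw [intervalIntegral.integral_congr (g := fun _ => (0 : ℂ)) (fun y hy => ?_)]
        · simp
        · exact hz (x, y) ⟨hx, hy⟩
    rw [hzero] at hdiv
    simp only [intervalIntegral.integral_const_mul] at hdiv
    have e : Complex.log q * (∫ s in a..σ, H (s, φ₁)) - Complex.log q * ∫ s in a..σ, H (s, φ₂) =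
        Complex.I * (∫ y in φ₁..φ₂, H (a, y)) - Complex.I * ∫ y in φ₁..φ₂, H (σ, y) := by
      linear_combination -hdiv
    have hs : ∀ s ≤ σ, ‖∫ y in φ₁..φ₂, H (s, y)‖ ≤ B s * |φ₂ - φ₁| := fun s hs =>
      intervalIntegral.norm_integral_le_of_norm_le_const fun y hy =>
        hB s hs y (uIoc_subset_uIcc hy)
    rw [e]
    refine (norm_sub_le _ _).trans ?_
    rw [norm_mul, norm_mul, Complex.norm_I, one_mul, one_mul]
    linarith [hs a ha, hs σ le_rfl]
  have t1 := intervalIntegral_tendsto_integral_Iic σ h1 tendsto_id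
  have t2 := intervalIntegral_tendsto_integral_Iic σ h2 tendsto_id
  have t3 := ((t1.const_mul (Complex.log q)).sub (t2.const_mul (Complex.log q))).norm
  have t4 : Tendsto (fun a => (B σ + B a) * |φ₂ - φ₁|) atBot (𝓝 ((B σ + 0) * |φ₂ - φ₁|)) :=
    (tendsto_const_nhds.add hB0).mul_const _
  rw [add_zero] at t4
  exact le_of_tendsto_of_tendsto t3 t4 ((eventually_le_atBot σ).mono hfin)

lemma exists_angle {u v : ℂ} (hu : ‖u‖ = 1) (hv : ‖v‖ = 1) (huv : u ≠ v) :
    ∃ φ ∈ Ioo 0 (2 * Real.pi), u = v * Complex.exp (φ * Complex.I) := by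
  have hv0 : v ≠ 0 := by rintro rfl; simp at hv
  have hw : ‖u / v‖ = 1 := by rw [norm_div, hu, hv, div_one]
  have h1 := Complex.norm_mul_exp_arg_mul_I (u / v)
  rw [hw, Complex.ofReal_one, one_mul] at h1
  have h2 : u = v * Complex.exp ((u / v).arg * Complex.I) := by rw [h1]; field_simp
  have h3 := Complex.neg_pi_lt_arg (u / v)
  have h4 := Complex.arg_le_pi (u / v)
  have hpi := Real.pi_pos
  rcases lt_trichotomy (u / v).arg 0 with h | h | h
  · refine ⟨(u / v).arg + 2 * Real.pi, ⟨by linarith, by linarith⟩, ?_⟩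
    conv_lhs => rw [h2]
    push_cast
    rw [add_mul, Complex.exp_add, Complex.exp_two_pi_mul_I, mul_one]
  · rw [h] at h2
    simp at h2
    exact absurd h2 huv
  · exact ⟨_, ⟨h, by linarith⟩, h2⟩

lemma norm_one_sub_exp_mul_I {φ : ℝ} (h0 : 0 ≤ φ) (h1 : φ ≤ 2 * Real.pi) :
    ‖1 - Complex.exp (φ * Complex.I)‖ = 2 * Real.sin (φ / 2) := by
  rw [norm_sub_rev, mul_comm, Complex.norm_exp_I_mul_ofReal_sub_one, Real.norm_of_nonneg]
  have := Real.sin_nonneg_of_nonneg_of_le_pi (x := φ / 2) (by linarith) (by linarith)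
  linarith

/-- |1 - e^{iφ}| = 2 sin(φ/2) is concave on [0, 2π], so on an interval it is smallest at an
endpoint. The whole arc between two admissible directions therefore stays admissible. -/
lemma le_norm_one_sub_exp_of_mem_uIcc {δ φ₁ φ₂ φ : ℝ} (h₁ : φ₁ ∈ Ioo 0 (2 * Real.pi))
    (h₂ : φ₂ ∈ Ioo 0 (2 * Real.pi)) (d₁ : δ ≤ ‖1 - Complex.exp (φ₁ * Complex.I)‖)
    (d₂ : δ ≤ ‖1 - Complex.exp (φ₂ * Complex.I)‖) (hφ : φ ∈ uIcc φ₁ φ₂) :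
    δ ≤ ‖1 - Complex.exp (φ * Complex.I)‖ := by
  wlog h : φ₁ ≤ φ₂ generalizing φ₁ φ₂
  · exact this h₂ h₁ d₂ d₁ (by rwa [uIcc_comm]) (by linarith)
  rw [uIcc_of_le h] at hφ
  rw [norm_one_sub_exp_mul_I h₁.1.le h₁.2.le] at d₁
  rw [norm_one_sub_exp_mul_I h₂.1.le h₂.2.le] at d₂
  rw [norm_one_sub_exp_mul_I (h₁.1.le.trans hφ.1) (hφ.2.trans h₂.2.le)]
  have := strictConcaveOn_sin_Icc.concaveOn.min_le_of_mem_Icc (x := φ₁ / 2) (y := φ₂ / 2)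
    (z := φ / 2) ⟨by linarith [h₁.1], by linarith [h₁.2]⟩ ⟨by linarith [h₂.1], by linarith [h₂.2]⟩
    ⟨by linarith [hφ.1], by linarith [hφ.2]⟩
  rcases min_le_iff.mp this with h | h <;> linarith

end contour

/-! ### Bounds uniform in ε and t. -/

section uniformBounds

variable {q l : ℂ}

lemma qLaplaceIntegrand_qpow_mul (q l : ℂ) (a : ℝ) (F : ℂ → ℂ) (z : ℂ) (s : ℝ) :
    qLaplaceIntegrand q (qpow q a * l) F z s = qLaplaceIntegrand q l F z (s + a) := by
  simp only [qLaplaceIntegrand, qpow_add, mul_assoc]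

/-- Moving l along its own spiral translates s, so l can be normalised to modulus 1. -/
lemma qLaplace_qpow_mul (q l : ℂ) (a : ℝ) (F : ℂ → ℂ) (z : ℂ) :
    qLaplace q (qpow q a * l) F z = qLaplace q l F z := by
  simp only [qLaplace, qLaplaceIntegrand_qpow_mul]
  rw [integral_add_right_eq_self (fun s => qLaplaceIntegrand q l F z s) a]

lemma integrable_gaussian_affine {a L : ℝ} (ha : 0 < a) (hL : 0 < L) (e : ℝ) :
    Integrable fun s : ℝ => Real.exp (-(a * (s * L + e) ^ 2)) := by
  have h := (integrable_exp_neg_mul_sq (b := a * L ^ 2) (by positivity)).comp_add_right (e / L)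
  refine h.congr (Eventually.of_forall fun s => ?_)
  simp only
  congr 1
  field_simp

lemma integral_gaussian_affine {a L : ℝ} (hL : 0 < L) (e : ℝ) :
    ∫ s : ℝ, Real.exp (-(a * (s * L + e) ^ 2)) = ∫ s : ℝ, Real.exp (-(a * (s * L) ^ 2)) := by
  rw [← integral_add_right_eq_self (fun s : ℝ => Real.exp (-(a * (s * L) ^ 2))) (e / L)]
  refine integral_congr_ae (Eventually.of_forall fun s => ?_)
  simp only
  congr 1
  field_simp

/-- With y = log|t| ≤ 0, the growth for x > 0 is beaten because (x - y)² ≥ x², and for x ≤ 0 there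
is no growth. Both Gaussians have integrals independent of their centres, whence uniformity in ε and
t. -/
lemma exp_max_sq_sub_le {M P x y : ℝ} (hM : 0 ≤ M) (hMP : M < P) (hy : y ≤ 0) :
    Real.exp (M * max x 0 ^ 2 - P * (x - y) ^ 2) ≤
      Real.exp (-((P - M) * x ^ 2)) + Real.exp (-(P * (x - y) ^ 2)) := by
  rcases le_or_gt x 0 with hx | hx
  · have e : M * max x 0 ^ 2 - P * (x - y) ^ 2 = -(P * (x - y) ^ 2) := by
      rw [max_eq_right hx]; ring
    rw [e]
    linarith [Real.exp_pos (-((P - M) * x ^ 2))]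
  · have h2 : x ^ 2 ≤ (x - y) ^ 2 := by nlinarith
    have h3 : P * x ^ 2 ≤ P * (x - y) ^ 2 := mul_le_mul_of_nonneg_left h2 (by linarith)
    have : Real.exp (M * max x 0 ^ 2 - P * (x - y) ^ 2) ≤ Real.exp (-((P - M) * x ^ 2)) := by
      rw [Real.exp_le_exp, max_eq_left hx.le]
      linarith
    linarith [Real.exp_pos (-(P * (x - y) ^ 2))]

/-- Lowering the rate from a to A makes the shift of ℓ by k cost only a constant. -/
lemma flat_exponent_le {a A k ℓ : ℝ} (ha : 0 ≤ a) (h : A < a) :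
    -(a * (ℓ - k) ^ 2) ≤ -(A * ℓ ^ 2) + a ^ 2 * k ^ 2 / (a - A) := by
  have hd : 0 < a - A := by linarith
  have h1 : 0 ≤ (a - A) * (ℓ - a * k / (a - A)) ^ 2 := by positivity
  have e : (a - A) * (ℓ - a * k / (a - A)) ^ 2 =
      a * (ℓ - k) ^ 2 - A * ℓ ^ 2 + a ^ 2 * k ^ 2 / (a - A) - a * k ^ 2 := by
    field_simp; ring
  rw [e] at h1
  have : 0 ≤ a * k ^ 2 := by positivity
  linarith

namespace IsLaplaceFamily

variable {E T : Set ℂ} {W : ℕ → ℂ → ℂ → ℂ} {κ : ℕ → ℝ} {M P c : ℝ} {ε t : ℂ}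

lemma of_qpow_mul {a : ℝ} (h : IsLaplaceFamily q (qpow q a * l) E T W κ M P c) :
    IsLaplaceFamily q l E T W κ M P c := by
  have e : ∀ s : ℝ, qpow q s * l = qpow q (s - a) * (qpow q a * l) := by
    intro s
    rw [← mul_assoc, ← qpow_add, sub_add_cancel]
  exact
  { one_lt := h.one_lt
    ne_zero := right_ne_zero_of_mul h.ne_zero
    isOpen_E := h.isOpen_E
    zero_notMem_E := h.zero_notMem_E
    isOpen_T := h.isOpen_T
    zero_notMem_T := h.zero_notMem_T
    mul_mem := h.mul_mem
    M_nonneg := h.M_nonneg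
    M_lt := h.M_lt
    c_pos := h.c_pos
    kappa_nonneg := h.kappa_nonneg
    summable_kappa := h.summable_kappa
    norm_le := fun ε hε s n => by rw [e]; exact h.norm_le ε hε _ n
    theta_ge := fun ε hε t ht s => by rw [e]; exact h.theta_ge ε hε t ht _
    differentiableOn := fun n s => by rw [e s]; exact h.differentiableOn n _
    continuous := fun n ε hε => by
      refine ((h.continuous n ε hε).comp (continuous_id.sub (continuous_const (y := a)))).congr
        fun s => ?_
      rw [e s]
      rfl }

/-- A bound of the `q`-Laplace transforms which is uniform in `ε ∈ E` and `‖t‖ ≤ 1`. -/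
lemma exists_norm_qLaplace_le_of_norm_le_one (h : IsLaplaceFamily q l E T W κ M P c) :
    ∃ Γ : ℝ, 0 ≤ Γ ∧ ∀ ε ∈ E, ∀ t ∈ T, ‖t‖ ≤ 1 → ∀ n,
      ‖qLaplace q l (W n ε) (ε * t)‖ ≤ n.factorial * κ n * Γ := by
  have hL : 0 < Real.log ‖q‖ := Real.log_pos h.one_lt
  have hd : 0 < P - M := by linarith [h.M_lt]
  have hP : 0 < P := by linarith [h.M_nonneg]
  have hc := h.c_pos
  set L := Real.log ‖q‖
  refine ⟨‖(piq q)⁻¹‖ * (‖Complex.log q‖ / c * ((∫ s : ℝ, Real.exp (-((P - M) * (s * L) ^ 2))) +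
    ∫ s : ℝ, Real.exp (-(P * (s * L) ^ 2)))), ?_, fun ε hε t ht ht1 n => ?_⟩
  · have := integral_nonneg (μ := volume) (f := fun s : ℝ => Real.exp (-((P - M) * (s * L) ^ 2)))
      fun s => (Real.exp_pos _).le
    have := integral_nonneg (μ := volume) (f := fun s : ℝ => Real.exp (-(P * (s * L) ^ 2)))
      fun s => (Real.exp_pos _).le
    positivity
  · have hκ := h.kappa_nonneg n
    have hy : Real.log ‖t‖ ≤ 0 := Real.log_nonpos (norm_nonneg _) ht1
    set e := Real.log ‖l‖ - Real.log ‖ε‖ with he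
    have hb : ∀ s, ‖qLaplaceIntegrand q l (W n ε) (ε * t) s‖ ≤ n.factorial * κ n *
        (‖Complex.log q‖ / c * (Real.exp (-((P - M) * (s * L + e) ^ 2)) +
          Real.exp (-(P * (s * L + (e - Real.log ‖t‖)) ^ 2)))) := by
      intro s
      refine (h.norm_integrand_le hε ht n s).trans ?_
      gcongr
      rw [show s * L + (e - Real.log ‖t‖) = s * L + e - Real.log ‖t‖ by ring]
      exact exp_max_sq_sub_le h.M_nonneg h.M_lt hy
    have i1 := integrable_gaussian_affine hd hL e
    have i2 := integrable_gaussian_affine hP hL (e - Real.log ‖t‖)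
    have h1 := norm_integral_le_of_norm_le (((i1.add i2).const_mul _).const_mul _)
      (Eventually.of_forall hb)
    rw [integral_const_mul, integral_const_mul] at h1
    simp only [Pi.add_apply] at h1
    rw [integral_add i1 i2, integral_gaussian_affine hL, integral_gaussian_affine hL] at h1
    unfold qLaplace
    rw [norm_mul]
    refine (mul_le_mul_of_nonneg_left h1 (norm_nonneg _)).trans_eq ?_
    ring

/-- The part of the `q`-Laplace integral at distance from the origin is flat in `ε`. -/
lemma exists_norm_tail_le (h : IsLaplaceFamily q l E T W κ M P c) (hl : ‖l‖ = 1) {A : ℝ}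
    (hA : A < P - M) :
    ∃ Γ : ℝ, 0 ≤ Γ ∧ ∀ ε ∈ E, ∀ t ∈ T, ‖ε‖ ≤ 1 / 2 → ‖t‖ ≤ 1 → ∀ n,
      ‖∫ s in Ioi (-(Real.log 2 / Real.log ‖q‖)),
        qLaplaceIntegrand q l (W n ε) (ε * t) s‖ ≤
        n.factorial * κ n * Γ * Real.exp (-A * Real.log ‖ε‖ ^ 2) := by
  have hL : 0 < Real.log ‖q‖ := Real.log_pos h.one_lt
  have hd : 0 < P - M := by linarith [h.M_lt]
  have hc := h.c_pos
  set L := Real.log ‖q‖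
  set k := Real.log 2 with hk
  have hk0 : 0 < k := Real.log_pos (by norm_num)
  set R := (P - M) ^ 2 * k ^ 2 / (P - M - A) with hR
  refine ⟨‖Complex.log q‖ / c * Real.exp R *
    ∫ s : ℝ, Real.exp (-((P - M) * (s * L + k) ^ 2)), ?_, fun ε hε t ht hε2 ht1 n => ?_⟩
  · have := integral_nonneg (μ := volume) (f := fun s : ℝ => Real.exp (-((P - M) * (s * L + k) ^ 2)))
      fun s => (Real.exp_pos _).le
    positivity
  · have hκ := h.kappa_nonneg n
    have hε0 : ε ≠ 0 := fun h0 => h.zero_notMem_E (h0 ▸ hε)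
    have hy : Real.log ‖t‖ ≤ 0 := Real.log_nonpos (norm_nonneg _) ht1
    have hℓ : k ≤ -Real.log ‖ε‖ := by
      rw [hk, ← Real.log_inv]
      refine Real.log_le_log (by norm_num) ?_
      rw [le_inv_comm₀ (by norm_num) (norm_pos_iff.mpr hε0)]
      simpa using hε2
    set ℓ := -Real.log ‖ε‖ with hℓd
    have hb : ∀ s ∈ Ioi (-(k / L)), ‖qLaplaceIntegrand q l (W n ε) (ε * t) s‖ ≤
        (n.factorial * κ n * (‖Complex.log q‖ / c * Real.exp R) *
          Real.exp (-A * Real.log ‖ε‖ ^ 2)) * Real.exp (-((P - M) * (s * L + k) ^ 2)) := by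
      intro s hs
      refine (h.norm_integrand_le hε ht n s).trans ?_
      have hv : 0 < s * L + k := by
        have : -(k / L) < s := hs
        have h2 : -(k / L) * L < s * L := mul_lt_mul_of_pos_right this hL
        have h3 : -(k / L) * L = -k := by field_simp
        linarith
      have e : Real.log ‖l‖ - Real.log ‖ε‖ = ℓ := by rw [hl, Real.log_one, hℓd]; ring
      rw [e]
      have e2 : Real.log ‖ε‖ ^ 2 = ℓ ^ 2 := by rw [hℓd]; ring
      rw [e2]
      have hx0 : 0 ≤ s * L + ℓ := by linarith
      rw [max_eq_left hx0]
      have h1 : M * (s * L + ℓ) ^ 2 - P * (s * L + ℓ - Real.log ‖t‖) ^ 2 ≤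
          R + -A * ℓ ^ 2 + -((P - M) * (s * L + k) ^ 2) := by
        have h2 : (s * L + ℓ) ^ 2 ≤ (s * L + ℓ - Real.log ‖t‖) ^ 2 := by
          gcongr; linarith
        have h3 : P * (s * L + ℓ) ^ 2 ≤ P * (s * L + ℓ - Real.log ‖t‖) ^ 2 :=
          mul_le_mul_of_nonneg_left h2 (by linarith [h.M_nonneg])
        -- Both terms are nonnegative on this half-line, so the square splits into a Gaussian in s
        -- and a flat factor in ε.
        have h4 : (s * L + k) ^ 2 + (ℓ - k) ^ 2 ≤ (s * L + ℓ) ^ 2 := by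
          have : 0 ≤ (s * L + k) * (ℓ - k) := mul_nonneg hv.le (by linarith)
          nlinarith
        have h5 := flat_exponent_le (k := k) (ℓ := ℓ) hd.le hA
        have h6 := mul_le_mul_of_nonneg_left h4 hd.le
        rw [← hR] at h5
        linarith
      calc n.factorial * κ n * (‖Complex.log q‖ / c * Real.exp (M * (s * L + ℓ) ^ 2 -
            P * (s * L + ℓ - Real.log ‖t‖) ^ 2))
          ≤ n.factorial * κ n * (‖Complex.log q‖ / c *
            Real.exp (R + -A * ℓ ^ 2 + -((P - M) * (s * L + k) ^ 2))) := by gcongr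
        _ = _ := by rw [Real.exp_add, Real.exp_add]; ring
    have i1 := (integrable_gaussian_affine hd hL k).const_mul
      (n.factorial * κ n * (‖Complex.log q‖ / c * Real.exp R) *
          Real.exp (-A * Real.log ‖ε‖ ^ 2))
    have h1 := norm_integral_le_of_norm_le i1.integrableOn
      ((ae_restrict_iff' measurableSet_Ioi).mpr (Eventually.of_forall hb))
    refine h1.trans ((setIntegral_le_integral i1
      (Eventually.of_forall fun s => by positivity)).trans_eq ?_)
    rw [integral_const_mul]
    ring

end IsLaplaceFamily

end uniformBounds

/-! ### Flatness of the difference of two q-Laplace transforms. -/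

section flatness

variable {q l l' : ℂ}

lemma complexLog_ne_zero (hq : 1 < ‖q‖) : Complex.log q ≠ 0 := by
  intro h
  have h1 := Real.log_pos hq
  rw [← Complex.log_re, h] at h1
  simp at h1

lemma tendsto_gaussian_atBot {M P L e y : ℝ} (hM : 0 ≤ M) (hMP : M < P) (hL : 0 < L) :
    Tendsto (fun s => Real.exp (M * max (s * L + e) 0 ^ 2 - P * (s * L + e - y) ^ 2)) atBot
      (𝓝 0) := by
  have hd : 0 < P - M := by linarith
  refine squeeze_zero (fun s => (Real.exp_pos _).le) (fun s => Real.exp_le_exp.mpr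
    (gaussian_exponent_le hM hMP (le_max_left |e| |y|) (le_max_right _ _))) ?_
  refine Real.tendsto_exp_atBot.comp (tendsto_atBot_add_const_right _ _ ?_)
  refine tendsto_neg_atTop_atBot.comp (Tendsto.const_mul_atTop (by positivity) ?_)
  have : Tendsto (fun s : ℝ => |s| ^ 2) atBot atTop :=
    (tendsto_pow_atTop two_ne_zero).comp tendsto_abs_atBot_atTop
  simpa using this

lemma norm_sub_angle_of_far {v z : ℂ} {a δ : ℝ} (hv : v ≠ 0) (hz : -z = qpow q a * v)
    (hfar : ∀ r : ℝ, δ < ‖1 + l / z * qpow q r‖) : δ < ‖1 - l / v‖ := by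
  have h := hfar a
  have hz' : z = -(qpow q a * v) := by rw [← hz, neg_neg]
  have ha := qpow_ne_zero q a
  have e : 1 + l / z * qpow q a = 1 - l / v := by
    rw [hz']
    field_simp
    ring
  rwa [e] at h

namespace IsLaplaceFamily

variable {E E' T : Set ℂ} {W W' : ℕ → ℂ → ℂ → ℂ} {κ κ' : ℕ → ℝ} {M P c c' : ℝ} {ε t : ℂ}

/-- Both paths carry the same holomorphic integrand in 0 < |τ| ≤ 1/2, which stays clear of the pole
at -1. Rotating one path into the other leaves the arc |τ| = 1/2, where the integrand is already
flat in ε. -/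
lemma exists_norm_head_sub_le (h : IsLaplaceFamily q l E T W κ M P c)
    (h' : IsLaplaceFamily q l' E' T W' κ' M P c') (hl : ‖l‖ = 1) (hl' : ‖l'‖ = 1) {δ A : ℝ}
    (hδ : 0 < δ) (hP : P < 1 / (2 * Real.log ‖q‖))
    (hfar : ∀ ε ∈ E, ∀ t ∈ T, ∀ r : ℝ, δ < ‖1 + l / (ε * t) * qpow q r‖)
    (hfar' : ∀ ε ∈ E', ∀ t ∈ T, ∀ r : ℝ, δ < ‖1 + l' / (ε * t) * qpow q r‖)
    (heq : ∀ ε ∈ E ∩ E', ∀ τ, τ ≠ 0 → ‖τ‖ ≤ 1 / 2 → ∀ n, W' n ε τ = W n ε τ)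
    (hdiff : ∀ ε ∈ E, ∀ τ, τ ≠ 0 → ‖τ‖ ≤ 1 / 2 → ∀ n, DifferentiableAt ℂ (W n ε) τ)
    (hbd : ∀ ε ∈ E, ∀ τ, τ ≠ 0 → ‖τ‖ ≤ 1 / 2 → ∀ n,
      ‖W n ε τ‖ ≤ n.factorial * (κ n * Real.exp (M * max (Real.log ‖τ / ε‖) 0 ^ 2)))
    (hA : A < P - M) :
    ∃ Γ : ℝ, 0 ≤ Γ ∧ ∀ ε ∈ E ∩ E', ∀ t ∈ T, ‖ε‖ ≤ 1 / 2 → ‖t‖ ≤ 1 → ∀ n,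
      ‖(∫ s in Iic (-(Real.log 2 / Real.log ‖q‖)), qLaplaceIntegrand q l (W n ε) (ε * t) s) -
        ∫ s in Iic (-(Real.log 2 / Real.log ‖q‖)), qLaplaceIntegrand q l' (W' n ε) (ε * t) s‖ ≤
        n.factorial * κ n * Γ * Real.exp (-A * Real.log ‖ε‖ ^ 2) := by
  have hq := h.one_lt
  have hL : 0 < Real.log ‖q‖ := Real.log_pos hq
  have hd : 0 < P - M := by linarith [h.M_lt]
  obtain ⟨c₀, hc₀, hθ⟩ := exists_theta_lower_bound_polar hq hP hδ
  set L := Real.log ‖q‖ with hLd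
  set k := Real.log 2 with hk
  have hk0 : 0 < k := Real.log_pos (by norm_num)
  set σ := -(k / L) with hσ
  have hσL : σ * L = -k := by rw [hσ]; field_simp
  set R := (P - M) ^ 2 * k ^ 2 / (P - M - A) with hR
  refine ⟨1 / c₀ * Real.exp R * (2 * Real.pi), by have := Real.pi_pos; positivity,
    fun ε hε t ht hε2 ht1 n => ?_⟩
  have hκ := h.kappa_nonneg n
  have hε0 : ε ≠ 0 := fun h0 => h.zero_notMem_E (h0 ▸ hε.1)
  have ht0 : t ≠ 0 := fun h0 => h.zero_notMem_T (h0 ▸ ht)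
  have hz0 : ε * t ≠ 0 := mul_ne_zero hε0 ht0
  have hy : Real.log ‖t‖ ≤ 0 := Real.log_nonpos (norm_nonneg _) ht1
  have hℓ : k ≤ -Real.log ‖ε‖ := by
    rw [hk, ← Real.log_inv]
    refine Real.log_le_log (by norm_num) ?_
    rw [le_inv_comm₀ (by norm_num) (norm_pos_iff.mpr hε0)]
    simpa using hε2
  set ℓ := -Real.log ‖ε‖ with hℓd
  -- v is the direction of the spiral -εt q^ℝ that contains the poles of the integrand. Angles are
  -- measured from v in (0, 2π), so the arc between φ₁ and φ₂ never crosses that spiral.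
  obtain ⟨v, hv, hzv⟩ := exists_polar hq (neg_ne_zero.mpr hz0)
  set a := Real.log ‖-(ε * t)‖ / Real.log ‖q‖ with ha
  have haL : a * L = -ℓ + Real.log ‖t‖ := by
    rw [ha, ← hLd, div_mul_cancel₀ _ hL.ne', norm_neg, norm_mul,
      Real.log_mul (norm_ne_zero_iff.mpr hε0) (norm_ne_zero_iff.mpr ht0), hℓd, neg_neg]
  have hv0 : v ≠ 0 := by rintro rfl; simp at hv
  have far1 := norm_sub_angle_of_far hv0 hzv (hfar ε hε.1 t ht)
  have far2 := norm_sub_angle_of_far hv0 hzv (hfar' ε hε.2 t ht)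
  have hne : ∀ u : ℂ, δ < ‖1 - u / v‖ → u ≠ v := by
    rintro u hu rfl
    rw [div_self hv0, sub_self, norm_zero] at hu
    linarith
  obtain ⟨φ₁, hφ₁, e₁⟩ := exists_angle hl hv (hne l far1)
  obtain ⟨φ₂, hφ₂, e₂⟩ := exists_angle hl' hv (hne l' far2)
  rw [e₁, mul_div_cancel_left₀ _ hv0] at far1
  rw [e₂, mul_div_cancel_left₀ _ hv0] at far2
  set G : ℂ → ℂ := fun ξ => W n ε ξ / theta q (ξ / (ε * t)) with hG
  set B : ℝ → ℝ := fun s => n.factorial * κ n / c₀ *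
    Real.exp (M * max (s * L + ℓ) 0 ^ 2 - P * (s * L + ℓ - Real.log ‖t‖) ^ 2) with hB
  have hnorm : ∀ (s φ : ℝ), ‖qpow q s * (v * Complex.exp (φ * Complex.I))‖ = Real.exp (s * L) := by
    intro s φ
    rw [norm_mul, norm_mul, hv, Complex.norm_exp_ofReal_mul_I, norm_qpow, mul_one, mul_one]
  have hhalf : ∀ s ≤ σ, Real.exp (s * L) ≤ 1 / 2 := by
    intro s hs
    have : s * L ≤ -k := by rw [← hσL]; gcongr
    calc Real.exp (s * L) ≤ Real.exp (-k) := Real.exp_le_exp.mpr this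
      _ = 1 / 2 := by rw [Real.exp_neg, hk, Real.exp_log (by norm_num)]; norm_num
  have hξ0 : ∀ (s φ : ℝ), qpow q s * (v * Complex.exp (φ * Complex.I)) ≠ 0 := fun s φ =>
    mul_ne_zero (qpow_ne_zero q s) (mul_ne_zero hv0 (Complex.exp_ne_zero _))
  have hlow : ∀ (s : ℝ), ∀ φ ∈ uIcc φ₁ φ₂,
      c₀ * Real.exp (P * (s * L + ℓ - Real.log ‖t‖) ^ 2) ≤
        ‖theta q (qpow q s * (v * Complex.exp (φ * Complex.I)) / (ε * t))‖ := by
    intro s φ hφ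
    have h1 := hθ (s - a) (Complex.exp (φ * Complex.I)) (Complex.norm_exp_ofReal_mul_I φ)
      (le_norm_one_sub_exp_of_mem_uIcc hφ₁ hφ₂ far1.le far2.le hφ)
    have e3 : (s - a) * L = s * L + ℓ - Real.log ‖t‖ := by linear_combination -haL
    have e4 : -(qpow q (s - a) * Complex.exp (φ * Complex.I)) =
        qpow q s * (v * Complex.exp (φ * Complex.I)) / (ε * t) := by
      have hz' : ε * t = -(qpow q a * v) := by rw [← hzv, neg_neg]
      have := qpow_ne_zero q a
      rw [hz', sub_eq_add_neg, qpow_add, qpow_neg]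
      field_simp
    rwa [e3, e4] at h1
  have hGd : ∀ s ≤ σ, ∀ φ ∈ uIcc φ₁ φ₂,
      DifferentiableAt ℂ G (qpow q s * (v * Complex.exp (φ * Complex.I))) := by
    intro s hs φ hφ
    have hx := hξ0 s φ
    have h1 := hdiff ε hε.1 _ hx ((hnorm s φ).trans_le (hhalf s hs)) n
    have h2 := hlow s φ hφ
    generalize qpow q s * (v * Complex.exp (φ * Complex.I)) = x at hx h1 h2
    refine h1.div ?_ fun h0 => ?_
    · exact DifferentiableAt.comp (g := theta q) x
        (differentiableAt_theta hq (div_ne_zero hx hz0)) (differentiableAt_id.div_const _)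
    · rw [h0, norm_zero] at h2
      exact absurd h2 (not_le.mpr (by positivity))
  have hGB : ∀ s ≤ σ, ∀ φ ∈ uIcc φ₁ φ₂,
      ‖G (qpow q s * (v * Complex.exp (φ * Complex.I)))‖ ≤ B s := by
    intro s hs φ hφ
    have hx := hξ0 s φ
    have hn := hnorm s φ
    have h1 := hbd ε hε.1 _ hx (hn.trans_le (hhalf s hs)) n
    have h2 := hlow s φ hφ
    have e3 : Real.log ‖qpow q s * (v * Complex.exp (φ * Complex.I)) / ε‖ = s * L + ℓ := by
      rw [norm_div, hn, Real.log_div (Real.exp_ne_zero _) (norm_ne_zero_iff.mpr hε0),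
        Real.log_exp, hℓd]
      ring
    rw [e3] at h1
    rw [hG, hB]
    simp only
    rw [norm_div, Real.exp_sub]
    calc _ ≤ n.factorial * (κ n * Real.exp (M * max (s * L + ℓ) 0 ^ 2)) /
          (c₀ * Real.exp (P * (s * L + ℓ - Real.log ‖t‖) ^ 2)) := by gcongr
      _ = _ := by field_simp
  have hB0 : Tendsto B atBot (𝓝 0) := by
    have := (tendsto_gaussian_atBot (e := ℓ) (y := Real.log ‖t‖) h.M_nonneg h.M_lt hL).const_mul
      (n.factorial * κ n / c₀)
    rwa [mul_zero] at this
  have hlog := complexLog_ne_zero hq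
  have e5 : ∀ s, qLaplaceIntegrand q l (W n ε) (ε * t) s =
      Complex.log q * G (qpow q s * (v * Complex.exp (φ₁ * Complex.I))) := by
    intro s
    rw [qLaplaceIntegrand_eq h.ne_zero, ← e₁]
  have e6 : ∀ s ∈ Iic σ, qLaplaceIntegrand q l' (W' n ε) (ε * t) s =
      Complex.log q * G (qpow q s * (v * Complex.exp (φ₂ * Complex.I))) := by
    intro s hs
    rw [qLaplaceIntegrand_eq h'.ne_zero, e₂,
      heq ε hε _ (hξ0 s φ₂) ((hnorm s φ₂).trans_le (hhalf s hs)) n]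
  have i1 : IntegrableOn (fun s : ℝ => G (qpow q s * (v * Complex.exp (φ₁ * Complex.I))))
      (Iic σ) := by
    have := ((h.integrable hε.1 ht n).integrableOn (s := Iic σ)).const_mul (Complex.log q)⁻¹
    refine IntegrableOn.congr_fun (f := fun s => _) this (fun s hs => ?_) measurableSet_Iic
    simp only
    rw [e5, inv_mul_cancel_left₀ hlog]
  have i2 : IntegrableOn (fun s : ℝ => G (qpow q s * (v * Complex.exp (φ₂ * Complex.I))))
      (Iic σ) := by
    have := ((h'.integrable hε.2 ht n).integrableOn (s := Iic σ)).const_mul (Complex.log q)⁻¹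
    refine IntegrableOn.congr_fun (f := fun s => _) this (fun s hs => ?_) measurableSet_Iic
    simp only
    rw [e6 s hs, inv_mul_cancel_left₀ hlog]
  have hmain := norm_integral_spiral_sub_le hGd hGB hB0 i1 i2
  rw [setIntegral_congr_fun measurableSet_Iic (fun s _ => e5 s),
    setIntegral_congr_fun measurableSet_Iic e6, integral_const_mul, integral_const_mul]
  refine hmain.trans ?_
  have hφ : |φ₂ - φ₁| ≤ 2 * Real.pi :=
    abs_le.mpr ⟨by linarith [hφ₁.2, hφ₂.1], by linarith [hφ₁.1, hφ₂.2]⟩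
  have hBσ : B σ ≤ n.factorial * κ n / c₀ * (Real.exp R * Real.exp (-A * ℓ ^ 2)) := by
    rw [hB, ← Real.exp_add]
    simp only
    gcongr
    rw [hσL, max_eq_left (by linarith)]
    have h2 : (-k + ℓ) ^ 2 ≤ (-k + ℓ - Real.log ‖t‖) ^ 2 := by
      have : 0 ≤ -k + ℓ := by linarith
      gcongr; linarith
    have h3 : P * (-k + ℓ) ^ 2 ≤ P * (-k + ℓ - Real.log ‖t‖) ^ 2 :=
      mul_le_mul_of_nonneg_left h2 (by linarith [h.M_nonneg])
    have h5 := flat_exponent_le (k := k) (ℓ := ℓ) hd.le hA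
    rw [← hR] at h5
    have h6 : (-k + ℓ) ^ 2 = (ℓ - k) ^ 2 := by ring
    rw [h6] at h3 ⊢
    linarith
  have e7 : Real.log ‖ε‖ ^ 2 = ℓ ^ 2 := by rw [hℓd]; ring
  rw [e7]
  calc B σ * |φ₂ - φ₁| ≤ n.factorial * κ n / c₀ * (Real.exp R * Real.exp (-A * ℓ ^ 2)) *
        (2 * Real.pi) := by gcongr
    _ = _ := by ring

/-- The `q`-Laplace transforms along two directions of functions that agree near the origin
differ by a function that is flat in `ε`. -/
lemma exists_norm_qLaplace_sub_le (h : IsLaplaceFamily q l E T W κ M P c)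
    (h' : IsLaplaceFamily q l' E' T W' κ' M P c') (hl : ‖l‖ = 1) (hl' : ‖l'‖ = 1) {δ A : ℝ}
    (hδ : 0 < δ) (hP : P < 1 / (2 * Real.log ‖q‖))
    (hfar : ∀ ε ∈ E, ∀ t ∈ T, ∀ r : ℝ, δ < ‖1 + l / (ε * t) * qpow q r‖)
    (hfar' : ∀ ε ∈ E', ∀ t ∈ T, ∀ r : ℝ, δ < ‖1 + l' / (ε * t) * qpow q r‖)
    (heq : ∀ ε ∈ E ∩ E', ∀ τ, τ ≠ 0 → ‖τ‖ ≤ 1 / 2 → ∀ n, W' n ε τ = W n ε τ)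
    (hdiff : ∀ ε ∈ E, ∀ τ, τ ≠ 0 → ‖τ‖ ≤ 1 / 2 → ∀ n, DifferentiableAt ℂ (W n ε) τ)
    (hbd : ∀ ε ∈ E, ∀ τ, τ ≠ 0 → ‖τ‖ ≤ 1 / 2 → ∀ n,
      ‖W n ε τ‖ ≤ n.factorial * (κ n * Real.exp (M * max (Real.log ‖τ / ε‖) 0 ^ 2)))
    (hA : A < P - M) :
    ∃ Γ : ℝ, 0 ≤ Γ ∧ ∀ ε ∈ E ∩ E', ∀ t ∈ T, ‖ε‖ ≤ 1 / 2 → ‖t‖ ≤ 1 → ∀ n,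
      ‖qLaplace q l (W n ε) (ε * t) - qLaplace q l' (W' n ε) (ε * t)‖ ≤
        n.factorial * (κ n + κ' n) * Γ * Real.exp (-A * Real.log ‖ε‖ ^ 2) := by
  obtain ⟨Γ₁, hΓ₁, b₁⟩ := h.exists_norm_tail_le hl hA
  obtain ⟨Γ₂, hΓ₂, b₂⟩ := h'.exists_norm_tail_le hl' hA
  obtain ⟨Γ₃, hΓ₃, b₃⟩ := h.exists_norm_head_sub_le h' hl hl' hδ hP hfar hfar' heq hdiff hbd hA
  refine ⟨‖(piq q)⁻¹‖ * (Γ₁ + Γ₂ + Γ₃), by positivity, fun ε hε t ht hε2 ht1 n => ?_⟩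
  have c₁ := b₁ ε hε.1 t ht hε2 ht1 n
  have c₂ := b₂ ε hε.2 t ht hε2 ht1 n
  have c₃ := b₃ ε hε t ht hε2 ht1 n
  have hκ := h.kappa_nonneg n
  have hκ' := h'.kappa_nonneg n
  set σ := -(Real.log 2 / Real.log ‖q‖)
  unfold qLaplace
  have i1 := h.integrable hε.1 ht n
  have i2 := h'.integrable hε.2 ht n
  rw [← intervalIntegral.integral_Iic_add_Ioi (b := σ) i1.integrableOn i1.integrableOn,
    ← intervalIntegral.integral_Iic_add_Ioi (b := σ) i2.integrableOn i2.integrableOn, ← mul_sub,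
    norm_mul]
  generalize (∫ s in Iic σ, qLaplaceIntegrand q l (W n ε) (ε * t) s) = x₁ at *
  generalize (∫ s in Iic σ, qLaplaceIntegrand q l' (W' n ε) (ε * t) s) = x₂ at *
  generalize (∫ s in Ioi σ, qLaplaceIntegrand q l (W n ε) (ε * t) s) = y₁ at *
  generalize (∫ s in Ioi σ, qLaplaceIntegrand q l' (W' n ε) (ε * t) s) = y₂ at *
  have hX := (Real.exp_pos (-A * Real.log ‖ε‖ ^ 2)).le
  generalize Real.exp (-A * Real.log ‖ε‖ ^ 2) = X at *
  have e : x₁ + y₁ - (x₂ + y₂) = (x₁ - x₂) + (y₁ - y₂) := by ring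
  have h1 : ‖x₁ + y₁ - (x₂ + y₂)‖ ≤ ‖x₁ - x₂‖ + (‖y₁‖ + ‖y₂‖) := by
    rw [e]
    exact (norm_add_le _ _).trans (by gcongr; exact norm_sub_le _ _)
  have h2 : ‖x₁ + y₁ - (x₂ + y₂)‖ ≤ n.factorial * (κ n + κ' n) * (Γ₁ + Γ₂ + Γ₃) * X := by
    have j1 : (n.factorial : ℝ) * κ n * Γ₁ * X ≤ n.factorial * (κ n + κ' n) * Γ₁ * X := by
      gcongr; linarith
    have j2 : (n.factorial : ℝ) * κ' n * Γ₂ * X ≤ n.factorial * (κ n + κ' n) * Γ₂ * X := by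
      gcongr; linarith
    have j3 : (n.factorial : ℝ) * κ n * Γ₃ * X ≤ n.factorial * (κ n + κ' n) * Γ₃ * X := by
      gcongr; linarith
    linarith
  exact (mul_le_mul_of_nonneg_left h2 (norm_nonneg _)).trans_eq (by ring)

end IsLaplaceFamily

end flatness

/-! ### Geometry of the spirals, and the difference of the full series. -/

section spirals

variable {q : ℂ}

/-- In the coordinate w = 2πiu + v log q, whose real part determines v, the set is an open
parallelogram, and exp is an open map. -/
lemma isOpen_intervalPair_U (hq : 1 < ‖q‖) (I : IntervalPair) : IsOpen (I.U q) := by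
  have hL : 0 < Real.log ‖q‖ := Real.log_pos hq
  have hpi := Real.pi_pos
  have e : I.U q = Complex.exp '' {w : ℂ |
      (w.im - w.re / Real.log ‖q‖ * q.arg) / (2 * Real.pi) ∈ Ioo I.u₀ I.u₁ ∧
        w.re / Real.log ‖q‖ ∈ Ioo I.v₀ I.v₁} := by
    ext x
    constructor
    · rintro ⟨u, hu, v, hv, rfl⟩
      refine ⟨2 * Real.pi * Complex.I * u + v * Complex.log q, ?_, ?_⟩
      · have e1 : (2 * Real.pi * Complex.I * u + v * Complex.log q : ℂ).re =
            v * Real.log ‖q‖ := by simp [Complex.log_re]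
        have e2 : (2 * Real.pi * Complex.I * u + v * Complex.log q : ℂ).im =
            2 * Real.pi * u + v * q.arg := by simp [Complex.log_im]
        rw [mem_ofPred_eq, e1, e2, mul_div_cancel_right₀ _ hL.ne', add_sub_cancel_right,
          mul_div_cancel_left₀ _ (by positivity)]
        exact ⟨hu, hv⟩
      · rw [Complex.exp_add]; rfl
    · rintro ⟨w, ⟨hu, hv⟩, rfl⟩
      refine ⟨_, hu, _, hv, ?_⟩
      rw [qpow, ← Complex.exp_add]
      congr 1
      apply Complex.ext
      · simp [Complex.log_re, -Complex.ofReal_div, hL.ne']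
      · simp only [Complex.add_im, Complex.mul_im, Complex.ofReal_re, Complex.ofReal_im,
          Complex.mul_re, Complex.I_re, Complex.I_im, Complex.log_im, Complex.log_re,
          Complex.re_ofNat, Complex.im_ofNat]
        field_simp
        ring
  rw [e]
  refine Complex.isOpenMap_exp _ ((isOpen_Ioo.preimage ?_).inter (isOpen_Ioo.preimage ?_))
  · fun_prop
  · fun_prop

lemma zero_notMem_intervalPair_U (I : IntervalPair) : (0 : ℂ) ∉ I.U q := by
  rintro ⟨u, -, v, -, h⟩
  exact mul_ne_zero (Complex.exp_ne_zero _) (qpow_ne_zero q v) h.symm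

lemma isOpen_spiralDown (hq : q ≠ 0) {U : Set ℂ} (hU : IsOpen U) : IsOpen (spiralDown q U) := by
  have e : spiralDown q U = ⋃ n : ℕ, (fun x => x * q ^ n) ⁻¹' U := by
    ext x
    simp only [spiralDown, mem_ofPred_eq, mem_iUnion, mem_preimage]
    constructor
    · rintro ⟨ε, hε, n, rfl⟩
      exact ⟨n, by rwa [inv_mul_cancel_right₀ (pow_ne_zero n hq)]⟩
    · rintro ⟨n, hn⟩
      exact ⟨_, hn, n, by rw [mul_inv_cancel_right₀ (pow_ne_zero n hq)]⟩
  rw [e]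
  exact isOpen_iUnion fun n => hU.preimage (by fun_prop)

lemma isOpen_spiralUp (hq : q ≠ 0) {T : Set ℂ} (hT : IsOpen T) : IsOpen (spiralUp q T) := by
  have e : spiralUp q T = ⋃ n : ℕ, (fun x => x * (q ^ n)⁻¹) ⁻¹' T := by
    ext x
    simp only [spiralUp, mem_ofPred_eq, mem_iUnion, mem_preimage]
    constructor
    · rintro ⟨t, ht, n, rfl⟩
      exact ⟨n, by rwa [mul_inv_cancel_right₀ (pow_ne_zero n hq)]⟩
    · rintro ⟨n, hn⟩
      exact ⟨_, hn, n, by rw [inv_mul_cancel_right₀ (pow_ne_zero n hq)]⟩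
  rw [e]
  exact isOpen_iUnion fun n => hT.preimage (by fun_prop)

lemma zero_notMem_spiralDown (hq : q ≠ 0) {U : Set ℂ} (hU : (0 : ℂ) ∉ U) :
    (0 : ℂ) ∉ spiralDown q U := by
  rintro ⟨ε, hε, n, h⟩
  rcases mul_eq_zero.mp h.symm with h | h
  · exact hU (h ▸ hε)
  · exact inv_ne_zero (pow_ne_zero n hq) h

lemma zero_notMem_spiralUp (hq : q ≠ 0) {T : Set ℂ} (hT : (0 : ℂ) ∉ T) :
    (0 : ℂ) ∉ spiralUp q T := by
  rintro ⟨t, ht, n, h⟩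
  rcases mul_eq_zero.mp h.symm with h | h
  · exact hT (h ▸ ht)
  · exact pow_ne_zero n hq h

lemma subset_spiralUp (q : ℂ) (T : Set ℂ) : T ⊆ spiralUp q T := fun t ht => ⟨t, ht, 0, by simp⟩

lemma mul_mem_spiralUp {T : Set ℂ} {t : ℂ} (ht : t ∈ spiralUp q T) : q * t ∈ spiralUp q T := by
  obtain ⟨t, ht, n, rfl⟩ := ht
  exact ⟨t, ht, n + 1, by ring⟩

/-- The whole spiral through a point of `V ∩ D(0, ρ)` lies in `V q^{ℝ₊}` or in the punctured
disc. -/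
lemma qpow_mul_mem_domain (hq : 1 < ‖q‖) {V : Set ℂ} {ρ : ℝ} {l : ℂ} (hl : l ∈ V ∩ Metric.ball 0 ρ)
    (hl0 : l ≠ 0) (s : ℝ) : qpow q s * l ∈ contSpiralUp q V ∪ puncturedDisc ρ := by
  rcases le_or_gt 0 s with hs | hs
  · exact Or.inl ⟨l, hl.1, s, hs, mul_comm _ _⟩
  · refine Or.inr ⟨?_, mul_ne_zero (qpow_ne_zero q s) hl0⟩
    have h1 := hl.2
    rw [mem_ball_zero_iff] at h1 ⊢
    refine lt_of_le_of_lt ?_ h1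
    rw [norm_mul, norm_qpow]
    refine mul_le_of_le_one_left (norm_nonneg _) (Real.exp_le_one_iff.mpr ?_)
    exact mul_nonpos_of_nonpos_of_nonneg hs.le (Real.log_pos hq).le

/-- The exponent r runs over all of ℝ and absorbs the integer powers of q carried by ε and t. -/
lemma IsAssociatedFamily.far_from_spirals {ι : Type*} {J : ι → IntervalPair} {δ ρ₀ : ℝ}
    {V : ι → Set ℂ} {T : Set ℂ} (h : IsAssociatedFamily q J δ ρ₀ V T) (hq : q ≠ 0) {i : ι} {l : ℂ}
    (hl : l ∈ V i ∩ Metric.ball 0 ρ₀) {ε t : ℂ} (hε : ε ∈ spiralDown q ((J i).U q))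
    (ht : t ∈ spiralUp q T) (r : ℝ) : δ < ‖1 + l / (ε * t) * qpow q r‖ := by
  obtain ⟨ε, hε, n, rfl⟩ := hε
  obtain ⟨t, ht, m, rfl⟩ := ht
  have h1 := h.far_from_zeros i t ht ε hε l hl ((m : ℝ) + -(n : ℝ) + -r)
  rw [qpow_add, qpow_add, qpow_neg, qpow_neg, qpow_natCast hq, qpow_natCast hq] at h1
  have e : l / (ε * (q ^ n)⁻¹ * (t * q ^ m)) * qpow q r =
      l / (ε * t * (q ^ m * (q ^ n)⁻¹ * (qpow q r)⁻¹)) := by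
    rw [div_mul_eq_mul_div, div_eq_div_iff_comm]
    simp only [div_eq_mul_inv, mul_inv]
    ring
  rwa [e]

lemma exists_isLaplaceFamily {l : ℂ} {E T D : Set ℂ} {W : ℕ → ℂ → ℂ → ℂ} {κ : ℕ → ℝ} {M P δ : ℝ}
    (hq : 1 < ‖q‖) (hEo : IsOpen E) (hE0 : (0 : ℂ) ∉ E) (hTo : IsOpen T) (hT0 : (0 : ℂ) ∉ T)
    (hTq : ∀ t ∈ T, q * t ∈ T) (hM : 0 ≤ M) (hMP : M < P) (hP : P < 1 / (2 * Real.log ‖q‖))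
    (hδ : 0 < δ) (hl0 : l ≠ 0) (hl : ∀ s : ℝ, qpow q s * l ∈ D) (hκ : ∀ n, 0 ≤ κ n)
    (hκs : ∀ ρ : ℝ, Summable fun n => κ n * ρ ^ n)
    (hbd : ∀ ε ∈ E, ∀ s : ℝ, ∀ n : ℕ, ‖W n ε (qpow q s * l)‖ ≤
      n.factorial * (κ n * Real.exp (M * max (Real.log ‖qpow q s * l / ε‖) 0 ^ 2)))
    (hfar : ∀ ε ∈ E, ∀ t ∈ T, ∀ r : ℝ, δ < ‖1 + l / (ε * t) * qpow q r‖)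
    (hW : ∀ n, DifferentiableOn ℂ (fun p : ℂ × ℂ => W n p.1 p.2) (E ×ˢ D)) :
    ∃ c : ℝ, IsLaplaceFamily q l E T W κ M P c := by
  obtain ⟨c, hc, hθ⟩ := exists_theta_lower_bound hq hP hδ
  exact ⟨c, {
    one_lt := hq
    ne_zero := hl0
    isOpen_E := hEo
    zero_notMem_E := hE0
    isOpen_T := hTo
    zero_notMem_T := hT0
    mul_mem := hTq
    M_nonneg := hM
    M_lt := hMP
    c_pos := hc
    kappa_nonneg := hκ
    summable_kappa := hκs
    norm_le := hbd
    theta_ge := fun ε hε t ht s => by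
      have hε0 : ε ≠ 0 := fun h => hE0 (h ▸ hε)
      have ht0 : t ≠ 0 := fun h => hT0 (h ▸ ht)
      refine hθ _ (div_ne_zero (mul_ne_zero (qpow_ne_zero q s) hl0) (mul_ne_zero hε0 ht0))
        fun r => ?_
      have h1 := hfar ε hε t ht (s + r)
      have e : qpow q s * l / (ε * t) * qpow q r = l / (ε * t) * qpow q (s + r) := by
        rw [qpow_add]; ring
      rwa [e]
    differentiableOn := fun n s =>
      (hW n).comp (f := fun ε => (ε, qpow q s * l)) (by fun_prop) fun ε hε => ⟨hε, hl s⟩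
    continuous := fun n ε hε => by
      refine (hW n).continuousOn.comp_continuous (f := fun s => (ε, qpow q s * l)) ?_
        fun s => ⟨hε, hl s⟩
      have := continuous_qpow q
      fun_prop }⟩

namespace IsLaplaceFamily

variable {l l' : ℂ} {E E' T : Set ℂ} {W W' : ℕ → ℂ → ℂ → ℂ} {κ κ' : ℕ → ℝ} {M P c c' : ℝ}

lemma exists_norm_tsum_le_of_norm_le_one (h : IsLaplaceFamily q l E T W κ M P c) (ρ : ℝ) :
    ∃ B : ℝ, 0 ≤ B ∧ ∀ ε ∈ E, ∀ t ∈ T, ‖t‖ ≤ 1 → ∀ z ∈ Metric.ball (0 : ℂ) ρ,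
      ‖∑' n : ℕ, qLaplace q l (W n ε) (ε * t) * (z ^ n / (n.factorial : ℂ))‖ ≤ B := by
  obtain ⟨Γ, hΓ, hb⟩ := h.exists_norm_qLaplace_le_of_norm_le_one
  have hs := (h.summable_kappa |ρ|).mul_right Γ
  refine ⟨∑' n, κ n * |ρ| ^ n * Γ, tsum_nonneg fun n => ?_, fun ε hε t ht ht1 z hz => ?_⟩
  · have := h.kappa_nonneg n; positivity
  · refine tsum_of_norm_bounded hs.hasSum fun n => ?_
    have hκ := h.kappa_nonneg n
    have hz' : ‖z‖ ≤ |ρ| := (mem_ball_zero_iff.mp hz).le.trans (le_abs_self ρ)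
    rw [norm_mul, norm_div, norm_pow, Complex.norm_natCast]
    calc _ ≤ n.factorial * κ n * Γ * (|ρ| ^ n / n.factorial) := by
          gcongr; exact hb ε hε t ht ht1 n
      _ = _ := by field_simp

/-- The sums of two families of `q`-Laplace transforms differ by a function that is flat in `ε`. -/
lemma exists_norm_tsum_sub_le (h : IsLaplaceFamily q l E T W κ M P c)
    (h' : IsLaplaceFamily q l' E' T W' κ' M P c') {δ A : ℝ}
    (hδ : 0 < δ) (hP : P < 1 / (2 * Real.log ‖q‖))
    (hfar : ∀ ε ∈ E, ∀ t ∈ T, ∀ r : ℝ, δ < ‖1 + l / (ε * t) * qpow q r‖)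
    (hfar' : ∀ ε ∈ E', ∀ t ∈ T, ∀ r : ℝ, δ < ‖1 + l' / (ε * t) * qpow q r‖)
    (heq : ∀ ε ∈ E ∩ E', ∀ τ, τ ≠ 0 → ‖τ‖ ≤ 1 / 2 → ∀ n, W' n ε τ = W n ε τ)
    (hdiff : ∀ ε ∈ E, ∀ τ, τ ≠ 0 → ‖τ‖ ≤ 1 / 2 → ∀ n, DifferentiableAt ℂ (W n ε) τ)
    (hbd : ∀ ε ∈ E, ∀ τ, τ ≠ 0 → ‖τ‖ ≤ 1 / 2 → ∀ n,
      ‖W n ε τ‖ ≤ n.factorial * (κ n * Real.exp (M * max (Real.log ‖τ / ε‖) 0 ^ 2)))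
    (hA0 : 0 ≤ A) (hA : A < P - M) (hE1 : ∀ ε ∈ E, ‖ε‖ ≤ 1) (ρ : ℝ) :
    ∃ C₁ : ℝ, 0 < C₁ ∧ ∀ ε ∈ E ∩ E', ∀ t ∈ T, ‖t‖ ≤ 1 → ∀ z ∈ Metric.ball (0 : ℂ) ρ,
      ‖(∑' n : ℕ, qLaplace q l (W n ε) (ε * t) * (z ^ n / (n.factorial : ℂ))) -
        ∑' n : ℕ, qLaplace q l' (W' n ε) (ε * t) * (z ^ n / (n.factorial : ℂ))‖ ≤
        C₁ * Real.exp (-A * Real.log ‖ε‖ ^ 2) := by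
  have hq := h.one_lt
  obtain ⟨u, hu, hlu⟩ := exists_polar hq h.ne_zero
  obtain ⟨u', hu', hlu'⟩ := exists_polar hq h'.ne_zero
  generalize Real.log ‖l‖ / Real.log ‖q‖ = a at hlu
  generalize Real.log ‖l'‖ / Real.log ‖q‖ = a' at hlu'
  subst hlu hlu'
  have far_unit : ∀ (a : ℝ) (u : ℂ) (z : ℂ), (∀ r : ℝ, δ < ‖1 + qpow q a * u / z * qpow q r‖) →
      ∀ r : ℝ, δ < ‖1 + u / z * qpow q r‖ := by
    intro a u z hz r
    have h1 := hz (-a + r)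
    have ha := qpow_ne_zero q a
    have e : qpow q a * u / z * qpow q (-a + r) = u / z * qpow q r := by
      rw [qpow_add, qpow_neg, mul_div_assoc, mul_comm (qpow q a), mul_assoc,
        mul_inv_cancel_left₀ ha]
    rwa [e] at h1
  obtain ⟨Γ, hΓ, hb⟩ := h.of_qpow_mul.exists_norm_qLaplace_sub_le h'.of_qpow_mul hu hu' hδ hP
    (fun ε hε t ht => far_unit a u _ (hfar ε hε t ht))
    (fun ε hε t ht => far_unit a' u' _ (hfar' ε hε t ht)) heq hdiff hbd hA
  obtain ⟨B, hB0, hB⟩ := h.exists_norm_tsum_le_of_norm_le_one ρ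
  obtain ⟨B', hB0', hB'⟩ := h'.exists_norm_tsum_le_of_norm_le_one ρ
  have hs : Summable fun n => (κ n + κ' n) * |ρ| ^ n * Γ := by
    refine (((h.summable_kappa |ρ|).add (h'.summable_kappa |ρ|)).mul_right Γ).congr fun n => ?_
    ring
  set F := ∑' n, (κ n + κ' n) * |ρ| ^ n * Γ with hF
  have hF0 : 0 ≤ F := tsum_nonneg fun n => by
    have := h.kappa_nonneg n
    have := h'.kappa_nonneg n
    positivity
  -- F serves |ε| ≤ 1/2. For 1/2 < |ε| ≤ 1 one has log²|ε| ≤ log² 2, so plain boundedness suffices;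
  -- the 1 only makes the constant positive.
  refine ⟨F + (B + B') * Real.exp (A * Real.log 2 ^ 2) + 1, by positivity,
    fun ε hε t ht ht1 z hz => ?_⟩
  have hε0 : ε ≠ 0 := fun h0 => h.zero_notMem_E (h0 ▸ hε.1)
  rcases le_or_gt ‖ε‖ (1 / 2) with hε2 | hε2
  · have s1 := ((h.isEntireSeq hε.1 ht).hasSum z)
    have s2 := ((h'.isEntireSeq hε.2 ht).hasSum z)
    rw [← s1.summable.tsum_sub s2.summable]
    have h1 : ‖∑' n : ℕ, (qLaplace q (qpow q a * u) (W n ε) (ε * t) * (z ^ n / (n.factorial : ℂ)) -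
        qLaplace q (qpow q a' * u') (W' n ε) (ε * t) * (z ^ n / (n.factorial : ℂ)))‖ ≤
        F * Real.exp (-A * Real.log ‖ε‖ ^ 2) := by
      refine tsum_of_norm_bounded (hs.hasSum.mul_right _) fun n => ?_
      have h2 := hb ε hε t ht hε2 ht1 n
      have hκ := h.kappa_nonneg n
      have hκ' := h'.kappa_nonneg n
      have hz' : ‖z‖ ≤ |ρ| := (mem_ball_zero_iff.mp hz).le.trans (le_abs_self ρ)
      rw [← sub_mul, norm_mul, norm_div, norm_pow, Complex.norm_natCast, qLaplace_qpow_mul,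
        qLaplace_qpow_mul]
      calc _ ≤ n.factorial * (κ n + κ' n) * Γ * Real.exp (-A * Real.log ‖ε‖ ^ 2) *
            (|ρ| ^ n / n.factorial) := by gcongr
        _ = _ := by field_simp
    refine h1.trans ?_
    gcongr
    have : 0 ≤ (B + B') * Real.exp (A * Real.log 2 ^ 2) := by positivity
    linarith
  · refine (norm_sub_le _ _).trans ((add_le_add (hB ε hε.1 t ht ht1 z hz)
      (hB' ε hε.2 t ht ht1 z hz)).trans ?_)
    have h1 : Real.log ‖ε‖ ^ 2 ≤ Real.log 2 ^ 2 := by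
      have h2 : Real.log ‖ε‖ ≤ 0 := Real.log_nonpos (norm_nonneg _) (hE1 ε hε.1)
      have h3 : -Real.log 2 ≤ Real.log ‖ε‖ := by
        rw [← Real.log_inv]
        exact Real.log_le_log (by norm_num) (by linarith)
      have h4 : 0 < Real.log 2 := Real.log_pos (by norm_num)
      exact sq_le_sq' h3 (by linarith)
    have h5 : 1 ≤ Real.exp (A * Real.log 2 ^ 2) * Real.exp (-A * Real.log ‖ε‖ ^ 2) := by
      rw [← Real.exp_add, Real.one_le_exp_iff]
      have := mul_le_mul_of_nonneg_left h1 hA0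
      linarith
    have h6 := (Real.exp_pos (-A * Real.log ‖ε‖ ^ 2)).le
    have h7 := mul_le_mul_of_nonneg_left h5 (add_nonneg hB0 hB0')
    calc B + B' ≤ (B + B') * Real.exp (A * Real.log 2 ^ 2) * Real.exp (-A * Real.log ‖ε‖ ^ 2) := by
          linarith
      _ ≤ _ := by gcongr; linarith

end IsLaplaceFamily

/-- A growth rate between `M` and `ξ / (2 log |q|)` that leaves room for both the formal solution
and the flatness. -/
lemma AssumptionC.exists_rate {M A₁ C ξ ξ' : ℝ} (hq : 1 < ‖q‖) (hA₁ : 0 < A₁) (hC : 0 < C)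
    (h : AssumptionC q M A₁ C ξ ξ') :
    ∃ M' : ℝ, M < M' ∧ M' < ξ / (2 * Real.log ‖q‖) ∧ C ^ 2 < 4 * A₁ * Real.log ‖q‖ * (M' - M) ∧
      0 ≤ (1 - ξ') * (ξ / (2 * Real.log ‖q‖) - M) ∧
      (1 - ξ') * (ξ / (2 * Real.log ‖q‖) - M) < ξ / (2 * Real.log ‖q‖) - M' := by
  obtain ⟨hξ0, hξ1, hξ0', hξ1', a₁, a₂, b₁, b₂, d₁, d₂, ha₁, ha₂, hb₁, hb₂, hd₁, hd₂, -, -, h3, h4⟩ :=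
    h
  have hL : 0 < Real.log ‖q‖ := Real.log_pos hq
  set L := Real.log ‖q‖
  have hp : 0 < d₂ / d₁ * L := by positivity
  set p := ξ / (2 * L) - M with hpd
  have hp0 : 0 < p := by linarith
  have h5 : C ^ 2 / (4 * ξ' * L * p) < A₁ := by
    have h6 : 0 < C * a₂ / a₁ := by positivity
    have h7 : 0 < A₁ * (d₂ * L / (d₁ * p)) := by positivity
    linarith
  rw [div_lt_iff₀ (by positivity)] at h5
  have h8 : C ^ 2 / (4 * A₁ * L) < ξ' * p := by
    rw [div_lt_iff₀ (by positivity)]; linarith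
  -- η = M' - M: the lower bound is the one the coefficient majorant requires, and the upper bound
  -- ξ' p is the flatness condition (1 - ξ') p < p - η.
  obtain ⟨η, hη1, hη2⟩ := exists_between h8
  have h9 : ξ' * p < p := mul_lt_of_lt_one_left hp0 hξ1'
  have hη0 : 0 < η := lt_of_le_of_lt (by positivity) hη1
  rw [div_lt_iff₀ (by positivity)] at hη1
  refine ⟨M + η, by linarith, by linarith, by linarith, ?_, by linarith⟩
  exact mul_nonneg (by linarith) hp0.le

end spirals

end QGevrey

/-! ### Assembly of the theorem. -/

theorem theorem3 {ι : Type*} [Finite ι]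
    (q : ℂ) (hq : 1 < ‖q‖)
    (M A₁ C : ℝ) (hM : 0 < M) (hA₁ : 0 < A₁) (hC : 0 < C)
    (S : ℕ) (hS : 1 ≤ S)
    (m₀ m₁ : ℕ → ℕ) (hm₀ : ∀ k < S, 0 < m₀ k) (hm₁ : ∀ k < S, 0 < m₁ k)
    (r₀ : ℝ) (hr₀ : 0 < r₀) (hr₀' : r₀ ≤ 1)
    (Is : ℕ → Finset ℕ) (b : ℕ → ℕ → ℂ → ℂ)
    (hb : ∀ k < S, ∀ s ∈ Is k, DifferentiableOn ℂ (b k s) (Metric.ball 0 r₀) ∧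
      ∃ B : ℝ, ∀ ε ∈ Metric.ball (0 : ℂ) r₀, ‖b k s ε‖ ≤ B)
    (J : ι → QGevrey.IntervalPair) (hJ : QGevrey.IsGoodCovering q J)
    (hJr : ∀ i, QGevrey.spiralDown q ((J i).U q) ⊆ Metric.ball 0 r₀)
    (δ ρ₀ : ℝ) (V : ι → Set ℂ) (T : Set ℂ)
    (hVT : QGevrey.IsAssociatedFamily q J δ ρ₀ V T)
    (W₀ : ℕ → ℂ → ℂ → ℂ) (WUV : ι → ℕ → ℂ → ℂ → ℂ)
    (hW : ∀ i, ∀ j < S, QGevrey.IsAdmissible q M r₀ ρ₀ ((J i).U q) (V i) (W₀ j) (WUV i j))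
    (l : ι → ℂ) (hl : ∀ i, l i ∈ V i ∩ Metric.ball 0 ρ₀)
    (hA : QGevrey.AssumptionA S Is m₀ m₁ A₁ C)
    (hB : M ≤ 1 / (2 * Real.log ‖q‖))
    (ξ ξ' : ℝ) (hξ : QGevrey.AssumptionC q M A₁ C ξ ξ') :
    ∃ (W : ι → ℕ → ℂ → ℂ → ℂ) (X : ι → ℂ → ℂ → ℂ → ℂ),
      (∀ i,
        -- the coefficients `W_β` are holomorphic and form the formal solution of the
        -- auxiliary Cauchy problem
        (∀ β, DifferentiableOn ℂ (fun p : ℂ × ℂ => W i β p.1 p.2)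
          (QGevrey.spiralDown q ((J i).U q) ×ˢ
            ((QGevrey.contSpiralUp q (V i) ∪ QGevrey.puncturedDisc ρ₀) \ {-1}))) ∧
        QGevrey.IsFormalSolution q S Is b m₀ m₁ (WUV i) (QGevrey.spiralDown q ((J i).U q))
          ((QGevrey.contSpiralUp q (V i) ∪ QGevrey.puncturedDisc ρ₀) \ {-1}) (W i) ∧
        -- `X_I` is the (convergent) series of their (convergent) `q`-Laplace transforms
        (∀ ε ∈ QGevrey.spiralDown q ((J i).U q), ∀ t ∈ QGevrey.spiralUp q T,
          (∀ β, MeasureTheory.Integrable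
            (QGevrey.qLaplaceIntegrand q (l i) (W i β ε) (ε * t))) ∧
          ∀ z : ℂ, HasSum
            (fun β : ℕ => QGevrey.qLaplace q (l i) (W i β ε) (ε * t) *
              (z ^ β / (β.factorial : ℂ)))
            (X i ε t z)) ∧
        -- `X_I` is holomorphic, and bounded as long as `z` stays in a bounded set
        DifferentiableOn ℂ (fun p : ℂ × ℂ × ℂ => X i p.1 p.2.1 p.2.2)
          (QGevrey.spiralDown q ((J i).U q) ×ˢ QGevrey.spiralUp q T ×ˢ Set.univ) ∧
        (∀ ρ : ℝ, 0 < ρ → ∃ B : ℝ, ∀ ε ∈ QGevrey.spiralDown q ((J i).U q), ∀ t ∈ T,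
          ∀ z ∈ Metric.ball (0 : ℂ) ρ, ‖X i ε t z‖ ≤ B) ∧
        -- `X_I` solves the Cauchy problem
        QGevrey.SolvesEquation q S Is b m₀ m₁ (QGevrey.spiralDown q ((J i).U q))
          (QGevrey.spiralUp q T) (X i) ∧
        (∀ ε ∈ QGevrey.spiralDown q ((J i).U q), ∀ t ∈ QGevrey.spiralUp q T, ∀ j < S,
          iteratedDeriv j (X i ε t) 0 = QGevrey.qLaplace q (l i) (WUV i j ε) (ε * t))) ∧
      -- flatness of the differences
      (∀ ρ : ℝ, 0 < ρ → ∀ i i' : ι,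
        (QGevrey.spiralDown q ((J i).U q) ∩ QGevrey.spiralDown q ((J i').U q)).Nonempty →
        ∃ C₁ : ℝ, 0 < C₁ ∧
          ∀ ε ∈ QGevrey.spiralDown q ((J i).U q) ∩ QGevrey.spiralDown q ((J i').U q),
            ∀ t ∈ T, ∀ z ∈ Metric.ball (0 : ℂ) ρ,
              ‖X i ε t z - X i' ε t z‖ ≤
                C₁ * Real.exp (-((1 - ξ') * (ξ / (2 * Real.log ‖q‖) - M)) *
                  Real.log ‖ε‖ ^ 2)) := by
  classical
  have hq0 := QGevrey.ne_zero_of_one_lt_norm hq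
  have hδ := hVT.delta_pos
  have hρ₀ := hVT.one_lt_rho
  obtain ⟨M', hMM', hM'P, hCM', hA0, hAlt⟩ := hξ.exists_rate hq hA₁ hC
  have hP : ξ / (2 * Real.log ‖q‖) < 1 / (2 * Real.log ‖q‖) := by
    have := Real.log_pos hq
    exact div_lt_div_of_pos_right hξ.2.1 (by positivity)
  have hEo : ∀ i, IsOpen (QGevrey.spiralDown q ((J i).U q)) := fun i =>
    QGevrey.isOpen_spiralDown hq0 (QGevrey.isOpen_intervalPair_U hq _)
  have hE0 : ∀ i, (0 : ℂ) ∉ QGevrey.spiralDown q ((J i).U q) := fun i =>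
    QGevrey.zero_notMem_spiralDown hq0 (QGevrey.zero_notMem_intervalPair_U _)
  have hl0 : ∀ i, l i ≠ 0 := fun i h => hVT.zero_notMem_V i (h ▸ (hl i).1)
  have hspiral : ∀ i s, δ < ‖QGevrey.qpow q s * l i + 1‖ := fun i s =>
    hVT.far_from_neg_one i _ ⟨l i, (hl i).1, s, mul_comm _ _⟩
  have hpole : ∀ i s, QGevrey.qpow q s * l i ≠ -1 := fun i s h => by
    have := hspiral i s
    rw [h, neg_add_cancel, norm_zero] at this
    linarith
  have hmem : ∀ i s, QGevrey.qpow q s * l i ∈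
      QGevrey.contSpiralUp q (V i) ∪ QGevrey.puncturedDisc ρ₀ := fun i s =>
    QGevrey.qpow_mul_mem_domain hq (hl i) (hl0 i) s
  have hdisc : ∀ τ : ℂ, τ ≠ 0 → ‖τ‖ ≤ 1 / 2 → τ ∈ QGevrey.puncturedDisc ρ₀ := fun τ hτ0 hτ =>
    ⟨by rw [mem_ball_zero_iff]; linarith, hτ0⟩
  have hneg : ∀ τ : ℂ, ‖τ‖ ≤ 1 / 2 → 1 / 2 ≤ ‖τ + 1‖ := fun τ hτ => by
    have := norm_sub_le (τ + 1) τ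
    rw [add_sub_cancel_left, norm_one] at this
    linarith
  have hfar : ∀ i, ∀ ε ∈ QGevrey.spiralDown q ((J i).U q), ∀ t ∈ QGevrey.spiralUp q T, ∀ r : ℝ,
      δ < ‖1 + l i / (ε * t) * QGevrey.qpow q r‖ := fun i ε hε t ht r =>
    hVT.far_from_spirals hq0 (hl i) hε ht r
  have hdiff : ∀ i n, DifferentiableOn ℂ
      (fun p : ℂ × ℂ => QGevrey.auxCoeff q S Is b m₀ m₁ (WUV i) p.1 p.2 n)
      (QGevrey.spiralDown q ((J i).U q) ×ˢ
        ((QGevrey.contSpiralUp q (V i) ∪ QGevrey.puncturedDisc ρ₀) \ {-1})) := fun i n => by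
    refine QGevrey.differentiableOn_auxCoeff (fun ε hε h => hE0 i (h ▸ hε)) (fun τ hτ => hτ.2)
      (fun k hk s hs => (hb k hk s hs).1.mono (hJr i)) (fun j hj => ?_) n
    obtain ⟨-, -, -, -, -, -, -, -, h, -⟩ := hW i j hj
    exact h.mono (Set.prod_mono_right Set.sdiff_subset)
  obtain ⟨B, hB0, hB⟩ : ∃ B : ℝ, 0 ≤ B ∧ ∀ ε ∈ Metric.ball (0 : ℂ) r₀, ∀ k < S, ∀ s ∈ Is k,
      ‖b k s ε‖ ≤ B := by
    choose! B hB using fun k hk s hs => (hb k hk s hs).2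
    refine ⟨∑ k ∈ Finset.range S, ∑ s ∈ Is k, |B k s|, by positivity, fun ε hε k hk s hs => ?_⟩
    calc ‖b k s ε‖ ≤ |B k s| := (hB k hk s hs ε hε).trans (le_abs_self _)
      _ ≤ ∑ s ∈ Is k, |B k s| :=
        Finset.single_le_sum (f := fun s => |B k s|) (fun s _ => abs_nonneg _) hs
      _ ≤ _ := Finset.single_le_sum (f := fun k => ∑ s ∈ Is k, |B k s|) (fun k _ => by positivity)
        (Finset.mem_range.mpr hk)
  -- One lower bound for |τ + 1| has to serve both regions: δ on the spiral through `l i`, and 1/2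
  -- on the disc |τ| ≤ 1/2 used in the contour deformation.
  have hδ' : 0 < min δ (1 / 2) := by positivity
  have key : ∀ i, ∃ κ : ℕ → ℝ, ∃ c : ℝ,
      QGevrey.IsLaplaceFamily q (l i) (QGevrey.spiralDown q ((J i).U q)) (QGevrey.spiralUp q T)
        (fun n ε τ => QGevrey.auxCoeff q S Is b m₀ m₁ (WUV i) ε τ n) κ M'
        (ξ / (2 * Real.log ‖q‖)) c ∧
      ∀ ε ∈ QGevrey.spiralDown q ((J i).U q), ∀ τ, τ ≠ 0 → ‖τ‖ ≤ 1 / 2 → ∀ n,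
        ‖QGevrey.auxCoeff q S Is b m₀ m₁ (WUV i) ε τ n‖ ≤
          n.factorial * (κ n * Real.exp (M' * max (Real.log ‖τ / ε‖) 0 ^ 2)) := by
    intro i
    choose! D₀ hD₀ hD using fun j hj =>
      (hW i j hj).exists_norm_le (hJr i) (hE0 i) hr₀' hρ₀
    obtain ⟨κ, hκ, hκs, hbd⟩ := QGevrey.exists_auxCoeff_majorant (w := WUV i)
      (D := QGevrey.contSpiralUp q (V i) ∪ QGevrey.puncturedDisc ρ₀)
      (D₀ := ∑ j ∈ Finset.range S, |D₀ j|) hq hA hA₁ hC.le hCM' hB0 hδ' (by positivity) (hE0 i)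
      (fun ε hε => hB ε (hJr i hε)) (fun j hj ε hε τ hτ hτ0 => by
        refine (hD j hj ε hε τ hτ hτ0).trans ?_
        gcongr
        exact (le_abs_self _).trans (Finset.single_le_sum (f := fun j => |D₀ j|)
          (fun j _ => abs_nonneg _) (Finset.mem_range.mpr hj)))
    obtain ⟨c, hc⟩ := QGevrey.exists_isLaplaceFamily
      (W := fun n ε τ => QGevrey.auxCoeff q S Is b m₀ m₁ (WUV i) ε τ n) (κ := κ)
      hq (hEo i) (hE0 i) (QGevrey.isOpen_spiralUp hq0 hVT.isOpen_T)
      (QGevrey.zero_notMem_spiralUp hq0 hVT.zero_notMem_T)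
      (fun t ht => QGevrey.mul_mem_spiralUp ht) (hM.trans hMM').le hM'P hP hδ (hl0 i)
      (D := (QGevrey.contSpiralUp q (V i) ∪ QGevrey.puncturedDisc ρ₀) \ {-1})
      (fun s => ⟨hmem i s, hpole i s⟩) hκ hκs
      (fun ε hε s n => hbd ε hε _ (hmem i s) (mul_ne_zero (QGevrey.qpow_ne_zero q s) (hl0 i))
        ((min_le_left _ _).trans (hspiral i s).le) n) (hfar i) (hdiff i)
    exact ⟨κ, c, hc, fun ε hε τ hτ0 hτ n => hbd ε hε τ (Or.inr (hdisc τ hτ0 hτ)) hτ0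
      ((min_le_right _ _).trans (hneg τ hτ)) n⟩
  choose κ c hfam hbd using key
  have hdisc_open : IsOpen (QGevrey.puncturedDisc ρ₀ \ {-1}) :=
    (Metric.isOpen_ball.sdiff isClosed_singleton).sdiff isClosed_singleton
  refine ⟨fun i n ε τ => QGevrey.auxCoeff q S Is b m₀ m₁ (WUV i) ε τ n, fun i ε t z =>
    ∑' n : ℕ, QGevrey.qLaplace q (l i)
      (fun τ => QGevrey.auxCoeff q S Is b m₀ m₁ (WUV i) ε τ n) (ε * t) *
        (z ^ n / (n.factorial : ℂ)), fun i => ⟨hdiff i, QGevrey.isFormalSolution_auxCoeff _ _,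
    fun ε hε t ht => ⟨(hfam i).integrable hε ht, ((hfam i).isEntireSeq hε ht).hasSum⟩,
    (hfam i).differentiableOn_tsum, fun ρ _ => ?_, (hfam i).solvesEquation (hpole i),
    fun ε hε t ht j hj => ?_⟩, fun ρ _ i i' _ => ?_⟩
  · obtain ⟨B, -, hB⟩ := (hfam i).exists_norm_tsum_le_of_norm_le_one ρ
    exact ⟨B, fun ε hε t ht => hB ε hε t (QGevrey.subset_spiralUp q T ht) (hVT.norm_le_one t ht)⟩
  · have h := ((hfam i).isEntireSeq hε ht).iteratedDeriv j
    refine (congrFun h 0).trans ?_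
    rw [QGevrey.tsum_entire_zero]
    simp only [zero_add, QGevrey.auxCoeff_of_lt hj]
  -- All sectors share the same W_j on the punctured disc; this common germ makes the two inner
  -- integrands agree.
  · have hWeq : ∀ i, ∀ j < S, ∀ ε ∈ QGevrey.spiralDown q ((J i).U q),
        ∀ τ ∈ QGevrey.puncturedDisc ρ₀, WUV i j ε τ = W₀ j ε τ := by
      intro i j hj
      obtain ⟨-, -, -, -, -, -, -, -, -, h, -⟩ := hW i j hj
      exact h
    obtain ⟨C₁, hC₁, h⟩ := (hfam i).exists_norm_tsum_sub_le (hfam i') hδ hP (hfar i) (hfar i')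
      (fun ε hε τ hτ0 hτ n => QGevrey.auxCoeff_congr (fun j hj => by
        rw [hWeq i j hj ε hε.1 τ (hdisc τ hτ0 hτ), hWeq i' j hj ε hε.2 τ (hdisc τ hτ0 hτ)]) n)
      (fun ε hε τ hτ0 hτ n => by
        have hτ1 : τ ∈ QGevrey.puncturedDisc ρ₀ \ {-1} := ⟨hdisc τ hτ0 hτ, by
          rintro rfl
          norm_num at hτ⟩
        have h1 : DifferentiableOn ℂ
            (fun τ => QGevrey.auxCoeff q S Is b m₀ m₁ (WUV i) ε τ n)
            (QGevrey.puncturedDisc ρ₀ \ {-1}) :=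
          (hdiff i n).comp (f := fun τ => (ε, τ)) (by fun_prop) fun τ hτ =>
            ⟨hε, Or.inr hτ.1, hτ.2⟩
        exact h1.differentiableAt (hdisc_open.mem_nhds hτ1))
      (hbd i) hA0 hAlt (fun ε hε => (mem_ball_zero_iff.mp (hJr i hε)).le.trans hr₀') ρ
    exact ⟨C₁, hC₁, fun ε hε t ht => h ε hε t (QGevrey.subset_spiralUp q T ht)
      (hVT.norm_le_one t ht)⟩
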